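/- Let $Q$ be an $n$-dimensional smooth manifold (without boundary), let $k\ge 1$, and for $r \ge 0$ let $T^rQ$ be the $r$-th order tangent bundle of $Q$, i.e. the manifold of $r$-jets at $0$ of smooth curves in $Q$, with natural coordinates $(q_0^A,\dots,q_r^A)$, $q_i^A=\frac{d^i\sigma^A}{dt^i}(0)$, and projections $\rho^r_s\colon T^rQ\to T^sQ$ ($s\le r$), $\beta^r=\rho^r_0\colon T^rQ\to Q$. Let $L\in C^\infty(T^kQ)$. Let $\theta_L=\sum_{r=1}^k\frac{(-1)^{r-1}}{r!}\,d_T^{\,r-1}d_{J_r}L\in\Omega^1(T^{2k-1}Q)$ and $\omega_L=-d\theta_L$. Here $d_{J_r}L=dL\circ J_r$, where $J_r=\sum_{i=0}^{k-r}\frac{(r+i)!}{i!}\,dq_i^A\otimes\frac{\partial}{\partial q_{r+i}^A}$ is the $r$-th vertical endomorphism of $T(T^kQ)$, and $d_T$ is Tulczyjew's derivation, i.e. the derivation of degree $0$ on forms that commutes with $d$ and satisfies $d_Tf=\sum_i q_{i+1}^A\frac{\partial f}{\partial q_i^A}$ on functions. The Legendre–Ostrogradsky map $FL\colon T^{2k-1}Q\to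 T^*(T^{k-1}Q)$ is defined by $\theta_L(u)=\langle T\rho^{2k-1}_{k-1}(u),FL(p)\rangle$ for all $u\in T_p(T^{2k-1}Q)$. The Lagrangian $L$ is called regular if $\omega_L$ is a symplectic form (equivalently, if the Hessian matrix $\left(\frac{\partial^2L}{\partial q_k^B\partial q_k^A}\right)$ is nondegenerate at every point of $T^kQ$). Let $W=T^{2k-1}Q\times_{T^{k-1}Q}T^*(T^{k-1}Q)$, with projections $\mathrm{pr}_1,\mathrm{pr}_2$ onto the two factors. Let $\Omega=\mathrm{pr}_2^*\omega_{k-1}$, where $\omega_{k-1}$ is the canonical symplectic form of $T^*(T^{k-1}Q)$ (in natural coordinates $\omega_{k-1}=dq_i^A\wedge dp^i_A$). Let $H(p,\alpha)=\langle\alpha, j_k(p)\rangle-L(\rho^{2k-1}_k(p))$, where $j_k\colon T^{2k-1}Q\to T(T^{k-1}Q)$ sends the $(2k-1)$-jet at $0$ of a curve $\sigma$ to the velocity at $t=0$ of the canonical lifting of $\sigma$ to $T^{k-1}Q$. Let $W_o=\{(p,FL(p)) : p\in T^{2k-1}Q\}\subset W$ be the graph of $FL$, a submanifold of $W$ diffeomorphic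 to $T^{2k-1}Q$ through $\mathrm{pr}_1$. If $L$ is regular, then there is a unique smooth vector field $X$ in $W$ with support on $W_o$ (i.e. a smooth assignment of a vector $X(w)\in T_wW$ to each $w\in W_o$) such that $$\left[i(X)\Omega-dH\right]\big|_{W_o}=0$$ (as an equality of covectors of $W$ at each point of $W_o$) and $X$ is tangent to $W_o$. This $X$ is a semispray of type $1$ in $W$: for every integral curve $\sigma\colon I\subset\mathbb R\to W$ of $X$ ($I$ open), the curve $\sigma_1=\mathrm{pr}_1\circ\sigma$ is the canonical lifting to $T^{2k-1}Q$ of the curve $\gamma=\beta^{2k-1}\circ\sigma_1$, i.e. $\tilde\gamma^{2k-1}=\sigma_1$. -/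

import Mathlib

open Set Filter Topology Bundle
open scoped Manifold ContDiff

noncomputable section

namespace HigherOrder

section Jets

variable (E : Type*) [NormedAddCommGroup E] [NormedSpace ℝ E]
  (k : ℕ) (Q : Type*) [TopologicalSpace Q] [ChartedSpace E Q]

/-- Curves in `Q` that are smooth at `0`; only their germ at `0` matters below. -/
abbrev Curve : Type _ := {σ : ℝ → Q // ContMDiffAt 𝓘(ℝ, ℝ) 𝓘(ℝ, E) ∞ σ 0}

/-- The `k`-jet equivalence relation at `0`: same value, and same derivatives up to order `k` in a
chart around that value. -/
def jetSetoid : Setoid (Curve E Q) where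
  r σ τ := σ.1 0 = τ.1 0 ∧ ∀ i ≤ k,
    iteratedDeriv i (chartAt E (σ.1 0) ∘ σ.1) 0 = iteratedDeriv i (chartAt E (σ.1 0) ∘ τ.1) 0
  iseqv :=
    { refl := fun _ => ⟨rfl, fun _ _ => rfl⟩
      symm := fun {_ _} h => ⟨h.1.symm, fun i hi => by rw [← h.1]; exact (h.2 i hi).symm⟩
      trans := fun {_ _ _} h h' =>
        ⟨h.1.trans h'.1, fun i hi => (h.2 i hi).trans (by rw [h.1]; exact h'.2 i hi)⟩ }

/-- The `k`-th order tangent bundle `T^k Q`: `k`-jets at `0` of curves in `Q`. -/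
def HTangent : Type _ := Quotient (jetSetoid E k Q)

/-- The model space `E^{k+1}` of `T^k Q`, with the coordinates `(q_0, …, q_k)`. -/
abbrev JetModel : Type _ := Fin (k + 1) → E

variable {E k Q}

/-- The `k`-jet at `0` of a curve. -/
def HTangent.mk (σ : Curve E Q) : HTangent E k Q := Quotient.mk (jetSetoid E k Q) σ

/-- The projection `β^k : T^k Q → Q`. -/
def HTangent.base : HTangent E k Q → Q := Quotient.lift (fun σ => σ.1 0) (fun _ _ h => h.1)

/-- The projection `ρ^k_r : T^k Q → T^r Q`, for `r ≤ k`. -/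
def HTangent.proj {r : ℕ} (h : r ≤ k) : HTangent E k Q → HTangent E r Q :=
  Quotient.map' id (fun _ _ h' => ⟨h'.1, fun i hi => h'.2 i (hi.trans h)⟩)

variable (E k) in
/-- The curve `s ↦ γ (s + t)`, when `γ` is smooth at `t`. -/
def Curve.shift (γ : ℝ → Q) (t : ℝ) (h : ContMDiffAt 𝓘(ℝ, ℝ) 𝓘(ℝ, E) ∞ γ t) : Curve E Q :=
  ⟨fun s => γ (s + t), by
    have h1 : ContMDiffAt 𝓘(ℝ, ℝ) 𝓘(ℝ, ℝ) ∞ (fun s : ℝ => s + t) 0 :=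
      (contDiff_id.add contDiff_const).contMDiff.contMDiffAt
    exact ContMDiffAt.comp (I' := 𝓘(ℝ, ℝ)) 0 (by simpa using h) h1⟩

/-- The value at `t` of the canonical lifting of the curve `γ` to `T^k Q`. -/
def lift (k : ℕ) (γ : ℝ → Q) (t : ℝ) (h : ContMDiffAt 𝓘(ℝ, ℝ) 𝓘(ℝ, E) ∞ γ t) : HTangent E k Q :=
  HTangent.mk (Curve.shift E γ t h)

/-- The coordinates `(q_0, …, q_k)` of a jet in the chart `e` of `Q`. -/
def coords (e : OpenPartialHomeomorph Q E) (p : HTangent E k Q) : JetModel E k :=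
  fun i => iteratedDeriv i (e ∘ (Quotient.out p).1) 0

/-- The curve `t ↦ ∑ q_j t^j / j!`. -/
def taylorCurve (q : JetModel E k) (t : ℝ) : E :=
  ∑ j : Fin (k + 1), (t ^ (j : ℕ)) • (((j : ℕ).factorial : ℝ)⁻¹ • q j)

open Classical in
/-- The jet with coordinates `q` in the chart `e` of `Q`. -/
def ofCoords (e : OpenPartialHomeomorph Q E) (q : JetModel E k) : HTangent E k Q :=
  HTangent.mk <|
    if h : ContMDiffAt 𝓘(ℝ, ℝ) 𝓘(ℝ, E) ∞ (e.symm ∘ taylorCurve q) 0 then ⟨_, h⟩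
    else ⟨fun _ => e.symm (q 0), contMDiffAt_const⟩

lemma contDiff_taylorCurve (q : JetModel E k) : ContDiff ℝ ∞ (taylorCurve q) := by
  unfold taylorCurve
  fun_prop

lemma iteratedDeriv_taylorCurve (q : JetModel E k) (i : Fin (k + 1)) :
    iteratedDeriv i (taylorCurve q) 0 = q i := by
  unfold taylorCurve
  rw [iteratedDeriv_fun_sum (fun j _ => by fun_prop), Finset.sum_eq_single i]
  · rw [iteratedDeriv_smul_const (by fun_prop), iteratedDeriv_fun_pow_zero, if_pos rfl, smul_smul,
      mul_inv_cancel₀ (by positivity), one_smul]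
  · intro j _ hj
    rw [iteratedDeriv_smul_const (by fun_prop), iteratedDeriv_fun_pow_zero,
      if_neg (fun h => hj (Fin.ext h.symm)), Nat.cast_zero, zero_smul]
  · simp

lemma taylorCurve_zero (q : JetModel E k) : taylorCurve q 0 = q 0 := by
  simpa using iteratedDeriv_taylorCurve q 0

lemma iteratedDeriv_comp_congr {F : Type*} [NormedAddCommGroup F] [NormedSpace ℝ F]
    {h : E → F} {f g : ℝ → E} (hf : ContDiffAt ℝ ∞ f 0)
    (hg : ContDiffAt ℝ ∞ g 0) (hh : ContDiffAt ℝ ∞ h (f 0))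
    (hfg : ∀ i ≤ k, iteratedDeriv i f 0 = iteratedDeriv i g 0) {i : ℕ} (hi : i ≤ k) :
    iteratedDeriv i (h ∘ f) 0 = iteratedDeriv i (h ∘ g) 0 := by
  have h0 : f 0 = g 0 := by simpa using hfg 0 (Nat.zero_le _)
  have hi' : (i : WithTop ℕ∞) ≤ ∞ := by exact_mod_cast le_top
  rw [iteratedDeriv_vcomp_eq_sum_orderedFinpartition hh hf hi',
    iteratedDeriv_vcomp_eq_sum_orderedFinpartition (h0 ▸ hh) hg hi', h0]
  refine Finset.sum_congr rfl fun c _ => ?_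
  congr 1
  funext j
  exact hfg _ ((c.partSize_le j).trans hi)

lemma comp_eventuallyEq {e e' : OpenPartialHomeomorph Q E} (σ : Curve E Q)
    (h : σ.1 0 ∈ e.source) : e' ∘ σ.1 =ᶠ[𝓝 0] (e' ∘ e.symm) ∘ (e ∘ σ.1) := by
  filter_upwards [σ.2.continuousAt.preimage_mem_nhds (e.open_source.mem_nhds h)] with t ht
  simp [e.left_inv ht]

lemma base_mk (σ : Curve E Q) : (HTangent.mk σ : HTangent E k Q).base = σ.1 0 := rfl

lemma base_proj {r : ℕ} (h : r ≤ k) (p : HTangent E k Q) : (p.proj h).base = p.base := by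
  induction p using Quotient.inductionOn with
  | h σ => rfl

variable [IsManifold 𝓘(ℝ, E) ∞ Q]

lemma contDiffAt_chart_comp {e : OpenPartialHomeomorph Q E} (he : e ∈ atlas E Q) (σ : Curve E Q)
    (h : σ.1 0 ∈ e.source) : ContDiffAt ℝ ∞ (e ∘ σ.1) 0 :=
  contMDiffAt_iff_contDiffAt.1
    ((contMDiffAt_of_mem_maximalAtlas (IsManifold.subset_maximalAtlas he) h).comp 0 σ.2)

lemma contDiffAt_transition {e e' : OpenPartialHomeomorph Q E} (he : e ∈ atlas E Q)
    (he' : e' ∈ atlas E Q) {x : E} (hx : x ∈ e.target) (hx' : e.symm x ∈ e'.source) :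
    ContDiffAt ℝ ∞ (e' ∘ e.symm) x :=
  contMDiffAt_iff_contDiffAt.1
    ((contMDiffAt_of_mem_maximalAtlas (IsManifold.subset_maximalAtlas he') hx').comp x
      (contMDiffAt_symm_of_mem_maximalAtlas (IsManifold.subset_maximalAtlas he) hx))

/-- The coordinates of a jet can be computed on any representative. -/
lemma coords_mk {e : OpenPartialHomeomorph Q E} (he : e ∈ atlas E Q) (σ : Curve E Q)
    (h : σ.1 0 ∈ e.source) (i : Fin (k + 1)) :
    coords e (HTangent.mk σ : HTangent E k Q) i = iteratedDeriv i (e ∘ σ.1) 0 := by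
  set τ : Curve E Q := Quotient.out (HTangent.mk σ : HTangent E k Q) with hτ
  have hr : (jetSetoid E k Q).r τ σ := Quotient.exact (Quotient.out_eq _)
  have h0 : τ.1 0 ∈ e.source := by rw [hr.1]; exact h
  have hs : τ.1 0 ∈ (chartAt E (τ.1 0)).source := mem_chart_source E _
  have hs' : σ.1 0 ∈ (chartAt E (τ.1 0)).source := by rw [← hr.1]; exact hs
  change iteratedDeriv i (e ∘ τ.1) 0 = _
  rw [(comp_eventuallyEq τ hs).iteratedDeriv_eq, (comp_eventuallyEq σ hs').iteratedDeriv_eq]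
  refine iteratedDeriv_comp_congr (contDiffAt_chart_comp (chart_mem_atlas E _) τ hs)
    (contDiffAt_chart_comp (chart_mem_atlas E _) σ hs') ?_ hr.2 (Nat.lt_succ_iff.1 i.2)
  exact contDiffAt_transition (chart_mem_atlas E _) he
    ((chartAt E (τ.1 0)).map_source hs) (by simpa using h0)

lemma coords_zero {e : OpenPartialHomeomorph Q E} (he : e ∈ atlas E Q) (p : HTangent E k Q)
    (h : p.base ∈ e.source) : coords e p 0 = e p.base := by
  induction p using Quotient.inductionOn with
  | h σ => exact (coords_mk he σ h 0).trans (by simp; rfl)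

lemma contMDiffAt_symm_taylorCurve {e : OpenPartialHomeomorph Q E} (he : e ∈ atlas E Q)
    {q : JetModel E k} (hq : q 0 ∈ e.target) :
    ContMDiffAt 𝓘(ℝ, ℝ) 𝓘(ℝ, E) ∞ (e.symm ∘ taylorCurve q) 0 :=
  ContMDiffAt.comp (I' := 𝓘(ℝ, E)) 0
    (contMDiffAt_symm_of_mem_maximalAtlas (IsManifold.subset_maximalAtlas he)
      (by rwa [taylorCurve_zero])) (contDiff_taylorCurve q).contMDiff.contMDiffAt

lemma ofCoords_eq {e : OpenPartialHomeomorph Q E} (he : e ∈ atlas E Q)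
    {q : JetModel E k} (hq : q 0 ∈ e.target) :
    ofCoords e q = HTangent.mk ⟨_, contMDiffAt_symm_taylorCurve he hq⟩ := by
  rw [ofCoords, dif_pos (contMDiffAt_symm_taylorCurve he hq)]

lemma base_ofCoords {e : OpenPartialHomeomorph Q E} (he : e ∈ atlas E Q)
    {q : JetModel E k} (hq : q 0 ∈ e.target) : (ofCoords e q).base = e.symm (q 0) := by
  rw [ofCoords_eq he hq, base_mk]
  simp [taylorCurve_zero]

/-- Change of coordinates in `T^k Q`, by Faà di Bruno's formula. -/
lemma coords_ofCoords_eq {e e' : OpenPartialHomeomorph Q E} (he : e ∈ atlas E Q)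
    (he' : e' ∈ atlas E Q) {q : JetModel E k} (hq : q 0 ∈ e.target) (hq' : e.symm (q 0) ∈ e'.source)
    (i : Fin (k + 1)) :
    coords e' (ofCoords e q) i = ∑ c : OrderedFinpartition (i : ℕ),
      iteratedFDeriv ℝ c.length (e' ∘ e.symm) (q 0) fun j =>
        q ⟨c.partSize j, (c.partSize_le j).trans_lt i.2⟩ := by
  have hi' : ((i : ℕ) : WithTop ℕ∞) ≤ ∞ := by exact_mod_cast le_top
  rw [ofCoords_eq he hq, coords_mk he' _ (by simpa [taylorCurve_zero] using hq')]
  change iteratedDeriv i ((e' ∘ e.symm) ∘ taylorCurve q) 0 = _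
  rw [iteratedDeriv_vcomp_eq_sum_orderedFinpartition (n := ∞) (f := taylorCurve q) (x := 0)
    (by rw [taylorCurve_zero]; exact contDiffAt_transition he he' hq hq')
    (contDiff_taylorCurve q).contDiffAt hi', taylorCurve_zero]
  refine Finset.sum_congr rfl fun c _ => ?_
  congr 1
  funext j
  exact iteratedDeriv_taylorCurve q ⟨c.partSize j, (c.partSize_le j).trans_lt i.2⟩

lemma coords_ofCoords {e : OpenPartialHomeomorph Q E} (he : e ∈ atlas E Q)
    {q : JetModel E k} (hq : q 0 ∈ e.target) : coords e (ofCoords e q) = q := by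
  funext i
  rw [ofCoords_eq he hq, coords_mk he _ (by simpa [taylorCurve_zero] using e.map_target hq)]
  rw [← iteratedDeriv_taylorCurve q i]
  refine EventuallyEq.iteratedDeriv_eq _ ?_
  have : taylorCurve q 0 ∈ e.target := by rwa [taylorCurve_zero]
  filter_upwards [(contDiff_taylorCurve q).continuous.continuousAt.preimage_mem_nhds
    (e.open_target.mem_nhds this)] with t ht
  simp [e.right_inv ht]

lemma ofCoords_coords {e : OpenPartialHomeomorph Q E} (he : e ∈ atlas E Q)
    (p : HTangent E k Q) (h : p.base ∈ e.source) : ofCoords e (coords e p) = p := by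
  have ht : coords e p 0 ∈ e.target := by rw [coords_zero he p h]; exact e.map_source h
  have key := coords_ofCoords he ht
  have hb : (ofCoords e (coords e p)).base = p.base := by
    rw [base_ofCoords he ht, coords_zero he p h, e.left_inv h]
  generalize ofCoords e (coords e p) = p' at key hb
  induction p using Quotient.inductionOn with
  | h σ =>
  induction p' using Quotient.inductionOn with
  | h τ =>
  refine Quotient.sound ⟨hb, fun i hi => ?_⟩
  have h1 : σ.1 0 ∈ e.source := h
  have hb' : τ.1 0 = σ.1 0 := hb
  have h2 : τ.1 0 ∈ e.source := by rw [hb']; exact h1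
  rw [(comp_eventuallyEq τ h2).iteratedDeriv_eq, (comp_eventuallyEq σ h1).iteratedDeriv_eq]
  refine iteratedDeriv_comp_congr (contDiffAt_chart_comp he τ h2)
    (contDiffAt_chart_comp he σ h1) ?_ ?_ hi
  · exact contDiffAt_transition he (chart_mem_atlas E _) (e.map_source h2)
      (by simp [e.left_inv h2])
  · intro i hi
    have := congrFun key ⟨i, Nat.lt_succ_iff.2 hi⟩
    have e1 := coords_mk (k := k) he τ h2 ⟨i, Nat.lt_succ_iff.2 hi⟩
    have e2 := coords_mk (k := k) he σ h1 ⟨i, Nat.lt_succ_iff.2 hi⟩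
    exact e1.symm.trans (this.trans e2)

variable (k) in
/-- The natural chart of `T^k Q` induced by a chart of `Q`. -/
def jetChart (e : OpenPartialHomeomorph Q E) (he : e ∈ atlas E Q) :
    PartialEquiv (HTangent E k Q) (JetModel E k) where
  toFun := coords e
  invFun := ofCoords e
  source := {p | p.base ∈ e.source}
  target := {q | q 0 ∈ e.target}
  map_source' p hp := by
    rw [mem_ofPred_eq, coords_zero he p hp]
    exact e.map_source hp
  map_target' q hq := by
    rw [mem_ofPred_eq, base_ofCoords he hq]
    exact e.map_target hq
  left_inv' p hp := ofCoords_coords he p hp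
  right_inv' q hq := coords_ofCoords he hq

lemma jetChart_trans_source {e e' : OpenPartialHomeomorph Q E} (he : e ∈ atlas E Q)
    (he' : e' ∈ atlas E Q) : ((jetChart k e he).symm.trans (jetChart k e' he')).source =
      (fun q : JetModel E k => q 0) ⁻¹' (e.symm.trans e').source := by
  ext q
  simp only [PartialEquiv.trans_source, PartialEquiv.symm_source, jetChart, mem_inter_iff,
    mem_ofPred_eq, mem_preimage, OpenPartialHomeomorph.trans_source,
    OpenPartialHomeomorph.symm_source, PartialEquiv.coe_symm_mk]
  exact and_congr_right fun hq => by rw [base_ofCoords he hq]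

lemma contDiffOn_jetChart_trans {e e' : OpenPartialHomeomorph Q E} (he : e ∈ atlas E Q)
    (he' : e' ∈ atlas E Q) :
    ContDiffOn ℝ ∞ ((jetChart k e he).symm.trans (jetChart k e' he'))
      ((jetChart k e he).symm.trans (jetChart k e' he')).source := by
  rw [jetChart_trans_source]
  have hmem : ∀ q ∈ (fun q : JetModel E k => q 0) ⁻¹' (e.symm.trans e').source,
      q 0 ∈ e.target ∧ e.symm (q 0) ∈ e'.source := fun q hq => by simpa using hq
  refine contDiffOn_pi.2 fun i => ContDiffOn.congr (f := fun q : JetModel E k =>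
    ∑ c : OrderedFinpartition (i : ℕ), iteratedFDeriv ℝ c.length (e' ∘ e.symm) (q 0) fun j =>
        q ⟨c.partSize j, (c.partSize_le j).trans_lt i.2⟩) ?_
    (fun q hq => coords_ofCoords_eq he he' (hmem q hq).1 (hmem q hq).2 i)
  refine ContDiffOn.sum fun c _ => ?_
  intro q hq
  refine ContDiffAt.contDiffWithinAt ?_
  have h1 : ContDiffAt ℝ ∞ (iteratedFDeriv ℝ c.length (e' ∘ e.symm)) (q 0) :=
    (contDiffAt_transition he he' (hmem q hq).1 (hmem q hq).2).iteratedFDeriv_right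
      (by exact_mod_cast le_top)
  have h2 : ContDiffAt ℝ ∞ (fun q : JetModel E k =>
      iteratedFDeriv ℝ c.length (e' ∘ e.symm) (q 0)) q :=
    ContDiffAt.comp (g := iteratedFDeriv ℝ c.length (e' ∘ e.symm)) q h1 (by fun_prop)
  exact (ContinuousLinearMap.cpolynomialAt_uncurry_of_multilinear (𝕜 := ℝ)
    (ContinuousLinearMap.id ℝ (E [×c.length]→L[ℝ] E))).contDiffAt.comp q (h2.prodMk (by fun_prop))

variable (E k Q) in
/-- The natural atlas of `T^k Q`. -/
def jetCore : ChartedSpaceCore (JetModel E k) (HTangent E k Q) where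
  atlas := {c | ∃ e, ∃ he : e ∈ atlas E Q, c = jetChart k e he}
  chartAt p := jetChart k (chartAt E p.base) (chart_mem_atlas E _)
  mem_chart_source p := mem_chart_source E p.base
  chart_mem_atlas p := ⟨_, chart_mem_atlas E _, rfl⟩
  open_source := by
    rintro _ _ ⟨e, he, rfl⟩ ⟨e', he', rfl⟩
    rw [jetChart_trans_source]
    exact (e.symm.trans e').open_source.preimage (continuous_apply 0)
  continuousOn_toFun := by
    rintro _ _ ⟨e, he, rfl⟩ ⟨e', he', rfl⟩
    exact (contDiffOn_jetChart_trans he he').continuousOn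

instance : TopologicalSpace (HTangent E k Q) := (jetCore E k Q).toTopologicalSpace

instance : ChartedSpace (JetModel E k) (HTangent E k Q) := (jetCore E k Q).toChartedSpace

instance : IsManifold 𝓘(ℝ, JetModel E k) ∞ (HTangent E k Q) := by
  refine isManifold_of_contDiffOn _ _ _ fun c c' hc hc' => ?_
  obtain ⟨_, ⟨e, he, rfl⟩, hc⟩ := mem_iUnion₂.1 hc
  obtain ⟨_, ⟨e', he', rfl⟩, hc'⟩ := mem_iUnion₂.1 hc'
  rw [mem_singleton_iff] at hc hc'
  subst hc hc'
  simp only [modelWithCornersSelf_coe, modelWithCornersSelf_coe_symm, range_id, inter_univ,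
    Function.id_comp, Function.comp_id, preimage_id_eq, id]
  exact contDiffOn_jetChart_trans (k := k) he he'


lemma coords_proj {r : ℕ} (h : r ≤ k) {e : OpenPartialHomeomorph Q E} (he : e ∈ atlas E Q)
    (p : HTangent E k Q) (hp : p.base ∈ e.source) (i : Fin (r + 1)) :
    coords e (p.proj h) i = coords e p (Fin.castLE (by lia) i) := by
  induction p using Quotient.inductionOn with
  | h σ =>
    have h1 := coords_mk (k := r) he σ hp i
    exact h1.trans (coords_mk (k := k) he σ hp (Fin.castLE (by lia) i)).symm

lemma contMDiff_proj {r : ℕ} (h : r ≤ k) :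
    ContMDiff 𝓘(ℝ, JetModel E k) 𝓘(ℝ, JetModel E r) ∞
      (HTangent.proj h : HTangent E k Q → HTangent E r Q) := by
  intro p
  set e := chartAt E p.base
  have he : e ∈ atlas E Q := chart_mem_atlas E _
  set c := chartAt (JetModel E k) p
  set c' := chartAt (JetModel E r) (p.proj h)
  let R : JetModel E k → JetModel E r := fun q i => q (Fin.castLE (by lia) i)
  have h1 : ContMDiffAt 𝓘(ℝ, JetModel E k) 𝓘(ℝ, JetModel E k) ∞ c p :=
    contMDiffAt_of_mem_maximalAtlas (IsManifold.chart_mem_maximalAtlas _) (mem_chart_source _ _)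
  have h2 : ContMDiff 𝓘(ℝ, JetModel E k) 𝓘(ℝ, JetModel E r) ∞ R :=
    ContDiff.contMDiff (by fun_prop)
  have key : ∀ x ∈ c.source, R (c x) = c' (x.proj h) := fun x hx => by
    funext i
    have : c' (x.proj h) = coords (chartAt E (p.proj h).base) (x.proj h) := rfl
    rw [this, base_proj, coords_proj h he x hx]
    rfl
  have hsrc : ∀ x ∈ c.source, x.proj h ∈ c'.source := fun x hx => by
    change (x.proj h).base ∈ (chartAt E (p.proj h).base).source
    rw [base_proj, base_proj]
    exact hx
  have hp := mem_chart_source (JetModel E k) p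
  have h3 : ContMDiffAt 𝓘(ℝ, JetModel E r) 𝓘(ℝ, JetModel E r) ∞ c'.symm (R (c p)) := by
    rw [key p hp]
    exact contMDiffAt_symm_of_mem_maximalAtlas (IsManifold.chart_mem_maximalAtlas _)
      (mem_chart_target _ _)
  refine ((h3.comp p (h2.contMDiffAt.comp p h1))).congr_of_eventuallyEq ?_
  filter_upwards [c.open_source.mem_nhds hp] with x hx
  simp only [Function.comp_apply, key x hx, c'.left_inv (hsrc x hx)]

/-- The projection `ρ^k_r : T^k Q → T^r Q`, as a smooth map. -/
def jetProj {r : ℕ} (h : r ≤ k) :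
    C^∞⟮𝓘(ℝ, JetModel E k), HTangent E k Q; 𝓘(ℝ, JetModel E r), HTangent E r Q⟯ :=
  ⟨HTangent.proj h, contMDiff_proj h⟩

end Jets

section Forms

variable {V H : Type*} [NormedAddCommGroup V] [NormedSpace ℝ V] [TopologicalSpace H]
  (I : ModelWithCorners ℝ V H) {M : Type*} [TopologicalSpace M] [ChartedSpace H M]
  {V' H' : Type*} [NormedAddCommGroup V'] [NormedSpace ℝ V'] [TopologicalSpace H']
  {I' : ModelWithCorners ℝ V' H'} {M' : Type*} [TopologicalSpace M'] [ChartedSpace H' M']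

variable (M) in
/-- Differential `1`-forms on `M` (as mere families of covectors). -/
abbrev OneForm : Type _ := ∀ x : M, TangentSpace I x →L[ℝ] ℝ

variable (M) in
/-- Families of bilinear forms on the tangent spaces of `M`; the `2`-forms below are alternating
by construction. -/
abbrev TwoForm : Type _ := ∀ x : M, TangentSpace I x →L[ℝ] TangentSpace I x →L[ℝ] ℝ

variable {I}

/-- The differential of a real function. -/
def dFun (f : M → ℝ) : OneForm I M := fun x => mfderiv I 𝓘(ℝ, ℝ) f x

/-- The exterior derivative of a `1`-form on a manifold without boundary. If `A` is the derivative
at `x` of the coefficients of `θ` in the preferred chart at `x` (through which Mathlib identifies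
`T_x M` with the model space), then `dθ (u, v) = A u v - A v u`. -/
def extDerivOne (θ : OneForm I M) : TwoForm I M := fun x =>
  let φ := extChartAt I x
  let A : V →L[ℝ] V →L[ℝ] ℝ :=
    fderiv ℝ (fun y : V => (θ (φ.symm y)).comp (mfderiv 𝓘(ℝ, V) I φ.symm y)) (φ x)
  A - A.flip

/-- The pullback of a `1`-form. -/
def pullOne (f : M' → M) (θ : OneForm I M) : OneForm I' M' :=
  fun x => (θ (f x)).comp (mfderiv I' I f x)

/-- The pullback of a `2`-form. -/
def pullTwo (f : M' → M) (η : TwoForm I M) : TwoForm I' M' :=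
  fun x =>
    let A : V' →L[ℝ] V := mfderiv I' I f x
    let B : V →L[ℝ] V →L[ℝ] ℝ := η (f x)
    let C : V' →L[ℝ] V' →L[ℝ] ℝ := B.bilinearComp A A
    C

end Forms

section Cotangent

variable (V : Type*) [NormedAddCommGroup V] [NormedSpace ℝ V]
  (M : Type*) [TopologicalSpace M] [ChartedSpace V M]

/-- The cotangent spaces of a manifold. -/
abbrev CotangentSpace (x : M) : Type _ := TangentSpace 𝓘(ℝ, V) x →L[ℝ] Trivial M ℝ x

variable [IsManifold 𝓘(ℝ, V) 1 M]

/-- The cotangent bundle, with Mathlib's manifold structure on the bundle of linear maps from the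
tangent bundle to the trivial line bundle. -/
abbrev Cotangent : Type _ := TotalSpace (V →L[ℝ] ℝ) (CotangentSpace V M)

/-- The canonical `1`-form of the cotangent bundle: `θ_α (u) = α (Tπ u)`. -/
def canonicalOne : OneForm (𝓘(ℝ, V).prod 𝓘(ℝ, V →L[ℝ] ℝ)) (Cotangent V M) := fun α =>
  α.2.comp (mfderiv (𝓘(ℝ, V).prod 𝓘(ℝ, V →L[ℝ] ℝ)) 𝓘(ℝ, V) (π (V →L[ℝ] ℝ) (CotangentSpace V M)) α)

/-- The canonical symplectic form `-dθ` of the cotangent bundle. -/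
def canonicalTwo : TwoForm (𝓘(ℝ, V).prod 𝓘(ℝ, V →L[ℝ] ℝ)) (Cotangent V M) :=
  - extDerivOne (canonicalOne V M)

end Cotangent

section Lagrangian

variable {E : Type*} [NormedAddCommGroup E] [NormedSpace ℝ E]
  {k : ℕ} {Q : Type*} [TopologicalSpace Q] [ChartedSpace E Q] [IsManifold 𝓘(ℝ, E) ∞ Q]

/-- The canonical injection `T^k Q → T(T^m Q)`, for `m + 1 ≤ k`: it sends the `k`-jet of `σ` at `0`
to the velocity at `t = 0` of the lifting of `σ` to `T^m Q`. In natural coordinates this is the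
vector `(q_1, …, q_{m+1})` at `(q_0, …, q_m)`. The natural chart used here, induced by the preferred
chart of `Q` at the base point, is the preferred chart of `T^m Q` at the point at hand, through
which Mathlib identifies the tangent space with the model space. -/
def canonicalInjection {m : ℕ} (h : m + 1 ≤ k) (p : HTangent E k Q) :
    TangentSpace 𝓘(ℝ, JetModel E m) (p.proj (Nat.le_of_succ_le h)) :=
  fun i : Fin (m + 1) => coords (chartAt E p.base) p ⟨i + 1, by lia⟩

/-- The `r`-th vertical endomorphism `J_r` of `T(T^k Q)`. In natural coordinates (again those of the
preferred chart at `p`) it is `(v_0, …, v_k) ↦ (w_0, …, w_k)` with `w_j = 0` for `j < r` and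
`w_j = (j! / (j - r)!) v_{j - r}` for `j ≥ r`. -/
def vertEndo (r : ℕ) (p : HTangent E k Q) :
    TangentSpace 𝓘(ℝ, JetModel E k) p →L[ℝ] TangentSpace 𝓘(ℝ, JetModel E k) p :=
  (ContinuousLinearMap.pi fun j : Fin (k + 1) =>
    if r ≤ j then
      ((j : ℕ).descFactorial r : ℝ) •
        ContinuousLinearMap.proj (R := ℝ) (φ := fun _ : Fin (k + 1) => E) ⟨j - r, by lia⟩
    else 0 : JetModel E k →L[ℝ] JetModel E k)

/-- The vertical differential of a function: `d_{J_r} f = df ∘ J_r`. -/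
def vertDiff (r : ℕ) (f : HTangent E k Q → ℝ) : OneForm 𝓘(ℝ, JetModel E k) (HTangent E k Q) :=
  fun p => (dFun f p).comp (vertEndo r p)

/-- The contraction `i_T θ` of a `1`-form on `T^k Q` with the canonical injection
`T^{k+1} Q → T(T^k Q)`. -/
def contractT (θ : OneForm 𝓘(ℝ, JetModel E k) (HTangent E k Q)) (p : HTangent E (k + 1) Q) : ℝ :=
  θ (p.proj k.le_succ) (canonicalInjection le_rfl p)

/-- Tulczyjew's derivation on `1`-forms, `d_T θ = i_T dθ + d i_T θ`. It is the derivation that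
extends `f ↦ d_T f = i_T df` and commutes with `d`. -/
def tulczyjew (θ : OneForm 𝓘(ℝ, JetModel E k) (HTangent E k Q)) :
    OneForm 𝓘(ℝ, JetModel E (k + 1)) (HTangent E (k + 1) Q) := fun p =>
  (extDerivOne θ (p.proj k.le_succ) (canonicalInjection le_rfl p)).comp
      (mfderiv 𝓘(ℝ, JetModel E (k + 1)) 𝓘(ℝ, JetModel E k)
        (HTangent.proj k.le_succ : HTangent E (k + 1) Q → HTangent E k Q) p) +
    dFun (contractT θ) p

/-- The iterates `d_T^i` on `1`-forms on `T^k Q`. -/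
def tulczyjewIter (θ : OneForm 𝓘(ℝ, JetModel E k) (HTangent E k Q)) :
    (i : ℕ) → OneForm 𝓘(ℝ, JetModel E (k + i)) (HTangent E (k + i) Q)
  | 0 => θ
  | i + 1 => tulczyjew (tulczyjewIter θ i)

lemma order_add_le (i : Fin k) : k + i ≤ 2 * k - 1 := by lia

/-- The Lagrangian `1`-form `θ_L = ∑_{r=1}^k (-1)^{r-1} (1 / r!) d_T^{r-1} d_{J_r} L` on
`T^{2k-1} Q`, with `r = i + 1`; each summand is pulled back from `T^{k+r-1} Q`. -/
def lagrangianOne (L : HTangent E k Q → ℝ) :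
    OneForm 𝓘(ℝ, JetModel E (2 * k - 1)) (HTangent E (2 * k - 1) Q) :=
  ∑ i : Fin k, ((-1) ^ (i : ℕ) / ((i : ℕ) + 1).factorial : ℝ) •
    pullOne (HTangent.proj (order_add_le i)) (tulczyjewIter (vertDiff (i + 1) L) i)

/-- The Lagrangian `2`-form `ω_L = -dθ_L`. -/
def lagrangianTwo (L : HTangent E k Q → ℝ) :
    TwoForm 𝓘(ℝ, JetModel E (2 * k - 1)) (HTangent E (2 * k - 1) Q) :=
  - extDerivOne (lagrangianOne L)

/-- A Lagrangian is regular if `ω_L` is symplectic, that is, nondegenerate at every point (`ω_L` is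
exact, hence closed). -/
def IsRegularLagrangian (L : HTangent E k Q → ℝ) : Prop :=
  ∀ (p : HTangent E (2 * k - 1) Q) (u : TangentSpace 𝓘(ℝ, JetModel E (2 * k - 1)) p),
    (∀ v, lagrangianTwo L p u v = 0) → u = 0

variable (E k Q) in
/-- The projection `T^{2k-1} Q → T^{k-1} Q`. -/
def baseProj : C^∞⟮𝓘(ℝ, JetModel E (2 * k - 1)), HTangent E (2 * k - 1) Q;
    𝓘(ℝ, JetModel E (k - 1)), HTangent E (k - 1) Q⟯ := jetProj (by lia)

/-- The Legendre–Ostrogradsky map `FL : T^{2k-1} Q → T^*(T^{k-1} Q)`: `FL(p)` is the covector at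
`ρ(p)`, where `ρ` is the projection `T^{2k-1} Q → T^{k-1} Q`, such that
`θ_L (u) = ⟨Tρ u, FL(p)⟩` for all `u` in `T_p(T^{2k-1} Q)`. -/
def legendre (L : HTangent E k Q → ℝ) (p : HTangent E (2 * k - 1) Q) :
    CotangentSpace (JetModel E (k - 1)) (HTangent E (k - 1) Q) (baseProj E k Q p) :=
  Classical.epsilon fun α => ∀ u : TangentSpace 𝓘(ℝ, JetModel E (2 * k - 1)) p,
    lagrangianOne L p u = α (mfderiv 𝓘(ℝ, JetModel E (2 * k - 1)) 𝓘(ℝ, JetModel E (k - 1))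
        (baseProj E k Q) p u)

variable (E k Q) in
/-- The unified phase space `W`, the fibre product of `T^{2k-1} Q` and `T^*(T^{k-1} Q)` over
`T^{k-1} Q`. Its points are the pairs `⟨p, α⟩` with `p` in `T^{2k-1} Q` and `α` a covector of
`T^{k-1} Q` at `ρ(p)`; its manifold structure is that of the pullback bundle. -/
abbrev UnifiedSpace : Type _ :=
  TotalSpace (JetModel E (k - 1) →L[ℝ] ℝ)
    ((baseProj E k Q : HTangent E (2 * k - 1) Q → HTangent E (k - 1) Q) *ᵖ
      (CotangentSpace (JetModel E (k - 1)) (HTangent E (k - 1) Q)))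

variable (E k) in
/-- The model of `W`. -/
abbrev unifiedModel := 𝓘(ℝ, JetModel E (2 * k - 1)).prod 𝓘(ℝ, JetModel E (k - 1) →L[ℝ] ℝ)

/-- The projection of `W` onto `T^*(T^{k-1} Q)`; the one onto `T^{2k-1} Q` is `w ↦ w.1`. -/
def prTwo (w : UnifiedSpace E k Q) : Cotangent (JetModel E (k - 1)) (HTangent E (k - 1) Q) :=
  Pullback.lift (baseProj E k Q) w

variable (E k Q) in
/-- The presymplectic form `Ω` on `W`, the pullback of the canonical symplectic form. -/
def unifiedTwo : TwoForm (unifiedModel E k) (UnifiedSpace E k Q) :=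
  pullTwo prTwo (canonicalTwo (JetModel E (k - 1)) (HTangent E (k - 1) Q))

/-- The coupling function `C(p, α) = ⟨α, j_k(p)⟩` on `W`. -/
def coupling (hk : 1 ≤ k) (w : UnifiedSpace E k Q) : ℝ :=
  (prTwo w).2 (canonicalInjection (show k - 1 + 1 ≤ 2 * k - 1 by lia) w.1)

/-- The Hamiltonian function `H = C - L` on `W`. -/
def hamiltonian (hk : 1 ≤ k) (L : HTangent E k Q → ℝ) (w : UnifiedSpace E k Q) : ℝ :=
  coupling hk w - L (w.1.proj (by lia))

/-- The embedding `p ↦ (p, FL(p))` of `T^{2k-1} Q` in `W`. -/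
def graphMap (L : HTangent E k Q → ℝ) (p : HTangent E (2 * k - 1) Q) : UnifiedSpace E k Q :=
  ⟨p, legendre L p⟩

/-- The submanifold `W_o` of `W`, the graph of `FL`. -/
def graphSubmanifold (L : HTangent E k Q → ℝ) : Set (UnifiedSpace E k Q) := range (graphMap L)

/-- Vector fields in `W` at support on `W_o`: `X w` is a tangent vector of `W` at each `w` in `W_o`,
depending smoothly on `w`. The smooth structure of `W_o` is the one of `T^{2k-1} Q`, through the
embedding `p ↦ (p, FL(p))`. -/
structure FieldAlong (L : HTangent E k Q → ℝ) where
  /-- The value of the field at a point of `W_o`. -/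
  toFun : ∀ w : graphSubmanifold L, TangentSpace (unifiedModel E k) (w : UnifiedSpace E k Q)
  smooth : ContMDiff 𝓘(ℝ, JetModel E (2 * k - 1)) (unifiedModel E k).tangent ∞
    fun p : HTangent E (2 * k - 1) Q =>
      (⟨graphMap L p, toFun ⟨graphMap L p, mem_range_self p⟩⟩ :
        TangentBundle (unifiedModel E k) (UnifiedSpace E k Q))

namespace FieldAlong

variable {L : HTangent E k Q → ℝ} (X : FieldAlong L)

/-- The dynamical equation `[i(X)Ω - dH]|_{W_o} = 0`. -/
def Solves (hk : 1 ≤ k) : Prop :=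
  ∀ (w : graphSubmanifold L) (v : TangentSpace (unifiedModel E k) (w : UnifiedSpace E k Q)),
    unifiedTwo E k Q w (X.toFun w) v = dFun (hamiltonian hk L) w v

/-- `X` is tangent to `W_o`: at `(p, FL(p))` it belongs to the tangent space of `W_o`, which is
the image of the differential at `p` of the embedding `p ↦ (p, FL(p))`. -/
def IsTangent : Prop :=
  ∀ p : HTangent E (2 * k - 1) Q,
    ∃ u : TangentSpace 𝓘(ℝ, JetModel E (2 * k - 1)) p,
      mfderiv 𝓘(ℝ, JetModel E (2 * k - 1)) (unifiedModel E k) (graphMap L) p u =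
        X.toFun ⟨graphMap L p, mem_range_self p⟩

/-- `σ` is an integral curve of `X` on the set `J` of times (in particular it lies in `W_o`). -/
def IsIntegralCurveOn (σ : ℝ → UnifiedSpace E k Q) (J : Set ℝ) : Prop :=
  ∀ t ∈ J, ∃ h : σ t ∈ graphSubmanifold L,
    HasMFDerivAt 𝓘(ℝ, ℝ) (unifiedModel E k) σ t
      ((1 : ℝ →L[ℝ] ℝ).smulRight (X.toFun ⟨σ t, h⟩))

/-- `X` is a semispray of type `1` in `W`: for every integral curve `σ` of `X`, defined on an open
set of times, the projection of `σ` to `T^{2k-1} Q` is the canonical lifting of the projection of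
`σ` to `Q`. -/
def IsSemispray : Prop :=
  ∀ (σ : ℝ → UnifiedSpace E k Q) (J : Set ℝ), IsOpen J → X.IsIntegralCurveOn σ J →
    ∀ t ∈ J, ∃ h : ContMDiffAt 𝓘(ℝ, ℝ) 𝓘(ℝ, E) ∞ (fun s => (σ s).1.base) t,
      lift (2 * k - 1) (fun s => (σ s).1.base) t h = (σ t).1

end FieldAlong

end Lagrangian

end HigherOrder

end

open HigherOrder

/-! In natural coordinates on `E^{2k}` let `S` be the shift with a zero in the top slot and let
`d_T` be the Lie derivative along the linear field `q ↦ S q` (`flatTul`). On forms that do not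
involve the top differential, `[S, J_1] = 1` gives `(d_T η) ∘ J_1 = d_T (η ∘ J_1) + η`. Two facts
about `θ_L` carry the proof. (a) Applied to the alternating sum `θ_L`, this relation telescopes to
`(d_T θ_L) ∘ J_1 = dL ∘ J_1`. The image of `J_1` consists of the vectors with `v_0 = 0`, so the
Euler–Lagrange form `dL - d_T θ_L` is a multiple of `dq_0` (`HasOrder.flatTul_flatTheta`).
Equivalently, `ω_L(S q, v) = dE_L(v)` whenever `v_0 = 0`. (b) For `i < k` the coefficient of `dq_i`
in `θ_L` only involves `q_0, …, q_{2k-1-i}`, and for `i ≥ k` it is zero. Hence `ω_L(c ∂/∂q_{2k-1},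
v) = 0` whenever `v_0 = 0` (`HasOrder.flatOmega_top`). Therefore every `S q + c ∂/∂q_{2k-1}` solves
`i_u ω_L = dE_L` on the vectors with `v_0 = 0`. The remaining equations are linear in `c`; by (b)
and nondegeneracy of `ω_L` the map `c ↦ ω_L(c ∂/∂q_{2k-1}, ∂/∂q_0)` from `E` to its dual is
injective, hence bijective (`HasOrder.exists_flat_solution`). The unique solution is thus holonomic:
`u_i = q_{i+1}` for `i < 2k-1`.

On `W` the form is `dq ∧ dp`, the Hamiltonian is `⟨p, (q_1, …, q_k)⟩ - L`, and a vector tangent to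
the graph of `FL` is the image of some `u`. The covectors along the fibre give `u_i = q_{i+1}` for
`i < k`; with these, the other components become the Euler–Lagrange equation for `u`
(`solves_iff_eulerLagrange`). Existence and uniqueness follow pointwise, and smoothness follows
because `u` solves a nondegenerate linear system with smooth coefficients. In a chart an integral
curve satisfies `y' = f(y)` with `f` smooth, hence is smooth, and holonomy gives `y_i' = y_{i+1}`,
which says that it is a lifting.

The rest is the passage between the global objects, defined through the preferred chart at each
point, and their expressions in one natural chart. It uses that the components of a change of
natural coordinates are iterated total derivatives of the first one. -/

noncomputable section

namespace HigherOrder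

/-! ### Total derivative and vertical endomorphisms on a fixed `E^{N+1}`. -/

section FlatOperators

variable {E : Type*} [NormedAddCommGroup E] [NormedSpace ℝ E] {N : ℕ}
  {F : Type*} [NormedAddCommGroup F] [NormedSpace ℝ F]

variable (E) in
/-- The shift `(q_0, …, q_N) ↦ (q_1, …, q_N, 0)`. -/
def jetShift (N : ℕ) : JetModel E N →L[ℝ] JetModel E N :=
  ContinuousLinearMap.pi fun j : Fin (N + 1) =>
    if h : (j : ℕ) + 1 < N + 1 then
      ContinuousLinearMap.proj (R := ℝ) (φ := fun _ : Fin (N + 1) => E) ⟨j + 1, h⟩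
    else 0

variable (E) in
/-- The coordinate expression of the vertical endomorphism `J_r`. -/
def jetVert (N r : ℕ) : JetModel E N →L[ℝ] JetModel E N :=
  ContinuousLinearMap.pi fun j : Fin (N + 1) =>
    if r ≤ j then
      ((j : ℕ).descFactorial r : ℝ) •
        ContinuousLinearMap.proj (R := ℝ) (φ := fun _ : Fin (N + 1) => E) ⟨j - r, by lia⟩
    else 0

variable (E) in
/-- The truncation `(q_0, …, q_N) ↦ (q_0, …, q_m)`. -/
def jetTrunc {m : ℕ} (h : m ≤ N) : JetModel E N →L[ℝ] JetModel E m :=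
  ContinuousLinearMap.pi fun j : Fin (m + 1) =>
    ContinuousLinearMap.proj (R := ℝ) (φ := fun _ : Fin (N + 1) => E) (Fin.castLE (by lia) j)

/-- The jet coordinates over the set `T`. -/
def jetDom (N : ℕ) (T : Set E) : Set (JetModel E N) := {q | q 0 ∈ T}

lemma isOpen_jetDom {T : Set E} (hT : IsOpen T) : IsOpen (jetDom N T) :=
  hT.preimage (continuous_apply 0)

lemma jetShift_apply_of_lt (q : JetModel E N) (j : Fin (N + 1)) (h : (j : ℕ) + 1 < N + 1) :
    jetShift E N q j = q ⟨j + 1, h⟩ := by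
  simp only [jetShift, ContinuousLinearMap.coe_pi', dif_pos h, ContinuousLinearMap.proj_apply]

lemma jetShift_apply_last (q : JetModel E N) (j : Fin (N + 1)) (h : ¬ (j : ℕ) + 1 < N + 1) :
    jetShift E N q j = 0 := by
  simp only [jetShift, ContinuousLinearMap.coe_pi', dif_neg h, zero_apply]

lemma jetVert_apply_of_le (r : ℕ) (q : JetModel E N) (j : Fin (N + 1)) (h : r ≤ j) :
    jetVert E N r q j = ((j : ℕ).descFactorial r : ℝ) • q ⟨j - r, by lia⟩ := by
  simp [jetVert, h]

lemma jetVert_apply_of_lt (r : ℕ) (q : JetModel E N) (j : Fin (N + 1)) (h : (j : ℕ) < r) :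
    jetVert E N r q j = 0 := by
  simp [jetVert, h.not_ge]

@[simp] lemma jetTrunc_apply {m : ℕ} (h : m ≤ N) (q : JetModel E N) (j : Fin (m + 1)) :
    jetTrunc E h q j = q (Fin.castLE (by lia) j) := rfl

lemma jetTrunc_mem_jetDom {m : ℕ} (h : m ≤ N) {T : Set E} {q : JetModel E N}
    (hq : q ∈ jetDom N T) : jetTrunc E h q ∈ jetDom m T := hq

/-- The weights multiply because `j! / (j - r - 1)! = (j! / (j - r)!) (j - r)`; thus `J_r` is the
`r`-th power of `J_1`. -/
lemma jetVert_succ (r : ℕ) : jetVert E N (r + 1) = (jetVert E N r).comp (jetVert E N 1) := by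
  ext w j
  simp only [ContinuousLinearMap.comp_apply]
  by_cases h : r + 1 ≤ j
  · rw [jetVert_apply_of_le _ _ _ h, jetVert_apply_of_le r _ _ (by lia),
      jetVert_apply_of_le 1 _ _ (by simp; lia), smul_smul, Nat.descFactorial_succ]
    congr 2
    simp [mul_comm]
  · rw [jetVert_apply_of_lt _ _ _ (by lia)]
    by_cases h' : r ≤ j
    · rw [jetVert_apply_of_le r _ _ h', jetVert_apply_of_lt 1 _ _ (by simp; lia), smul_zero]
    · rw [jetVert_apply_of_lt _ _ _ (by lia)]

lemma jetVert_zero : jetVert E N 0 = ContinuousLinearMap.id ℝ _ := by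
  ext w j
  simp [jetVert]

/-- This lets an identity between forms composed with `J_1` be read as an identity on the vectors
with zero first component. -/
lemma exists_jetVert_one_eq {w : JetModel E N} (hw : w 0 = 0) : ∃ z, jetVert E N 1 z = w := by
  refine ⟨fun i => if h : (i : ℕ) + 1 < N + 1 then (((i : ℕ) + 1 : ℝ)⁻¹) • w ⟨i + 1, h⟩ else 0, ?_⟩
  ext j
  by_cases h : 1 ≤ (j : ℕ)
  · rw [jetVert_apply_of_le _ _ _ h]
    have h2 : (j : ℕ) - 1 + 1 < N + 1 := by lia
    have h3 : (⟨(j : ℕ) - 1 + 1, h2⟩ : Fin (N + 1)) = j := Fin.ext (by simp; lia)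
    have h4 : (((j : ℕ) - 1 : ℕ) : ℝ) + 1 = (j : ℕ) := by
      rw [Nat.cast_sub h]; simp
    have h5 : ((j : ℕ) : ℝ) ≠ 0 := by
      have : (j : ℕ) ≠ 0 := by lia
      exact_mod_cast this
    simp only [h2, dif_pos, h3, h4, Nat.descFactorial_one, smul_smul]
    rw [mul_inv_cancel₀ h5, one_smul]
  · rw [jetVert_apply_of_lt _ _ _ (by lia)]
    have : j = 0 := Fin.ext (by simp; lia)
    rw [this, hw]

/-- The commutation relation `[S, J_1] = 1`, up to the top component. -/
lemma jetShift_jetVert_one (w : JetModel E N) (j : Fin (N + 1)) (h : (j : ℕ) < N) :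
    jetShift E N (jetVert E N 1 w) j = (jetVert E N 1 (jetShift E N w) + w) j := by
  -- At `j = N` the left side would be `0` and the right side `(N + 1) w_N`, whence the bound on
  -- `j`.
  rw [jetShift_apply_of_lt _ _ (by lia), jetVert_apply_of_le _ _ _ (by simp)]
  simp only [Nat.descFactorial_one, add_tsub_cancel_right, Fin.eta, Pi.add_apply]
  by_cases h0 : 1 ≤ (j : ℕ)
  · have h3 : (⟨(j : ℕ) - 1 + 1, by lia⟩ : Fin (N + 1)) = j := Fin.ext (by simp; lia)
    rw [jetVert_apply_of_le _ _ _ h0, jetShift_apply_of_lt _ _ (by simp; lia), h3]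
    simp [add_smul]
  · have : (j : ℕ) = 0 := by lia
    rw [jetVert_apply_of_lt _ _ _ (by lia), this]
    simp

/-- Tulczyjew's derivation in coordinates, on forms with values in `F`. -/
def flatTul (η : JetModel E N → (JetModel E N →L[ℝ] F)) :
    JetModel E N → (JetModel E N →L[ℝ] F) :=
  fun q => fderiv ℝ η q (jetShift E N q) + (η q).comp (jetShift E N)

/-- `η` only involves the differentials `dq_i` with `i < m`. -/
def SemibasicOn (U : Set (JetModel E N)) (m : ℕ) (η : JetModel E N → (JetModel E N →L[ℝ] F)) :
    Prop :=
  ∀ q ∈ U, ∀ w : JetModel E N, (∀ i : Fin (N + 1), (i : ℕ) < m → w i = 0) → η q w = 0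

variable {U : Set (JetModel E N)} {η η' : JetModel E N → (JetModel E N →L[ℝ] F)}

lemma SemibasicOn.congr {m : ℕ} (h : SemibasicOn U m η) {q : JetModel E N} (hq : q ∈ U)
    {w w' : JetModel E N} (hw : ∀ i : Fin (N + 1), (i : ℕ) < m → w i = w' i) :
    η q w = η q w' := by
  rw [← sub_eq_zero, ← map_sub]
  exact h q hq _ fun i hi => by simp [hw i hi]

lemma contDiffOn_flatTul (hU : IsOpen U) (h : ContDiffOn ℝ ∞ η U) :
    ContDiffOn ℝ ∞ (flatTul η) U := by
  have h1 : ContDiffOn ℝ ∞ (fderiv ℝ η) U := h.fderiv_of_isOpen hU (by simp)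
  unfold flatTul
  refine ContDiffOn.add (h1.clm_apply (jetShift E N).contDiff.contDiffOn) ?_
  exact h.clm_comp contDiffOn_const

lemma flatTul_congr (hU : IsOpen U) (h : EqOn η η' U) : EqOn (flatTul η) (flatTul η') U := by
  intro q hq
  have : η =ᶠ[𝓝 q] η' := h.eventuallyEq_of_mem (hU.mem_nhds hq)
  simp only [flatTul, this.fderiv_eq, h hq]

lemma flatTul_iterate_congr (hU : IsOpen U) (h : EqOn η η' U) (a : ℕ) :
    EqOn (flatTul^[a] η) (flatTul^[a] η') U := by
  induction a with
  | zero => exact h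
  | succ a ih =>
    simp only [Function.iterate_succ', Function.comp_apply]
    exact flatTul_congr hU ih

lemma contDiffOn_flatTul_iterate (hU : IsOpen U) (h : ContDiffOn ℝ ∞ η U) (a : ℕ) :
    ContDiffOn ℝ ∞ (flatTul^[a] η) U := by
  induction a with
  | zero => exact h
  | succ a ih =>
    simp only [Function.iterate_succ', Function.comp_apply]
    exact contDiffOn_flatTul hU ih

lemma ContDiffOn.differentiableAt_of_isOpen {V W : Type*} [NormedAddCommGroup V] [NormedSpace ℝ V]
    [NormedAddCommGroup W] [NormedSpace ℝ W] {f : V → W} {s : Set V} (h : ContDiffOn ℝ ∞ f s)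
    (hs : IsOpen s) {x : V} (hx : x ∈ s) : DifferentiableAt ℝ f x :=
  (h.contDiffAt (hs.mem_nhds hx)).differentiableAt (by simp)

lemma flatTul_apply (hU : IsOpen U) (h : ContDiffOn ℝ ∞ η U) {q : JetModel E N} (hq : q ∈ U)
    (w : JetModel E N) : flatTul η q w =
      fderiv ℝ (fun q => η q w) q (jetShift E N q) + η q (jetShift E N w) := by
  have hd := ContDiffOn.differentiableAt_of_isOpen h hU hq
  have : HasFDerivAt (fun q => η q w) _ q := hd.hasFDerivAt.clm_apply (hasFDerivAt_const w q)
  rw [this.fderiv]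
  simp [flatTul]

/-- The shift brings slot `i + 1` to slot `i`, so `η (S w)` reads one slot more than `η w`;
differentiating the coefficients of `η` adds none. -/
lemma SemibasicOn.flatTul (hU : IsOpen U) (h : ContDiffOn ℝ ∞ η U) {m : ℕ}
    (hm : SemibasicOn U m η) : SemibasicOn U (m + 1) (flatTul η) := by
  intro q hq w hw
  rw [flatTul_apply hU h hq]
  have h1 : (fun q => η q w) =ᶠ[𝓝 q] fun _ => 0 := by
    filter_upwards [hU.mem_nhds hq] with q' hq'
    exact hm q' hq' w fun i hi => hw i (by lia)
  rw [h1.fderiv_eq, hm q hq _ fun i hi => ?_]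
  · simp
  · by_cases h : (i : ℕ) + 1 < N + 1
    · rw [jetShift_apply_of_lt _ _ h]
      exact hw _ (by simpa using hi)
    · exact jetShift_apply_last _ _ h

lemma SemibasicOn.flatTul_iterate (hU : IsOpen U) (h : ContDiffOn ℝ ∞ η U) {m : ℕ}
    (hm : SemibasicOn U m η) (a : ℕ) : SemibasicOn U (m + a) (HigherOrder.flatTul^[a] η) := by
  induction a with
  | zero => exact hm
  | succ a ih =>
    simp only [Function.iterate_succ', Function.comp_apply]
    exact ih.flatTul hU (contDiffOn_flatTul_iterate hU h a)

/-- The commutation relation of `d_T` and `J_1`. -/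
lemma flatTul_comp_jetVert (hU : IsOpen U) (h : ContDiffOn ℝ ∞ η U) {m : ℕ}
    (hm : SemibasicOn U m η) (hmN : m ≤ N) {q : JetModel E N} (hq : q ∈ U) :
    (flatTul η q).comp (jetVert E N 1) =
      flatTul (fun q => (η q).comp (jetVert E N 1)) q + η q := by
  ext w
  have h' : ContDiffOn ℝ ∞ (fun q => (η q).comp (jetVert E N 1)) U := h.clm_comp contDiffOn_const
  rw [ContinuousLinearMap.comp_apply, flatTul_apply hU h hq, add_apply,
    flatTul_apply hU h' hq, add_assoc]
  congr 1
  rw [ContinuousLinearMap.comp_apply, ← map_add]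
  -- The commutation relation fails only in the top slot, which `η` does not read because `m ≤ N`.
  exact hm.congr hq fun i hi => jetShift_jetVert_one w i (by lia)

lemma flatTul_add_smul (hU : IsOpen U) (h : ContDiffOn ℝ ∞ η U) (h' : ContDiffOn ℝ ∞ η' U)
    (c : ℝ) {q : JetModel E N} (hq : q ∈ U) :
    flatTul (fun q => η q + c • η' q) q = flatTul η q + c • flatTul η' q := by
  have hd := ContDiffOn.differentiableAt_of_isOpen h hU hq
  have hd' := ContDiffOn.differentiableAt_of_isOpen h' hU hq
  have := (hd.hasFDerivAt.add (hd'.hasFDerivAt.const_smul c)).fderiv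
  ext w
  have e : fderiv ℝ (fun q => η q + c • η' q) q = fderiv ℝ η q + c • fderiv ℝ η' q := this
  simp only [flatTul, e, add_apply, smul_apply,
    ContinuousLinearMap.comp_apply, smul_add]
  abel

lemma flatTul_sum_smul {ι : Type*} (s : Finset ι) (c : ι → ℝ)
    {η : ι → JetModel E N → (JetModel E N →L[ℝ] F)} (hU : IsOpen U)
    (h : ∀ i, ContDiffOn ℝ ∞ (η i) U) {q : JetModel E N} (hq : q ∈ U) :
    flatTul (fun q => ∑ i ∈ s, c i • η i q) q = ∑ i ∈ s, c i • flatTul (η i) q := by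
  have hd := fun i => (ContDiffOn.differentiableAt_of_isOpen (h i) hU hq).hasFDerivAt
  have := (HasFDerivAt.fun_sum (u := s) fun i _ => (hd i).const_smul (c i)).fderiv
  ext w
  have e : fderiv ℝ (fun q => ∑ i ∈ s, c i • η i q) q = ∑ i ∈ s, c i • fderiv ℝ (η i) q := this
  simp [flatTul, e, Finset.sum_add_distrib]

/-- Moving `J_1` past each of the `a + 1` factors `d_T` leaves one copy of `d_T^a η`. The bound `m +
a ≤ N` keeps the intermediate forms free of `dq_N`. -/
lemma flatTul_iterate_comp_jetVert (hU : IsOpen U) (h : ContDiffOn ℝ ∞ η U) {m : ℕ}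
    (hm : SemibasicOn U m η) (a : ℕ) (hmN : m + a ≤ N) : ∀ q ∈ U,
    (flatTul^[a + 1] η q).comp (jetVert E N 1) =
      flatTul^[a + 1] (fun q => (η q).comp (jetVert E N 1)) q +
        ((a : ℝ) + 1) • flatTul^[a] η q := by
  have h' : ContDiffOn ℝ ∞ (fun q => (η q).comp (jetVert E N 1)) U := h.clm_comp contDiffOn_const
  induction a with
  | zero =>
    intro q hq
    simpa using flatTul_comp_jetVert hU h hm (by lia) hq
  | succ a ih =>
    intro q hq
    rw [Function.iterate_succ_apply',
      flatTul_comp_jetVert hU (contDiffOn_flatTul_iterate hU h (a + 1))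
        (hm.flatTul_iterate hU h (a + 1)) hmN hq, flatTul_congr hU (ih (by lia)) hq,
      flatTul_add_smul hU (contDiffOn_flatTul_iterate hU h' (a + 1))
        (contDiffOn_flatTul_iterate hU h a) _ hq,
      ← Function.iterate_succ_apply' flatTul, ← Function.iterate_succ_apply' flatTul]
    push_cast
    module

end FlatOperators

/-! ### The Lagrangian forms in coordinates and the holonomic solution. -/

section FlatLagrangian

variable {E : Type*} [NormedAddCommGroup E] [NormedSpace ℝ E] {N k : ℕ} {ℓ : JetModel E N → ℝ}
  {T : Set E}

/-- The function `f` only depends on `q_0, …, q_k`. -/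
def HasOrder (k : ℕ) (f : JetModel E N → ℝ) : Prop :=
  ∀ q z : JetModel E N, (∀ i : Fin (N + 1), (i : ℕ) ≤ k → z i = 0) → f (q + z) = f q

/-- The vertical differential `dℓ ∘ J_r` in coordinates. -/
def flatVertDiff (r : ℕ) (ℓ : JetModel E N → ℝ) : JetModel E N → (JetModel E N →L[ℝ] ℝ) :=
  fun q => (fderiv ℝ ℓ q).comp (jetVert E N r)

/-- The Lagrangian `1`-form in coordinates. -/
def flatTheta (k : ℕ) (ℓ : JetModel E N → ℝ) : JetModel E N → (JetModel E N →L[ℝ] ℝ) :=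
  fun q => ∑ i : Fin k, ((-1) ^ (i : ℕ) / ((i : ℕ) + 1).factorial : ℝ) •
    flatTul^[(i : ℕ)] (flatVertDiff ((i : ℕ) + 1) ℓ) q

lemma flatVertDiff_succ (r : ℕ) : flatVertDiff (r + 1) ℓ =
    fun q => (flatVertDiff r ℓ q).comp (jetVert E N 1) := by
  funext q
  rw [flatVertDiff, jetVert_succ, ← ContinuousLinearMap.comp_assoc]
  rfl

lemma contDiffOn_flatVertDiff (hT : IsOpen T) (h : ContDiffOn ℝ ∞ ℓ (jetDom N T)) (r : ℕ) :
    ContDiffOn ℝ ∞ (flatVertDiff r ℓ) (jetDom N T) := by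
  have h1 : ContDiffOn ℝ ∞ (fderiv ℝ ℓ) (jetDom N T) :=
    h.fderiv_of_isOpen (isOpen_jetDom hT) (by simp)
  exact h1.clm_comp contDiffOn_const

lemma contDiffOn_flatTheta (hT : IsOpen T) (h : ContDiffOn ℝ ∞ ℓ (jetDom N T)) :
    ContDiffOn ℝ ∞ (flatTheta k ℓ) (jetDom N T) := by
  refine ContDiffOn.sum fun i _ => ?_
  exact (contDiffOn_flatTul_iterate (isOpen_jetDom hT)
    (contDiffOn_flatVertDiff hT h _) _).const_smul
    ((-1) ^ (i : ℕ) / ((i : ℕ) + 1).factorial : ℝ)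

/-- No differentiability is needed: where it fails, `fderiv` is zero by convention. -/
lemma fderiv_apply_eq_zero_of_invariant {V W : Type*} [NormedAddCommGroup V] [NormedSpace ℝ V]
    [NormedAddCommGroup W] [NormedSpace ℝ W] {f : V → W} {x v : V}
    (h : ∀ t : ℝ, f (x + t • v) = f x) : fderiv ℝ f x v = 0 := by
  by_cases hd : DifferentiableAt ℝ f x
  · rw [← hd.lineDeriv_eq_fderiv, lineDeriv]
    simp [h]
  · simp [fderiv_zero_of_not_differentiableAt hd]

lemma HasOrder.fderiv_apply_eq_zero (h : HasOrder k ℓ) (q z : JetModel E N)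
    (hz : ∀ i : Fin (N + 1), (i : ℕ) ≤ k → z i = 0) : fderiv ℝ ℓ q z = 0 :=
  fderiv_apply_eq_zero_of_invariant fun t => h q _ fun i hi => by simp [hz i hi]

lemma HasOrder.fderiv_add (h : HasOrder k ℓ) (q z : JetModel E N)
    (hz : ∀ i : Fin (N + 1), (i : ℕ) ≤ k → z i = 0) : fderiv ℝ ℓ (q + z) = fderiv ℝ ℓ q := by
  rw [← fderiv_comp_add_right]
  congr 1
  funext q
  exact h q z hz

/-- `J_r` moves slot `i` to slot `i + r`, and `dℓ` reads nothing beyond slot `k`. For `r = k + 1`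
the bound is `0`, so the form vanishes. -/
lemma HasOrder.semibasicOn (h : HasOrder k ℓ) (U : Set (JetModel E N)) {r : ℕ} :
    SemibasicOn U (k + 1 - r) (flatVertDiff r ℓ) := by
  intro q _ w hw
  refine h.fderiv_apply_eq_zero q _ fun j hj => ?_
  by_cases hr : r ≤ (j : ℕ)
  · refine (jetVert_apply_of_le _ _ _ hr).trans ?_
    rw [hw _ (by simp; lia), smul_zero]
  · exact jetVert_apply_of_lt _ _ _ (by lia)

/-- In the summand of index `i`, `J_{i+1}` leaves the slots below `k - i`, and the `i` derivations
add `i` slots. The Legendre map exists because of this. -/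
lemma HasOrder.semibasicOn_flatTheta (ho : HasOrder k ℓ) (hT : IsOpen T)
    (h : ContDiffOn ℝ ∞ ℓ (jetDom N T)) : SemibasicOn (jetDom N T) k (flatTheta k ℓ) := by
  intro q hq w hw
  simp only [flatTheta, sum_apply, smul_apply]
  refine Finset.sum_eq_zero fun i _ => ?_
  have := (ho.semibasicOn (jetDom N T) (r := i + 1)).flatTul_iterate (isOpen_jetDom hT)
    (contDiffOn_flatVertDiff hT h _) i
  rw [this q hq w fun j hj => hw j (by lia), smul_zero]

/-- The Euler–Lagrange form `dℓ - d_T θ` is a multiple of `dq_0`. -/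
lemma HasOrder.flatTul_flatTheta (ho : HasOrder k ℓ) (hT : IsOpen T)
    (h : ContDiffOn ℝ ∞ ℓ (jetDom N T)) (hkN : k ≤ N) {q : JetModel E N}
    (hq : q ∈ jetDom N T) {w : JetModel E N} (hw : w 0 = 0) :
    flatTul (flatTheta k ℓ) q w = fderiv ℝ ℓ q w := by
  -- It suffices to compare the two forms after composition with `J_1`, where the commutation
  -- relation applies.
  obtain ⟨z, rfl⟩ := exists_jetVert_one_eq hw
  have hU : IsOpen (jetDom N T) := isOpen_jetDom hT
  have hs := fun r => contDiffOn_flatVertDiff (r := r) hT h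
  have e1 : flatTul (flatTheta k ℓ) q = _ := flatTul_sum_smul Finset.univ _ hU
    (fun i : Fin k => contDiffOn_flatTul_iterate hU (hs ((i : ℕ) + 1)) i) hq
  -- The coefficients of `θ_L` are such that the commutation relation turns the `i`-th term of `(d_T
  -- θ) ∘ J_1` into `f i - f (i + 1)`.
  let f : ℕ → JetModel E N →L[ℝ] ℝ := fun i => ((-1) ^ i / (i.factorial : ℝ)) •
    flatTul^[i] (flatVertDiff (i + 1) ℓ) q
  have e2 : (flatTul (flatTheta k ℓ) q).comp (jetVert E N 1) = f 0 - f k := by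
    rw [e1, ← Finset.sum_range_sub', ← Fin.sum_univ_eq_sum_range (fun i => f i - f (i + 1))]
    ext z
    simp only [ContinuousLinearMap.comp_apply, sum_apply, smul_apply]
    refine Finset.sum_congr rfl fun i _ => ?_
    have e3 := DFunLike.congr_fun (flatTul_iterate_comp_jetVert hU (hs ((i : ℕ) + 1))
      (ho.semibasicOn (jetDom N T)) i (by lia) q hq) z
    rw [← flatVertDiff_succ, ContinuousLinearMap.comp_apply] at e3
    rw [← Function.iterate_succ_apply' flatTul, e3]
    simp only [f, add_apply, smul_apply, sub_apply, smul_eq_mul, Nat.factorial_succ, pow_succ]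
    push_cast
    have : ((i : ℕ) : ℝ) + 1 ≠ 0 := by positivity
    field_simp
    ring
  -- The end of the telescope vanishes since `J_{k+1}` pushes every slot beyond the order of `ℓ`.
  have e4 : flatTul^[k] (flatVertDiff (k + 1) ℓ) q = 0 := by
    have h0 : EqOn (flatVertDiff (k + 1) ℓ) 0 (jetDom N T) := fun q hq => by
      ext w
      exact ho.semibasicOn (jetDom N T) q hq w (by simp)
    rw [flatTul_iterate_congr hU h0 k hq]
    have : ∀ a, flatTul^[a] (0 : JetModel E N → (JetModel E N →L[ℝ] ℝ)) = 0 := fun a => by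
      induction a with
      | zero => rfl
      | succ a ih =>
        rw [Function.iterate_succ_apply', ih]
        funext q
        ext w
        simp [flatTul]
    rw [this]
    rfl
  have := DFunLike.congr_fun e2 z
  simpa [f, e4, flatVertDiff] using this

/-- For `i < k`, the coefficient of `dq_i` in `η` only depends on `q_0, …, q_{M - i}`. -/
def WeightOn (T : Set E) (k M : ℕ) (η : JetModel E N → (JetModel E N →L[ℝ] ℝ)) : Prop :=
  ∀ i : Fin (N + 1), (i : ℕ) < k → ∀ (y : E) (z : JetModel E N),
    (∀ b : Fin (N + 1), (b : ℕ) + i ≤ M → z b = 0) → ∀ q ∈ jetDom N T,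
      η (q + z) (Pi.single i y) = η q (Pi.single i y)

lemma add_mem_jetDom {q z : JetModel E N} (hq : q ∈ jetDom N T) (hz : z 0 = 0) :
    q + z ∈ jetDom N T := by
  simpa [jetDom, hz] using hq

lemma jetShift_single_zero (y : E) : jetShift E N (Pi.single 0 y) = 0 := by
  ext j
  by_cases h : (j : ℕ) + 1 < N + 1
  · rw [jetShift_apply_of_lt _ _ h,
      Pi.single_eq_of_ne (by rw [ne_eq, Fin.ext_iff]; exact Nat.succ_ne_zero _)]
    rfl
  · exact jetShift_apply_last _ _ h

lemma jetShift_single (i : Fin (N + 1)) (hi : (i : ℕ) ≠ 0) (y : E) :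
    jetShift E N (Pi.single i y) = Pi.single ⟨i - 1, by lia⟩ y := by
  ext j
  by_cases h : (j : ℕ) + 1 < N + 1
  · rw [jetShift_apply_of_lt _ _ h]
    simp only [Pi.single_apply, Fin.ext_iff]
    congr 1
    simp only [eq_iff_iff]
    lia
  · rw [jetShift_apply_last _ _ h, Pi.single_eq_of_ne]
    simp only [ne_eq, Fin.ext_iff]
    lia

/-- The coefficient of `dq_i` in `d_T η` is `d_T η_i + η_{i-1}`, and both terms involve at most
`q_0, …, q_{M+1-i}`. The hypothesis `k ≤ M` forces `z 0 = 0`, so that `q + z` stays over `T`. -/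
lemma WeightOn.flatTul {M : ℕ} {η : JetModel E N → (JetModel E N →L[ℝ] ℝ)} (hT : IsOpen T)
    (h : ContDiffOn ℝ ∞ η (jetDom N T)) (hkM : k ≤ M) (hη : WeightOn T k M η) :
    WeightOn T k (M + 1) (flatTul η) := by
  intro i hi y z hz q hq
  have hU : IsOpen (jetDom N T) := isOpen_jetDom hT
  have hz0 : ∀ z : JetModel E N, (∀ b : Fin (N + 1), (b : ℕ) + i ≤ M → z b = 0) → z 0 = 0 :=
    fun z hz => hz 0 (by simp; lia)
  have hz' : ∀ b : Fin (N + 1), (b : ℕ) + i ≤ M → z b = 0 := fun b hb => hz b (by lia)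
  have hSz : ∀ b : Fin (N + 1), (b : ℕ) + i ≤ M → jetShift E N z b = 0 := fun b hb => by
    by_cases h : (b : ℕ) + 1 < N + 1
    · rw [jetShift_apply_of_lt _ _ h]
      exact hz _ (by simp; lia)
    · exact jetShift_apply_last _ _ h
  have hqz := add_mem_jetDom hq (hz0 z hz')
  rw [flatTul_apply hU h hqz, flatTul_apply hU h hq]
  congr 1
  · have e1 : fderiv ℝ (fun q => η q (Pi.single i y)) (q + z) =
        fderiv ℝ (fun q => η q (Pi.single i y)) q := by
      rw [← fderiv_comp_add_right]
      refine EventuallyEq.fderiv_eq ?_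
      filter_upwards [hU.mem_nhds hq] with q' hq'
      exact hη i hi y z hz' q' hq'
    have e2 : fderiv ℝ (fun q => η q (Pi.single i y)) q (jetShift E N z) = 0 :=
      fderiv_apply_eq_zero_of_invariant fun t =>
        hη i hi y _ (fun b hb => by simp [hSz b hb]) q hq
    rw [e1, map_add, map_add, e2, add_zero]
  · by_cases hi0 : (i : ℕ) = 0
    · have : i = 0 := Fin.ext hi0
      rw [this, jetShift_single_zero, map_zero, map_zero]
    · rw [jetShift_single _ hi0]
      exact hη _ (by simp; lia) y z (fun b hb => hz b (by simp at hb; lia)) q hq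

/-- The coefficient of `dq_i` is zero unless `i + r ≤ k`, and then `2k - r - i ≥ k` is no
restriction on a function of order `k`. -/
lemma HasOrder.weightOn (h : HasOrder k ℓ) (T : Set E) (r : ℕ) :
    WeightOn T k (2 * k - r) (flatVertDiff r ℓ) := by
  intro i hi y z hz q hq
  by_cases hir : (i : ℕ) + r ≤ k
  · rw [flatVertDiff, h.fderiv_add q z fun b hb => hz b (by lia)]
    rfl
  · have hs : ∀ j : Fin (N + 1), (j : ℕ) < k + 1 - r →
        (Pi.single i y : JetModel E N) j = 0 := fun j hj => Pi.single_eq_of_ne (by lia) _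
    rw [h.semibasicOn univ _ (mem_univ _) _ hs, h.semibasicOn univ _ (mem_univ _) _ hs]

/-- Each summand has weight `(2k - r) + (r - 1) = 2k - 1`, whatever `r`: the loss from `J_r` is
balanced by the `r - 1` derivations. -/
lemma HasOrder.weightOn_flatTheta (ho : HasOrder k ℓ) (hT : IsOpen T)
    (h : ContDiffOn ℝ ∞ ℓ (jetDom N T)) : WeightOn T k (2 * k - 1) (flatTheta k ℓ) := by
  have key : ∀ r, r ≤ k → ∀ a,
      WeightOn T k (2 * k - r + a) (HigherOrder.flatTul^[a] (flatVertDiff r ℓ)) := by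
    intro r hr a
    induction a with
    | zero => exact ho.weightOn T r
    | succ a ih =>
      rw [Function.iterate_succ']
      exact WeightOn.flatTul hT (contDiffOn_flatTul_iterate (isOpen_jetDom hT)
        (contDiffOn_flatVertDiff hT h r) a) (by lia) ih
  intro i hi y z hz q hq
  simp only [flatTheta, sum_apply, smul_apply]
  refine Finset.sum_congr rfl fun r _ => ?_
  rw [key (r + 1) (by lia) r i hi y z (fun b hb => hz b (by lia)) q hq]

/-- The Lagrangian `2`-form in coordinates. -/
def flatOmega (θ : JetModel E N → (JetModel E N →L[ℝ] ℝ)) (q : JetModel E N) :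
    JetModel E N →L[ℝ] JetModel E N →L[ℝ] ℝ :=
  (fderiv ℝ θ q).flip - fderiv ℝ θ q

/-- The Lagrangian energy in coordinates. -/
def flatEnergy (θ : JetModel E N → (JetModel E N →L[ℝ] ℝ)) (ℓ : JetModel E N → ℝ)
    (q : JetModel E N) : ℝ :=
  θ q (jetShift E N q) - ℓ q

lemma flatOmega_apply (θ : JetModel E N → (JetModel E N →L[ℝ] ℝ)) (q u v : JetModel E N) :
    flatOmega θ q u v = fderiv ℝ θ q v u - fderiv ℝ θ q u v := by
  simp [flatOmega]

lemma fderiv_flatEnergy {θ : JetModel E N → (JetModel E N →L[ℝ] ℝ)} {q : JetModel E N}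
    (hθ : DifferentiableAt ℝ θ q) (hℓ : DifferentiableAt ℝ ℓ q) (v : JetModel E N) :
    fderiv ℝ (flatEnergy θ ℓ) q v =
      fderiv ℝ θ q v (jetShift E N q) + θ q (jetShift E N v) - fderiv ℝ ℓ q v := by
  have := ((hθ.hasFDerivAt.clm_apply (jetShift E N).hasFDerivAt).sub hℓ.hasFDerivAt).fderiv
  have e : fderiv ℝ (flatEnergy θ ℓ) q = _ := this
  rw [e]
  simp [add_comm]

/-- The terms `Dθ(v)(S q)` cancel, and the difference of the two sides is the Euler–Lagrange form
`dℓ - d_T θ` evaluated at `v`. -/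
lemma HasOrder.flatOmega_shift (ho : HasOrder k ℓ) (hT : IsOpen T)
    (h : ContDiffOn ℝ ∞ ℓ (jetDom N T)) (hkN : k ≤ N) {q : JetModel E N}
    (hq : q ∈ jetDom N T) {v : JetModel E N} (hv : v 0 = 0) :
    flatOmega (flatTheta k ℓ) q (jetShift E N q) v =
      fderiv ℝ (flatEnergy (flatTheta k ℓ) ℓ) q v := by
  have hU : IsOpen (jetDom N T) := isOpen_jetDom hT
  have e := ho.flatTul_flatTheta hT h hkN hq hv
  rw [fderiv_flatEnergy (ContDiffOn.differentiableAt_of_isOpen (contDiffOn_flatTheta hT h) hU hq)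
    (ContDiffOn.differentiableAt_of_isOpen h hU hq), flatOmega_apply, ← e]
  simp only [flatTul, add_apply, ContinuousLinearMap.comp_apply]
  ring

/-- `θ` has no `dq_N` component, and `q_N` occurs only in its coefficient of `dq_0`. So the top
direction pairs only with the bottom one. -/
lemma HasOrder.flatOmega_top (ho : HasOrder k ℓ) (hT : IsOpen T)
    (h : ContDiffOn ℝ ∞ ℓ (jetDom N T)) (hkN : N + 1 = 2 * k) {q : JetModel E N}
    (hq : q ∈ jetDom N T) (c : E) {v : JetModel E N} (hv : v 0 = 0) :
    flatOmega (flatTheta k ℓ) q (Pi.single (Fin.last N) c) v = 0 := by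
  have hU : IsOpen (jetDom N T) := isOpen_jetDom hT
  have hs := contDiffOn_flatTheta (k := k) hT h
  have hd := ContDiffOn.differentiableAt_of_isOpen hs hU hq
  have hb := ho.semibasicOn_flatTheta hT h
  have hev : ∀ w, HasFDerivAt (fun q => flatTheta k ℓ q w)
      ((fderiv ℝ (flatTheta k ℓ) q).flip w) q := fun w => by
    have := hd.hasFDerivAt.clm_apply (hasFDerivAt_const w q)
    simpa using this
  have e1 : fderiv ℝ (flatTheta k ℓ) q v (Pi.single (Fin.last N) c) = 0 := by
    have h1 : (fun q => flatTheta k ℓ q (Pi.single (Fin.last N) c)) =ᶠ[𝓝 q] fun _ => 0 := by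
      filter_upwards [hU.mem_nhds hq] with q' hq'
      exact hb q' hq' _ fun i hi => Pi.single_eq_of_ne
        (by rw [ne_eq, Fin.ext_iff, Fin.val_last]; lia) _
    have h2 := (hev (Pi.single (Fin.last N) c)).fderiv
    rw [h1.fderiv_eq] at h2
    have := DFunLike.congr_fun h2 v
    simpa using this.symm
  -- Componentwise in `v`: the index `0` is excluded by `hv`, the weight bound handles `0 < i < k`
  -- because `N + i > 2k - 1`, and the coefficients with `i ≥ k` vanish.
  have e2 : fderiv ℝ (flatTheta k ℓ) q (Pi.single (Fin.last N) c) v = 0 := by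
    have h2 := (hev v).fderiv
    have h3 : fderiv ℝ (fun q => flatTheta k ℓ q v) q (Pi.single (Fin.last N) c) = 0 := by
      refine fderiv_apply_eq_zero_of_invariant fun t => ?_
      rw [← Pi.single_smul]
      rw [← Finset.univ_sum_single v, map_sum, map_sum]
      refine Finset.sum_congr rfl fun i _ => ?_
      by_cases hi : i = 0
      · rw [hi, hv, Pi.single_zero, map_zero, map_zero]
      have hi' : (i : ℕ) ≠ 0 := fun h => hi (Fin.ext h)
      by_cases hik : (i : ℕ) < k
      · refine ho.weightOn_flatTheta hT h i hik _ _ (fun b hb => Pi.single_eq_of_ne ?_ _) q hq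
        rw [ne_eq, Fin.ext_iff, Fin.val_last]
        lia
      · have hz : ∀ j : Fin (N + 1), (j : ℕ) < k →
            (Pi.single i (v i) : JetModel E N) j = 0 :=
          fun j hj => Pi.single_eq_of_ne (by lia) _
        rw [hb q hq _ hz, hb _ (add_mem_jetDom hq (Pi.single_eq_of_ne
          (by rw [ne_eq, Fin.ext_iff, Fin.val_last]; simp; lia) _)) _ hz]
    rw [h2] at h3
    simpa using h3
  rw [flatOmega_apply, e1, e2, sub_zero]

/-- The solution of the Euler–Lagrange equations of a regular Lagrangian is holonomic. -/
lemma HasOrder.exists_flat_solution [FiniteDimensional ℝ E] (ho : HasOrder k ℓ) (hT : IsOpen T)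
    (h : ContDiffOn ℝ ∞ ℓ (jetDom N T)) (hkN : N + 1 = 2 * k) {q : JetModel E N}
    (hq : q ∈ jetDom N T)
    (hreg : ∀ u, (∀ v, flatOmega (flatTheta k ℓ) q u v = 0) → u = 0) :
    ∃ c, ∀ v, flatOmega (flatTheta k ℓ) q (jetShift E N q + Pi.single (Fin.last N) c) v =
      fderiv ℝ (flatEnergy (flatTheta k ℓ) ℓ) q v := by
  set om := flatOmega (flatTheta k ℓ) q with hom
  -- The block of `ω` pairing the top slot with the bottom one. A vector killed by `A` is killed by
  -- all of `ω`, hence the injectivity; equal finite dimensions give surjectivity.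
  let A : E →ₗ[ℝ] Module.Dual ℝ E :=
    { toFun := fun c => (om (Pi.single (Fin.last N) c)).toLinearMap.comp
        (LinearMap.single ℝ (fun _ : Fin (N + 1) => E) 0)
      map_add' := fun c c' => by ext y; simp [Pi.single_add]
      map_smul' := fun t c => by ext y; simp [Pi.single_smul] }
  have hv : ∀ v : JetModel E N, v = Pi.single 0 (v 0) + (v - Pi.single 0 (v 0)) := fun v => by simp
  have hA : Function.Injective A := by
    rw [← LinearMap.ker_eq_bot, LinearMap.ker_eq_bot']
    intro c hc
    have : (Pi.single (Fin.last N) c : JetModel E N) = 0 := hreg _ fun v => by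
      rw [hv v, map_add, hom, ho.flatOmega_top hT h hkN hq c (v := v - _) (by simp), add_zero]
      exact DFunLike.congr_fun hc (v 0)
    simpa using this
  have hA' : Function.Surjective A :=
    (LinearMap.injective_iff_surjective_of_finrank_eq_finrank
      Subspace.dual_finrank_eq.symm).1 hA
  -- The defect of `S q` in the `dq_0` equations, to be corrected by the top component `c`.
  let B := (fderiv ℝ (flatEnergy (flatTheta k ℓ) ℓ) q - om (jetShift E N q)).toLinearMap.comp
        (LinearMap.single ℝ (fun _ : Fin (N + 1) => E) 0)
  obtain ⟨c, hc⟩ := hA' B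
  refine ⟨c, fun v => ?_⟩
  have h1 : om (Pi.single (Fin.last N) c) (Pi.single 0 (v 0)) =
      fderiv ℝ (flatEnergy (flatTheta k ℓ) ℓ) q (Pi.single 0 (v 0)) -
        om (jetShift E N q) (Pi.single 0 (v 0)) := DFunLike.congr_fun hc (v 0)
  have h2 := ho.flatOmega_shift hT h (by lia) hq (v := v - Pi.single 0 (v 0)) (by simp)
  have h3 := ho.flatOmega_top hT h hkN hq c (v := v - Pi.single 0 (v 0)) (by simp)
  rw [hv v]
  simp only [map_add om, add_apply, map_add (om _), map_add (fderiv ℝ _ q)]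
  rw [hom] at h1 ⊢
  rw [h1, h2, h3]
  ring

/-- A nondegenerate form is an isomorphism onto the dual, and inversion of continuous linear
isomorphisms is smooth; so `u = om⁻¹ β` is smooth. -/
lemma contDiffOn_of_nondegenerate {X V : Type*} [NormedAddCommGroup X] [NormedSpace ℝ X]
    [NormedAddCommGroup V] [NormedSpace ℝ V] [FiniteDimensional ℝ V] {s : Set X} (hs : IsOpen s)
    {om : X → V →L[ℝ] V →L[ℝ] ℝ} {β : X → V →L[ℝ] ℝ} {u : X → V} (hom : ContDiffOn ℝ ∞ om s)
    (hβ : ContDiffOn ℝ ∞ β s) (hu : ∀ x ∈ s, om x (u x) = β x)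
    (hreg : ∀ x ∈ s, ∀ u, om x u = 0 → u = 0) : ContDiffOn ℝ ∞ u s := by
  have : CompleteSpace V := FiniteDimensional.complete ℝ V
  have hfr : Module.finrank ℝ V = Module.finrank ℝ (V →L[ℝ] ℝ) := by
    rw [← (LinearMap.toContinuousLinearMap (𝕜 := ℝ) (E := V) (F' := ℝ)).finrank_eq]
    exact Subspace.dual_finrank_eq.symm
  have hequiv : ∀ x ∈ s, ∃ e : V ≃L[ℝ] (V →L[ℝ] ℝ), (e : V →L[ℝ] V →L[ℝ] ℝ) = om x := by
    intro x hx
    have hi : Function.Injective (om x).toLinearMap := by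
      rw [← LinearMap.ker_eq_bot, LinearMap.ker_eq_bot']
      exact hreg x hx
    refine ⟨(LinearEquiv.ofInjectiveOfFinrankEq (om x).toLinearMap hi hfr).toContinuousLinearEquiv,
      ?_⟩
    ext v w
    rfl
  have heq : ∀ x ∈ s, u x = (om x).inverse (β x) := by
    intro x hx
    obtain ⟨e, he⟩ := hequiv x hx
    rw [← hu x hx, ← he, ContinuousLinearMap.inverse_equiv]
    simp
  refine ContDiffOn.congr (f := fun x => (om x).inverse (β x)) ?_ heq
  refine ContDiffOn.clm_apply (fun x hx => ?_) hβ
  obtain ⟨e, he⟩ := hequiv x hx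
  exact (ContDiffAt.comp x (g := ContinuousLinearMap.inverse)
    (by rw [← he]; exact contDiffAt_map_inverse e)
    (hom.contDiffAt (hs.mem_nhds hx))).contDiffWithinAt

end FlatLagrangian

/-! ### Changes of natural coordinates as iterated total derivatives. -/

section Transition

variable {E : Type*} [NormedAddCommGroup E] [NormedSpace ℝ E] {m : ℕ}
  {Q : Type*} [TopologicalSpace Q] [ChartedSpace E Q]

variable (m) in
/-- The change of natural coordinates of `T^m Q`. -/
def jetTrans (e e' : OpenPartialHomeomorph Q E) (q : JetModel E m) : JetModel E m :=
  coords e' (ofCoords e q : HTangent E m Q)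

lemma hasDerivAt_iteratedDeriv {F : Type*} [NormedAddCommGroup F] [NormedSpace ℝ F] {f : ℝ → F}
    {t : ℝ} (h : ContDiffAt ℝ ∞ f t) (i : ℕ) :
    HasDerivAt (iteratedDeriv i f) (iteratedDeriv (i + 1) f t) t := by
  rw [iteratedDeriv_succ, hasDerivAt_deriv_iff]
  obtain ⟨u, hu, h'⟩ := h.contDiffOn (m := (i + 1 : ℕ)) (by exact_mod_cast le_top) (by simp)
  obtain ⟨v, hvu, hv, htv⟩ := mem_nhds_iff.1 hu
  have h1 := (h'.mono hvu).differentiableOn_iteratedDerivWithin (m := i)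
    (by exact_mod_cast Nat.lt_succ_self i) hv.uniqueDiffOn
  have h2 := (h1 t htv).differentiableAt (hv.mem_nhds htv)
  refine h2.congr_of_eventuallyEq ?_
  filter_upwards [hv.mem_nhds htv] with s hs
  exact (iteratedDerivWithin_of_isOpen hv hs).symm

/-- The coordinates of the `m`-jet at `t` of a curve in `E`. -/
def jetCurve (m : ℕ) (f : ℝ → E) (t : ℝ) : JetModel E m := fun i => iteratedDeriv i f t

lemma taylorCurve_eq_jetShift (q : JetModel E m) (t : ℝ) :
    HasDerivAt (taylorCurve q) (taylorCurve (jetShift E m q) t) t := by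
  have h1 : HasDerivAt (taylorCurve q) (∑ j : Fin (m + 1),
      (((j : ℕ) : ℝ) * t ^ ((j : ℕ) - 1)) • (((j : ℕ).factorial : ℝ)⁻¹ • q j)) t := by
    unfold taylorCurve
    exact HasDerivAt.fun_sum fun j _ => (hasDerivAt_pow _ _).smul_const _
  convert h1 using 1
  rw [taylorCurve, Fin.sum_univ_castSucc, Fin.sum_univ_succ,
    jetShift_apply_last _ (Fin.last m) (by simp)]
  simp only [Fin.val_last, Fin.val_castSucc, smul_zero, add_zero, Fin.val_zero, Nat.cast_zero,
    zero_mul, zero_smul, zero_add, Fin.val_succ, add_tsub_cancel_right]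
  refine Finset.sum_congr rfl fun j _ => ?_
  rw [jetShift_apply_of_lt _ _ (by simp), smul_smul, smul_smul]
  have : (⟨(j.castSucc : ℕ) + 1, by simp⟩ : Fin (m + 1)) = j.succ := rfl
  rw [this, Nat.factorial_succ]
  congr 1
  push_cast
  have h2 : ((j : ℕ) : ℝ) + 1 ≠ 0 := by positivity
  have h3 : ((j : ℕ).factorial : ℝ) ≠ 0 := by positivity
  field_simp

/-- The zero in the top slot of the shift is the vanishing derivative of order `m + 1` of a
polynomial of degree at most `m`. This realises `S q` as the velocity of a curve of jets. -/
lemma hasDerivAt_jetCurve_taylorCurve (q : JetModel E m) :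
    HasDerivAt (jetCurve m (taylorCurve q)) (jetShift E m q) 0 := by
  have hd : deriv (taylorCurve q) = taylorCurve (jetShift E m q) :=
    funext fun t => (taylorCurve_eq_jetShift q t).deriv
  refine hasDerivAt_pi.2 fun i => ?_
  have := hasDerivAt_iteratedDeriv (contDiff_taylorCurve q).contDiffAt i (t := 0)
  rwa [iteratedDeriv_succ', hd, iteratedDeriv_taylorCurve] at this

lemma jetCurve_taylorCurve_zero (q : JetModel E m) : jetCurve m (taylorCurve q) 0 = q :=
  funext fun i => iteratedDeriv_taylorCurve q i

variable [IsManifold 𝓘(ℝ, E) ∞ Q] {e e' : OpenPartialHomeomorph Q E}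

lemma jetTrans_apply (he : e ∈ atlas E Q) (he' : e' ∈ atlas E Q) {q : JetModel E m}
    (hq : q ∈ jetDom m (e.symm.trans e').source) (i : Fin (m + 1)) :
    jetTrans m e e' q i = iteratedDeriv i ((e' ∘ e.symm) ∘ taylorCurve q) 0 := by
  have hq' : q 0 ∈ e.target ∧ e.symm (q 0) ∈ e'.source := by simpa [jetDom] using hq
  rw [jetTrans, ofCoords_eq he hq'.1, coords_mk he' _ (by simpa [taylorCurve_zero] using hq'.2)]
  rfl

lemma contDiffOn_jetTrans (he : e ∈ atlas E Q) (he' : e' ∈ atlas E Q) :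
    ContDiffOn ℝ ∞ (jetTrans m e e') (jetDom m (e.symm.trans e').source) := by
  have := contDiffOn_jetChart_trans (k := m) he he'
  rwa [jetChart_trans_source] at this

lemma contDiffAt_trans_of_mem (he : e ∈ atlas E Q) (he' : e' ∈ atlas E Q) {x : E}
    (hx : x ∈ (e.symm.trans e').source) : ContDiffAt ℝ ∞ (e' ∘ e.symm) x := by
  have hq' : x ∈ e.target ∧ e.symm x ∈ e'.source := by simpa using hx
  exact contDiffAt_transition he he' hq'.1 hq'.2

/-- The components of a change of natural coordinates are iterated total derivatives. -/
lemma fderiv_jetTrans_jetShift (he : e ∈ atlas E Q) (he' : e' ∈ atlas E Q) {q : JetModel E m}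
    (hq : q ∈ jetDom m (e.symm.trans e').source) (i : Fin (m + 1)) (hi : (i : ℕ) + 1 < m + 1) :
    fderiv ℝ (fun q => jetTrans m e e' q i) q (jetShift E m q) = jetTrans m e e' q ⟨i + 1, hi⟩ := by
  set φ := e' ∘ e.symm
  have hU : IsOpen (jetDom m (e.symm.trans e').source) :=
    isOpen_jetDom (e.symm.trans e').open_source
  have hd : DifferentiableAt ℝ (fun q => jetTrans m e e' q i) q :=
    differentiableAt_pi.1 (ContDiffOn.differentiableAt_of_isOpen
      (contDiffOn_jetTrans he he') hU hq) i
  have hc := hasDerivAt_jetCurve_taylorCurve q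
  have h1 : HasDerivAt (fun t => jetTrans m e e' (jetCurve m (taylorCurve q) t) i)
      (fderiv ℝ (fun q => jetTrans m e e' q i) q (jetShift E m q)) 0 := by
    have := hd.hasFDerivAt
    rw [← jetCurve_taylorCurve_zero q] at this
    have := this.comp_hasDerivAt 0 hc
    rwa [jetCurve_taylorCurve_zero] at this
  have hφ : ContDiffAt ℝ ∞ (φ ∘ taylorCurve q) 0 :=
    ContDiffAt.comp 0 (by rw [taylorCurve_zero]; exact contDiffAt_trans_of_mem he he' hq)
      (contDiff_taylorCurve q).contDiffAt
  have h2 : HasDerivAt (iteratedDeriv i (φ ∘ taylorCurve q))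
      (iteratedDeriv (i + 1) (φ ∘ taylorCurve q) 0) 0 := hasDerivAt_iteratedDeriv hφ i
  -- Component `i` of the transformed jet at time `t` is the `i`-th derivative of `φ ∘ taylorCurve
  -- q` there: the curve translated by `t` has the same `m`-jet at `0` as the Taylor curve of its
  -- jet.
  have h3 : (fun t => jetTrans m e e' (jetCurve m (taylorCurve q) t) i) =ᶠ[𝓝 0]
      iteratedDeriv i (φ ∘ taylorCurve q) := by
    have hq0 : jetCurve m (taylorCurve q) 0 ∈ jetDom m (e.symm.trans e').source := by
      rwa [jetCurve_taylorCurve_zero]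
    filter_upwards [hc.continuousAt.preimage_mem_nhds (hU.mem_nhds hq0)] with t ht
    rw [jetTrans_apply he he' ht]
    have h4 : iteratedDeriv i (φ ∘ taylorCurve q) t =
        iteratedDeriv i (φ ∘ fun s => taylorCurve q (s + t)) 0 := by
      have := congrFun (iteratedDeriv_comp_add_const i (φ ∘ taylorCurve q) t) 0
      simpa [Function.comp_def] using this.symm
    rw [h4]
    refine iteratedDeriv_comp_congr (k := m) (contDiff_taylorCurve _).contDiffAt
      ((contDiff_taylorCurve q).comp (by fun_prop)).contDiffAt ?_ (fun j hj => ?_) (by lia)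
    · rw [taylorCurve_zero]
      exact contDiffAt_trans_of_mem he he' ht
    · have e1 := iteratedDeriv_taylorCurve (jetCurve m (taylorCurve q) t) ⟨j, by lia⟩
      have e2 := congrFun (iteratedDeriv_comp_add_const j (taylorCurve q) t) 0
      simp only [zero_add] at e2
      exact e1.trans e2.symm
  rw [jetTrans_apply he he' hq]
  exact h1.unique (h2.congr_of_eventuallyEq h3)

lemma fderiv_jetTrans_apply (he : e ∈ atlas E Q) (he' : e' ∈ atlas E Q) {q : JetModel E m}
    (hq : q ∈ jetDom m (e.symm.trans e').source) (w : JetModel E m) (i : Fin (m + 1)) :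
    fderiv ℝ (jetTrans m e e') q w i = fderiv ℝ (fun q => jetTrans m e e' q i) q w := by
  have hU : IsOpen (jetDom m (e.symm.trans e').source) :=
    isOpen_jetDom (e.symm.trans e').open_source
  have hd := ContDiffOn.differentiableAt_of_isOpen (contDiffOn_jetTrans he he') hU hq
  rw [fderiv_pi (differentiableAt_pi.1 hd)]
  rfl

/-- The total derivative commutes with the differential. -/
lemma flatTul_fderiv {F : Type*} [NormedAddCommGroup F] [NormedSpace ℝ F] {f : JetModel E m → F}
    {U : Set (JetModel E m)} (hU : IsOpen U) (h : ContDiffOn ℝ ∞ f U) {q : JetModel E m}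
    (hq : q ∈ U) :
    fderiv ℝ (fun q => fderiv ℝ f q (jetShift E m q)) q = flatTul (fderiv ℝ f) q := by
  have h1 : ContDiffOn ℝ ∞ (fderiv ℝ f) U := h.fderiv_of_isOpen hU (by simp)
  have hd := ContDiffOn.differentiableAt_of_isOpen h1 hU hq
  -- Differentiating `Df(q)(S q)` along `w` gives `D²f(w, S q)`, whereas `flatTul` has `D²f(S q,
  -- w)`.
  have hsymm : IsSymmSndFDerivAt ℝ f q := (h.contDiffAt (hU.mem_nhds hq)).isSymmSndFDerivAt
    (by
      simp only [minSmoothness_of_isRCLikeNormedField]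
      exact WithTop.coe_le_coe.2 (le_top : (2 : ℕ∞) ≤ ⊤))
  have := (hd.hasFDerivAt.clm_apply (jetShift E m).hasFDerivAt (x := q)).fderiv
  rw [this]
  ext w
  simp [flatTul, hsymm.eq w, add_comm]

lemma fderiv_jetTrans_eq_iterate (he : e ∈ atlas E Q) (he' : e' ∈ atlas E Q) (i : ℕ)
    (hi : i < m + 1) : EqOn (fderiv ℝ (fun q => jetTrans m e e' q ⟨i, hi⟩))
      (flatTul^[i] (fderiv ℝ (fun q => jetTrans m e e' q 0)))
      (jetDom m (e.symm.trans e').source) := by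
  have hU : IsOpen (jetDom m (e.symm.trans e').source) :=
    isOpen_jetDom (e.symm.trans e').open_source
  induction i with
  | zero => exact fun q _ => rfl
  | succ i ih =>
    intro q hq
    have h1 : (fun q => jetTrans m e e' q ⟨i + 1, hi⟩) =ᶠ[𝓝 q]
        fun q => fderiv ℝ (fun q => jetTrans m e e' q ⟨i, by lia⟩) q (jetShift E m q) := by
      filter_upwards [hU.mem_nhds hq] with q' hq'
      exact (fderiv_jetTrans_jetShift he he' hq' ⟨i, by lia⟩ hi).symm
    rw [h1.fderiv_eq, flatTul_fderiv hU (contDiffOn_pi.1 (contDiffOn_jetTrans he he') _) hq,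
      Function.iterate_succ_apply']
    exact flatTul_congr hU (ih (by lia)) hq

lemma flatTul_iterate_zero {F : Type*} [NormedAddCommGroup F] [NormedSpace ℝ F] (a : ℕ) :
    flatTul^[a] (0 : JetModel E m → (JetModel E m →L[ℝ] F)) = 0 := by
  induction a with
  | zero => rfl
  | succ a ih =>
    rw [Function.iterate_succ_apply', ih]
    funext q
    ext w
    simp [flatTul]

/-- Write `φ_j` for the components of the coordinate change. Then `dφ_j = d_T^j dφ_0`, and `dφ_0 ∘
J_1 = 0` since `φ_0` depends on `q_0` alone. The commutation relation leaves `dφ_j ∘ J_1 = j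
dφ_{j-1}`, which is the assertion in components. -/
lemma fderiv_jetTrans_comp_jetVert_one (he : e ∈ atlas E Q) (he' : e' ∈ atlas E Q)
    {q : JetModel E m} (hq : q ∈ jetDom m (e.symm.trans e').source) (w : JetModel E m) :
    fderiv ℝ (jetTrans m e e') q (jetVert E m 1 w) =
      jetVert E m 1 (fderiv ℝ (jetTrans m e e') q w) := by
  have hU : IsOpen (jetDom m (e.symm.trans e').source) :=
    isOpen_jetDom (e.symm.trans e').open_source
  set η := fderiv ℝ (fun q => jetTrans m e e' q 0) with hη
  have hs : ContDiffOn ℝ ∞ η (jetDom m (e.symm.trans e').source) :=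
    (contDiffOn_pi.1 (contDiffOn_jetTrans he he') 0).fderiv_of_isOpen hU (by simp)
  have hsb : SemibasicOn (jetDom m (e.symm.trans e').source) 1 η := by
    intro q hq w hw
    have hw0 : w 0 = 0 := hw 0 (by simp)
    have h1 : (fun q => jetTrans m e e' q 0) =ᶠ[𝓝 q] fun q => (e' ∘ e.symm) (q 0) := by
      filter_upwards [hU.mem_nhds hq] with q' hq'
      rw [jetTrans_apply he he' hq']
      simp [taylorCurve_zero]
    rw [hη, h1.fderiv_eq]
    exact fderiv_apply_eq_zero_of_invariant fun t => by simp [hw0]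
  have hJ : EqOn (fun q => (η q).comp (jetVert E m 1)) 0 (jetDom m (e.symm.trans e').source) := by
    intro q hq
    ext w
    refine hsb q hq _ fun i hi => jetVert_apply_of_lt _ _ _ (by lia)
  ext j
  rw [fderiv_jetTrans_apply he he' hq, fderiv_jetTrans_eq_iterate he he' j j.2 hq]
  obtain ⟨j, hj⟩ := j
  cases j with
  | zero =>
    rw [jetVert_apply_of_lt _ _ _ (by simp)]
    exact DFunLike.congr_fun (hJ hq) w
  | succ j =>
    have := DFunLike.congr_fun
      (flatTul_iterate_comp_jetVert hU hs hsb j (by lia) q hq) w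
    rw [flatTul_iterate_congr hU hJ _ hq, flatTul_iterate_zero,
      ← fderiv_jetTrans_eq_iterate he he' j (by lia) hq, Pi.zero_apply, zero_add] at this
    refine this.trans ?_
    rw [jetVert_apply_of_le _ _ _ (by simp), fderiv_jetTrans_apply he he' hq]
    simp

/-- The vertical endomorphisms do not depend on the natural coordinates. -/
lemma fderiv_jetTrans_comp_jetVert (he : e ∈ atlas E Q) (he' : e' ∈ atlas E Q)
    {q : JetModel E m} (hq : q ∈ jetDom m (e.symm.trans e').source) (r : ℕ) (w : JetModel E m) :
    fderiv ℝ (jetTrans m e e') q (jetVert E m r w) =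
      jetVert E m r (fderiv ℝ (jetTrans m e e') q w) := by
  induction r generalizing w with
  | zero => simp [jetVert_zero]
  | succ r ih =>
    rw [jetVert_succ, ContinuousLinearMap.comp_apply, ih, ContinuousLinearMap.comp_apply,
      fderiv_jetTrans_comp_jetVert_one he he' hq]

lemma ofCoords_jetTrunc {r : ℕ} (h : r ≤ m) (he : e ∈ atlas E Q) {q : JetModel E m}
    (hq : q ∈ jetDom m e.target) :
    (ofCoords e (jetTrunc E h q) : HTangent E r Q) = (ofCoords e q : HTangent E m Q).proj h := by
  have hb : (ofCoords e q : HTangent E m Q).base ∈ e.source := by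
    rw [base_ofCoords he hq]
    exact e.map_target hq
  have : coords e ((ofCoords e q : HTangent E m Q).proj h) = jetTrunc E h q := by
    funext i
    rw [coords_proj h he _ hb, coords_ofCoords he hq]
    rfl
  rw [← this, ofCoords_coords he _ (by rwa [base_proj])]

/-- The canonical injection does not depend on the natural coordinates. -/
lemma fderiv_jetTrans_jetTrunc_jetShift {r : ℕ} (h : r + 1 ≤ m) (he : e ∈ atlas E Q)
    (he' : e' ∈ atlas E Q) {q : JetModel E m} (hq : q ∈ jetDom m (e.symm.trans e').source) :
    fderiv ℝ (jetTrans r e e') (jetTrunc E (Nat.le_of_succ_le h) q)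
        (jetTrunc E (Nat.le_of_succ_le h) (jetShift E m q)) =
      jetTrunc E (Nat.le_of_succ_le h) (jetShift E m (jetTrans m e e' q)) := by
  have hr : r ≤ m := Nat.le_of_succ_le h
  have hU : IsOpen (jetDom m (e.symm.trans e').source) :=
    isOpen_jetDom (e.symm.trans e').open_source
  have hU' : IsOpen (jetDom r (e.symm.trans e').source) :=
    isOpen_jetDom (e.symm.trans e').open_source
  ext i
  have hq' : jetTrunc E hr q ∈ jetDom r (e.symm.trans e').source := hq
  rw [fderiv_jetTrans_apply he he' hq', jetTrunc_apply,
    jetShift_apply_of_lt _ _ (by simp; lia),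
    ← fderiv_jetTrans_jetShift he he' hq (Fin.castLE (by lia) i) (by simp; lia)]
  have h1 : (fun q => jetTrans m e e' q (Fin.castLE (by lia) i)) =ᶠ[𝓝 q]
      fun q => jetTrans r e e' (jetTrunc E hr q) i := by
    filter_upwards [hU.mem_nhds hq] with q' hq'
    have hq2 : q' 0 ∈ e.target ∧ e.symm (q' 0) ∈ e'.source := by simpa [jetDom] using hq'
    rw [jetTrans, jetTrans, ofCoords_jetTrunc hr he hq2.1, coords_proj hr he']
    rw [base_ofCoords he hq2.1]
    exact hq2.2
  rw [h1.fderiv_eq]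
  have hd : DifferentiableAt ℝ (fun q => jetTrans r e e' q i) (jetTrunc E hr q) :=
    differentiableAt_pi.1 (ContDiffOn.differentiableAt_of_isOpen
      (contDiffOn_jetTrans he he') hU' hq') i
  have := (hd.hasFDerivAt.comp q (jetTrunc E hr).hasFDerivAt).fderiv
  exact (DFunLike.congr_fun this (jetShift E m q)).symm

end Transition

/-! ### Forms on `T^m Q` read in an arbitrary natural chart. -/

section NaturalCharts

variable {E : Type*} [NormedAddCommGroup E] [NormedSpace ℝ E] {m : ℕ}
  {Q : Type*} [TopologicalSpace Q] [ChartedSpace E Q] [IsManifold 𝓘(ℝ, E) ∞ Q]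
  {e e' : OpenPartialHomeomorph Q E}

lemma jetChart_mem (he : e ∈ atlas E Q) : jetChart m e he ∈ (jetCore E m Q).atlas := ⟨e, he, rfl⟩

lemma jetChart_mem_atlas (he : e ∈ atlas E Q) :
    (jetCore E m Q).openPartialHomeomorph (jetChart m e he) (jetChart_mem he) ∈
      atlas (JetModel E m) (HTangent E m Q) :=
  mem_iUnion₂.2 ⟨_, jetChart_mem he, rfl⟩

lemma isOpen_base_preimage (he : e ∈ atlas E Q) :
    IsOpen {p : HTangent E m Q | p.base ∈ e.source} :=
  ((jetCore E m Q).openPartialHomeomorph (jetChart m e he) (jetChart_mem he)).open_source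

lemma contMDiffOn_coords (he : e ∈ atlas E Q) :
    ContMDiffOn 𝓘(ℝ, JetModel E m) 𝓘(ℝ, JetModel E m) ∞ (coords e)
      {p : HTangent E m Q | p.base ∈ e.source} :=
  contMDiffOn_of_mem_maximalAtlas (IsManifold.subset_maximalAtlas (jetChart_mem_atlas (m := m) he))

lemma contMDiffOn_ofCoords (he : e ∈ atlas E Q) :
    ContMDiffOn 𝓘(ℝ, JetModel E m) 𝓘(ℝ, JetModel E m) ∞
      (ofCoords e : JetModel E m → HTangent E m Q) (jetDom m e.target) :=
  contMDiffOn_symm_of_mem_maximalAtlas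
    (IsManifold.subset_maximalAtlas (jetChart_mem_atlas (m := m) he))

lemma mdifferentiableAt_ofCoords (he : e ∈ atlas E Q) {q : JetModel E m}
    (hq : q ∈ jetDom m e.target) : MDifferentiableAt 𝓘(ℝ, JetModel E m) 𝓘(ℝ, JetModel E m)
      (ofCoords e : JetModel E m → HTangent E m Q) q :=
  ((contMDiffOn_ofCoords he).contMDiffAt
    ((isOpen_jetDom e.open_target).mem_nhds hq)).mdifferentiableAt (by simp)

lemma mdifferentiableAt_coords (he : e ∈ atlas E Q) {p : HTangent E m Q}
    (hp : p.base ∈ e.source) : MDifferentiableAt 𝓘(ℝ, JetModel E m) 𝓘(ℝ, JetModel E m)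
      (coords e) p :=
  ((contMDiffOn_coords he).contMDiffAt
    ((isOpen_base_preimage he).mem_nhds hp)).mdifferentiableAt (by simp)

lemma ofCoords_base_mem (he : e ∈ atlas E Q) {q : JetModel E m} (hq : q ∈ jetDom m e.target) :
    (ofCoords e q : HTangent E m Q).base ∈ e.source := by
  rw [base_ofCoords he hq]
  exact e.map_target hq

lemma coords_mem_jetDom (he : e ∈ atlas E Q) {p : HTangent E m Q} (hp : p.base ∈ e.source) :
    coords e p ∈ jetDom m e.target := by
  change coords e p 0 ∈ e.target
  rw [coords_zero he p hp]
  exact e.map_source hp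

/-- The differential of the inverse of a natural chart of `T^m Q`. -/
def chartFrame (m : ℕ) (e : OpenPartialHomeomorph Q E) (q : JetModel E m) :
    JetModel E m →L[ℝ] JetModel E m :=
  mfderiv 𝓘(ℝ, JetModel E m) 𝓘(ℝ, JetModel E m) (ofCoords e : JetModel E m → HTangent E m Q) q

lemma mem_jetDom_trans {q : JetModel E m} (hq : q ∈ jetDom m e.target) :
    q ∈ jetDom m (e.symm.trans (chartAt E (e.symm (q 0)))).source := by
  have hq' : q 0 ∈ e.target := hq
  simp [jetDom, hq']

/-- Tangent vectors at a jet are read in the preferred chart over its base point, so the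
differential of `ofCoords e` is the Jacobian of the passage from `e` to that chart. -/
lemma chartFrame_eq (he : e ∈ atlas E Q) {q : JetModel E m} (hq : q ∈ jetDom m e.target) :
    chartFrame m e q = fderiv ℝ (jetTrans m e (chartAt E (e.symm (q 0)))) q := by
  rw [chartFrame, (mdifferentiableAt_ofCoords he hq).mfderiv]
  rw [← base_ofCoords (k := m) he hq]
  simp only [modelWithCornersSelf_coe, range_id, fderivWithin_univ]
  rfl

lemma jetTrans_self (he : e ∈ atlas E Q) {q : JetModel E m} (hq : q ∈ jetDom m e.target) :
    jetTrans m e e q = q := coords_ofCoords he hq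

lemma chartFrame_self (p : HTangent E m Q) :
    chartFrame m (chartAt E p.base) (coords (chartAt E p.base) p) =
      ContinuousLinearMap.id ℝ (JetModel E m) := by
  have he := chart_mem_atlas E p.base
  have hp := mem_chart_source E p.base
  have hq := coords_mem_jetDom he hp
  have h0 : (chartAt E p.base).symm (coords (chartAt E p.base) p 0) = p.base := by
    rw [coords_zero he p hp, (chartAt E p.base).left_inv hp]
  rw [chartFrame_eq he hq, h0]
  have : jetTrans m (chartAt E p.base) (chartAt E p.base) =ᶠ[𝓝 (coords (chartAt E p.base) p)]
      id := by
    filter_upwards [(isOpen_jetDom (chartAt E p.base).open_target).mem_nhds hq] with q' hq'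
    exact jetTrans_self he hq'
  rw [this.fderiv_eq, fderiv_id]

lemma chartFrame_trans (he : e ∈ atlas E Q) (he' : e' ∈ atlas E Q) {q : JetModel E m}
    (hq : q ∈ jetDom m (e.symm.trans e').source) :
    chartFrame m e q =
      (chartFrame m e' (jetTrans m e e' q)).comp (fderiv ℝ (jetTrans m e e') q) := by
  have hU : IsOpen (jetDom m (e.symm.trans e').source) :=
    isOpen_jetDom (e.symm.trans e').open_source
  have hd := ContDiffOn.differentiableAt_of_isOpen (contDiffOn_jetTrans he he') hU hq
  have hmem : ∀ q ∈ jetDom m (e.symm.trans e').source,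
      q 0 ∈ e.target ∧ e.symm (q 0) ∈ e'.source := fun q hq => by simpa [jetDom] using hq
  have hb : ∀ q ∈ jetDom m (e.symm.trans e').source,
      (ofCoords e q : HTangent E m Q).base ∈ e'.source := fun q hq => by
    rw [base_ofCoords he (hmem q hq).1]
    exact (hmem q hq).2
  have h1 : (ofCoords e : JetModel E m → HTangent E m Q) =ᶠ[𝓝 q]
      ofCoords e' ∘ jetTrans m e e' := by
    filter_upwards [hU.mem_nhds hq] with q' hq'
    exact (ofCoords_coords he' _ (hb q' hq')).symm
  rw [chartFrame, h1.mfderiv_eq]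
  refine (mfderiv_comp q (mdifferentiableAt_ofCoords he' (coords_mem_jetDom he' (hb q hq)))
    hd.mdifferentiableAt).trans ?_
  rw [mfderiv_eq_fderiv]
  rfl

lemma mfderiv_coords_chartFrame (he : e ∈ atlas E Q) {q : JetModel E m}
    (hq : q ∈ jetDom m e.target) (w : JetModel E m) :
    mfderiv 𝓘(ℝ, JetModel E m) 𝓘(ℝ, JetModel E m) (coords e) (ofCoords e q : HTangent E m Q)
      (chartFrame m e q w) = w := by
  have h1 : (coords e ∘ (ofCoords e : JetModel E m → HTangent E m Q)) =ᶠ[𝓝 q] id := by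
    filter_upwards [(isOpen_jetDom e.open_target).mem_nhds hq] with q' hq'
    exact coords_ofCoords he hq'
  have h2 := mfderiv_comp q (mdifferentiableAt_coords he (ofCoords_base_mem he hq))
    (mdifferentiableAt_ofCoords he hq)
  rw [h1.mfderiv_eq, mfderiv_id] at h2
  exact (DFunLike.congr_fun h2 w).symm

/-- A right inverse is the Jacobian of the passage from the preferred chart back to `e`. Test
vectors may thus be taken of the form `chartFrame m e q v`. -/
lemma chartFrame_surjective (he : e ∈ atlas E Q) {q : JetModel E m}
    (hq : q ∈ jetDom m e.target) : Function.Surjective (chartFrame m e q) := by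
  set p : HTangent E m Q := ofCoords e q with hp
  have hpe : p.base ∈ e.source := ofCoords_base_mem he hq
  have he' := chart_mem_atlas E p.base
  have hp' := mem_chart_source E p.base
  have hq' : coords (chartAt E p.base) p ∈ jetDom m ((chartAt E p.base).symm.trans e).source := by
    simp [jetDom, coords_zero he' p hp', hpe]
  have h := chartFrame_trans he' he hq'
  rw [chartFrame_self] at h
  have h2 : jetTrans m (chartAt E p.base) e (coords (chartAt E p.base) p) = q := by
    rw [jetTrans, ofCoords_coords he' p hp', hp, coords_ofCoords he hq]
  rw [h2] at h
  intro v
  exact ⟨_, (DFunLike.congr_fun h v).symm⟩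

/-- The coordinate expression of a `1`-form on `T^m Q` in a natural chart. -/
def locForm (e : OpenPartialHomeomorph Q E) (θ : OneForm 𝓘(ℝ, JetModel E m) (HTangent E m Q))
    (q : JetModel E m) : JetModel E m →L[ℝ] ℝ :=
  let A : JetModel E m →L[ℝ] ℝ := θ (ofCoords e q)
  A.comp (chartFrame m e q)

variable {θ : OneForm 𝓘(ℝ, JetModel E m) (HTangent E m Q)}

/-- The base point is a variable, so that two expressions for one jet can be exchanged without
transporting tangent vectors. -/
lemma locForm_apply_of_eq {q : JetModel E m} {x : HTangent E m Q} (hx : ofCoords e q = x)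
    (w : JetModel E m) : θ x (chartFrame m e q w) = locForm e θ q w := by
  subst hx
  rfl

lemma locForm_coords_self (p : HTangent E m Q) :
    locForm (chartAt E p.base) θ (coords (chartAt E p.base) p) = θ p := by
  have h : ofCoords (chartAt E p.base) (coords (chartAt E p.base) p) = p :=
    ofCoords_coords (chart_mem_atlas E _) p (mem_chart_source E _)
  ext w
  have := locForm_apply_of_eq (θ := θ) h w
  rw [chartFrame_self] at this
  exact this.symm

lemma locForm_trans (he : e ∈ atlas E Q) (he' : e' ∈ atlas E Q) {q : JetModel E m}
    (hq : q ∈ jetDom m (e.symm.trans e').source) :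
    locForm e θ q = (locForm e' θ (jetTrans m e e' q)).comp (fderiv ℝ (jetTrans m e e') q) := by
  have hq' : q 0 ∈ e.target ∧ e.symm (q 0) ∈ e'.source := by simpa [jetDom] using hq
  have h : ofCoords e' (jetTrans m e e' q) = (ofCoords e q : HTangent E m Q) :=
    ofCoords_coords he' _ (by rw [base_ofCoords he hq'.1]; exact hq'.2)
  ext w
  rw [ContinuousLinearMap.comp_apply, ← locForm_apply_of_eq h, ← locForm_apply_of_eq rfl,
    chartFrame_trans he he' hq]
  rfl

/-- A `1`-form on `T^m Q` with smooth coefficients in the natural charts. -/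
def SmoothForm (θ : OneForm 𝓘(ℝ, JetModel E m) (HTangent E m Q)) : Prop :=
  ∀ e ∈ atlas E Q, ContDiffOn ℝ ∞ (locForm e θ) (jetDom m e.target)

lemma extDerivOne_apply (p : HTangent E m Q) (u v : JetModel E m) :
    extDerivOne θ p u v =
      fderiv ℝ (locForm (chartAt E p.base) θ) (coords (chartAt E p.base) p) u v -
        fderiv ℝ (locForm (chartAt E p.base) θ) (coords (chartAt E p.base) p) v u := rfl

/-- The term with the second derivative of `f` is symmetric in `u` and `v` when `f` is smooth, and
so drops out of the exterior derivative. -/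
lemma fderiv_comp_form {V : Type*} [NormedAddCommGroup V] [NormedSpace ℝ V] {f : V → V}
    {β : V → V →L[ℝ] ℝ} {x : V} (hf : ContDiffAt ℝ ∞ f x) (hβ : DifferentiableAt ℝ β (f x))
    (u v : V) : fderiv ℝ (fun x => (β (f x)).comp (fderiv ℝ f x)) x u v =
      fderiv ℝ β (f x) (fderiv ℝ f x u) (fderiv ℝ f x v) +
        β (f x) (fderiv ℝ (fderiv ℝ f) x u v) := by
  have h1 : DifferentiableAt ℝ (fderiv ℝ f) x :=
    (hf.fderiv_right (m := ∞) (by simp)).differentiableAt (by simp)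
  have h2 : DifferentiableAt ℝ f x := hf.differentiableAt (by simp)
  have := ((hβ.hasFDerivAt.comp x h2.hasFDerivAt).clm_comp h1.hasFDerivAt).fderiv
  rw [show (fun x => (β (f x)).comp (fderiv ℝ f x)) =
    fun x => ((β ∘ f) x).comp (fderiv ℝ f x) from rfl, this]
  simp [add_comm]

/-- The exterior derivative may be computed in any natural chart. -/
lemma extDerivOne_chartFrame (hθ : SmoothForm θ) (he : e ∈ atlas E Q) {q : JetModel E m}
    (hq : q ∈ jetDom m e.target) (u v : JetModel E m) :
    extDerivOne θ (ofCoords e q) (chartFrame m e q u) (chartFrame m e q v) =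
      fderiv ℝ (locForm e θ) q u v - fderiv ℝ (locForm e θ) q v u := by
  have he' := chart_mem_atlas E (e.symm (q 0))
  have hq' := mem_jetDom_trans hq
  set e' := chartAt E (e.symm (q 0)) with hdef
  have hU : IsOpen (jetDom m (e.symm.trans e').source) :=
    isOpen_jetDom (e.symm.trans e').open_source
  have hb : (ofCoords e q : HTangent E m Q).base ∈ e'.source := by
    rw [base_ofCoords he hq]
    exact mem_chart_source _ _
  have hf := (contDiffOn_jetTrans (m := m) he he').contDiffAt (hU.mem_nhds hq')
  have hβ := ContDiffOn.differentiableAt_of_isOpen (hθ e' he') (isOpen_jetDom e'.open_target)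
    (coords_mem_jetDom he' hb)
  have hsymm : IsSymmSndFDerivAt ℝ (jetTrans m e e') q := hf.isSymmSndFDerivAt (by
    simp only [minSmoothness_of_isRCLikeNormedField]
    exact WithTop.coe_le_coe.2 (le_top : (2 : ℕ∞) ≤ ⊤))
  have h1 : locForm e θ =ᶠ[𝓝 q] fun q =>
      (locForm e' θ (jetTrans m e e' q)).comp (fderiv ℝ (jetTrans m e e') q) := by
    filter_upwards [hU.mem_nhds hq'] with q' hq'
    exact locForm_trans he he' hq'
  refine (extDerivOne_apply _ _ _).trans ?_
  rw [base_ofCoords he hq, ← hdef, h1.fderiv_eq, fderiv_comp_form hf hβ, fderiv_comp_form hf hβ,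
    hsymm.eq u v, chartFrame_eq he hq, ← hdef]
  simp only [jetTrans]
  ring

/-- `vertEndo` is defined through the preferred chart; the commutation of Jacobians with `jetVert`
carries its formula to `e`. -/
lemma vertEndo_chartFrame (he : e ∈ atlas E Q) {q : JetModel E m} (hq : q ∈ jetDom m e.target)
    (r : ℕ) (w : JetModel E m) :
    vertEndo r (ofCoords e q : HTangent E m Q) (chartFrame m e q w) =
      chartFrame m e q (jetVert E m r w) := by
  rw [chartFrame_eq he hq]
  exact (fderiv_jetTrans_comp_jetVert he (chart_mem_atlas E _) (mem_jetDom_trans hq) r w).symm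

lemma canonicalInjection_ofCoords {r : ℕ} (h : r + 1 ≤ m) (he : e ∈ atlas E Q)
    {q : JetModel E m} (hq : q ∈ jetDom m e.target) :
    canonicalInjection h (ofCoords e q : HTangent E m Q) =
      chartFrame r e (jetTrunc E (Nat.le_of_succ_le h) q)
        (jetTrunc E (Nat.le_of_succ_le h) (jetShift E m q)) := by
  rw [chartFrame_eq he (jetTrunc_mem_jetDom _ hq)]
  refine Eq.trans ?_ (fderiv_jetTrans_jetTrunc_jetShift h he (chart_mem_atlas E _)
    (mem_jetDom_trans hq)).symm
  funext i
  refine Eq.trans ?_ (jetShift_apply_of_lt _ (Fin.castLE (by lia) i) (by simp; lia)).symm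
  change coords (chartAt E (ofCoords e q : HTangent E m Q).base) _ _ = _
  rw [base_ofCoords he hq]
  rfl

lemma mfderiv_proj_chartFrame {r : ℕ} (h : r ≤ m) (he : e ∈ atlas E Q) {q : JetModel E m}
    (hq : q ∈ jetDom m e.target) (w : JetModel E m) :
    mfderiv 𝓘(ℝ, JetModel E m) 𝓘(ℝ, JetModel E r)
      (HTangent.proj h : HTangent E m Q → HTangent E r Q) (ofCoords e q) (chartFrame m e q w) =
      chartFrame r e (jetTrunc E h q) (jetTrunc E h w) := by
  have hU : IsOpen (jetDom m e.target) := isOpen_jetDom e.open_target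
  have h1 : (HTangent.proj h : HTangent E m Q → HTangent E r Q) ∘ ofCoords e =ᶠ[𝓝 q]
      ofCoords e ∘ jetTrunc E h := by
    filter_upwards [hU.mem_nhds hq] with q' hq'
    exact (ofCoords_jetTrunc h he hq').symm
  have h2 := mfderiv_comp q ((contMDiff_proj (E := E) (Q := Q) h).mdifferentiableAt (by simp))
    (mdifferentiableAt_ofCoords he hq)
  have h3 := mfderiv_comp q
    (mdifferentiableAt_ofCoords (Q := Q) he (jetTrunc_mem_jetDom h hq))
    (jetTrunc E h).differentiableAt.mdifferentiableAt
  rw [h1.mfderiv_eq, h3, mfderiv_eq_fderiv, (jetTrunc E h).fderiv] at h2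
  exact (DFunLike.congr_fun h2 w).symm

lemma contDiffOn_comp_ofCoords {f : HTangent E m Q → ℝ}
    (hf : ContMDiff 𝓘(ℝ, JetModel E m) 𝓘(ℝ, ℝ) ∞ f) (he : e ∈ atlas E Q) :
    ContDiffOn ℝ ∞ (f ∘ ofCoords e) (jetDom m e.target) :=
  contMDiffOn_iff_contDiffOn.1 (hf.comp_contMDiffOn (contMDiffOn_ofCoords he))

lemma dFun_chartFrame {f : HTangent E m Q → ℝ} {q : JetModel E m}
    (hf : MDifferentiableAt 𝓘(ℝ, JetModel E m) 𝓘(ℝ, ℝ) f (ofCoords e q)) (he : e ∈ atlas E Q)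
    (hq : q ∈ jetDom m e.target) (w : JetModel E m) :
    dFun (I := 𝓘(ℝ, JetModel E m)) f (ofCoords e q) (chartFrame m e q w) =
      fderiv ℝ (f ∘ ofCoords e) q w := by
  have h2 := mfderiv_comp q hf (mdifferentiableAt_ofCoords he hq)
  rw [mfderiv_eq_fderiv] at h2
  exact (DFunLike.congr_fun h2 w).symm

lemma locForm_vertDiff {f : HTangent E m Q → ℝ}
    (hf : ContMDiff 𝓘(ℝ, JetModel E m) 𝓘(ℝ, ℝ) ∞ f) (he : e ∈ atlas E Q) (r : ℕ) :
    EqOn (locForm e (vertDiff r f)) (flatVertDiff r (f ∘ ofCoords e)) (jetDom m e.target) := by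
  intro q hq
  ext w
  refine Eq.trans ?_ (dFun_chartFrame (hf.mdifferentiableAt (by simp)) he hq (jetVert E m r w))
  rw [← vertEndo_chartFrame he hq]
  rfl

/-- The coordinate expression on `T^N Q` of a `1`-form on `T^m Q`, for `m ≤ N`. -/
def flatForm {N : ℕ} (h : m ≤ N) (e : OpenPartialHomeomorph Q E)
    (θ : OneForm 𝓘(ℝ, JetModel E m) (HTangent E m Q)) (q : JetModel E N) :
    JetModel E N →L[ℝ] ℝ :=
  (locForm e θ (jetTrunc E h q)).comp (jetTrunc E h)

lemma SmoothForm.contDiffOn_flatForm (hθ : SmoothForm θ) {N : ℕ} (h : m ≤ N)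
    (he : e ∈ atlas E Q) : ContDiffOn ℝ ∞ (flatForm h e θ) (jetDom N e.target) :=
  ((hθ e he).comp (jetTrunc E h).contDiff.contDiffOn
    fun _ hq => jetTrunc_mem_jetDom h hq).clm_comp contDiffOn_const

lemma locForm_pullOne_proj {N : ℕ} (h : m ≤ N) (he : e ∈ atlas E Q) :
    EqOn (locForm e (pullOne (HTangent.proj h : HTangent E N Q → HTangent E m Q) θ))
      (flatForm h e θ) (jetDom N e.target) := by
  intro q hq
  ext w
  rw [flatForm, ContinuousLinearMap.comp_apply,
    ← locForm_apply_of_eq (ofCoords_jetTrunc h he hq), ← mfderiv_proj_chartFrame h he hq]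
  rfl

lemma SmoothForm.flatTul_flatForm (hθ : SmoothForm θ) {N : ℕ} (h : m ≤ N) (he : e ∈ atlas E Q)
    {q : JetModel E N} (hq : q ∈ jetDom N e.target) (w : JetModel E N) :
    flatTul (flatForm h e θ) q w =
      fderiv ℝ (locForm e θ) (jetTrunc E h q) (jetTrunc E h (jetShift E N q)) (jetTrunc E h w) +
        locForm e θ (jetTrunc E h q) (jetTrunc E h (jetShift E N w)) := by
  have hd := ContDiffOn.differentiableAt_of_isOpen (hθ e he) (isOpen_jetDom e.open_target)
    (jetTrunc_mem_jetDom h hq)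
  have h1 := ((hd.hasFDerivAt.comp q (jetTrunc E h).hasFDerivAt).clm_comp
    (hasFDerivAt_const (jetTrunc E h) q)).fderiv
  have h2 : fderiv ℝ (flatForm h e θ) q = _ := h1
  rw [flatTul, add_apply, h2]
  simp [flatForm]

lemma contractT_ofCoords (he : e ∈ atlas E Q) {q : JetModel E (m + 1)}
    (hq : q ∈ jetDom (m + 1) e.target) :
    contractT θ (ofCoords e q) =
      flatForm m.le_succ e θ q (jetShift E (m + 1) q) := by
  rw [contractT, canonicalInjection_ofCoords le_rfl he hq]
  exact locForm_apply_of_eq (ofCoords_jetTrunc m.le_succ he hq) _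

lemma mdifferentiableAt_of_comp_ofCoords {f : HTangent E m Q → ℝ} (he : e ∈ atlas E Q)
    {q : JetModel E m} (hq : q ∈ jetDom m e.target) (h : DifferentiableAt ℝ (f ∘ ofCoords e) q) :
    MDifferentiableAt 𝓘(ℝ, JetModel E m) 𝓘(ℝ, ℝ) f (ofCoords e q) := by
  have hp := ofCoords_base_mem he hq
  have h1 : f =ᶠ[𝓝 (ofCoords e q)] (f ∘ ofCoords e) ∘ coords e := by
    filter_upwards [(isOpen_base_preimage he).mem_nhds hp] with p' hp'
    simp [ofCoords_coords he p' hp']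
  refine MDifferentiableAt.congr_of_eventuallyEq ?_ h1
  refine MDifferentiableAt.comp _ ?_ (mdifferentiableAt_coords he hp)
  rw [coords_ofCoords he hq]
  exact h.mdifferentiableAt

/-- Cartan's formula: the term `Dθ(w)(S q)` occurs with opposite signs in `i_T dθ` and `d i_T θ`,
which leaves `Dθ(S q)(w) + θ(S w)`. -/
lemma SmoothForm.locForm_tulczyjew (hθ : SmoothForm θ) (he : e ∈ atlas E Q) :
    EqOn (locForm e (tulczyjew θ)) (flatTul (flatForm m.le_succ e θ))
      (jetDom (m + 1) e.target) := by
  intro q hq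
  have hU : IsOpen (jetDom (m + 1) e.target) := isOpen_jetDom e.open_target
  ext w
  have hs := hθ.contDiffOn_flatForm m.le_succ he
  have hd := ContDiffOn.differentiableAt_of_isOpen hs hU hq
  have hev : contractT θ ∘ ofCoords e =ᶠ[𝓝 q] fun q =>
      flatForm m.le_succ e θ q (jetShift E (m + 1) q) := by
    filter_upwards [hU.mem_nhds hq] with q' hq'
    exact contractT_ofCoords he hq'
  have hd2 := hd.hasFDerivAt.clm_apply (jetShift E (m + 1)).hasFDerivAt
  have h1 : dFun (I := 𝓘(ℝ, JetModel E (m + 1))) (contractT θ) (ofCoords e q)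
      (chartFrame (m + 1) e q w) =
      fderiv ℝ (flatForm m.le_succ e θ) q w (jetShift E (m + 1) q) +
        flatForm m.le_succ e θ q (jetShift E (m + 1) w) := by
    rw [dFun_chartFrame (mdifferentiableAt_of_comp_ofCoords he hq
      (hd2.differentiableAt.congr_of_eventuallyEq hev)) he hq, hev.fderiv_eq, hd2.fderiv]
    simp [add_comm]
  have h2 : fderiv ℝ (flatForm m.le_succ e θ) q =
      ((ContinuousLinearMap.compL ℝ (JetModel E (m + 1)) (JetModel E m) ℝ).flip
        (jetTrunc E m.le_succ)).comp
        ((fderiv ℝ (locForm e θ) (jetTrunc E m.le_succ q)).comp (jetTrunc E m.le_succ)) := by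
    have hd := ContDiffOn.differentiableAt_of_isOpen (hθ e he) (isOpen_jetDom e.open_target)
      (jetTrunc_mem_jetDom m.le_succ hq)
    have h1 := ((hd.hasFDerivAt.comp q (jetTrunc E m.le_succ).hasFDerivAt).clm_comp
      (hasFDerivAt_const (jetTrunc E m.le_succ) q)).fderiv
    refine (show fderiv ℝ (flatForm m.le_succ e θ) q = _ from h1).trans ?_
    ext u v
    simp
  have h3 : ∀ (x : HTangent E m Q) (hx : ofCoords e (jetTrunc E m.le_succ q) = x)
      (u v : JetModel E m), extDerivOne θ x (chartFrame m e (jetTrunc E m.le_succ q) u)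
        (chartFrame m e (jetTrunc E m.le_succ q) v) =
        fderiv ℝ (locForm e θ) (jetTrunc E m.le_succ q) u v -
          fderiv ℝ (locForm e θ) (jetTrunc E m.le_succ q) v u := by
    rintro x rfl u v
    exact extDerivOne_chartFrame hθ he (jetTrunc_mem_jetDom m.le_succ hq) u v
  have h4 : locForm e (tulczyjew θ) q w =
      extDerivOne θ ((ofCoords e q : HTangent E (m + 1) Q).proj m.le_succ)
        (canonicalInjection le_rfl (ofCoords e q))
        (mfderiv 𝓘(ℝ, JetModel E (m + 1)) 𝓘(ℝ, JetModel E m)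
          (HTangent.proj m.le_succ : HTangent E (m + 1) Q → HTangent E m Q) (ofCoords e q)
          (chartFrame (m + 1) e q w)) +
        dFun (I := 𝓘(ℝ, JetModel E (m + 1))) (contractT θ) (ofCoords e q)
          (chartFrame (m + 1) e q w) := rfl
  rw [h4, h1, canonicalInjection_ofCoords le_rfl he hq, mfderiv_proj_chartFrame m.le_succ he hq,
    h3 _ (ofCoords_jetTrunc m.le_succ he hq), hθ.flatTul_flatForm m.le_succ he hq, h2]
  simp only [flatForm, ContinuousLinearMap.comp_apply, ContinuousLinearMap.flip_apply,
    ContinuousLinearMap.compL_apply]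
  ring

lemma SmoothForm.tulczyjew (hθ : SmoothForm θ) : SmoothForm (tulczyjew θ) := fun _ he =>
  (contDiffOn_flatTul (isOpen_jetDom (OpenPartialHomeomorph.open_target _))
    (hθ.contDiffOn_flatForm m.le_succ he)).congr (hθ.locForm_tulczyjew he)

/-- All orders are compared on one space `E^{N+1}`. The artificial zero in the top slot of the shift
is invisible because a form of order `m < N` only reads slots up to `m` of `S q` and `S w`. -/
lemma SmoothForm.flatForm_tulczyjew (hθ : SmoothForm θ) {N : ℕ} (h : m + 1 ≤ N)
    (he : e ∈ atlas E Q) : EqOn (flatForm h e (HigherOrder.tulczyjew θ))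
      (flatTul (flatForm (Nat.le_of_succ_le h) e θ)) (jetDom N e.target) := by
  intro q hq
  ext w
  have hq' := jetTrunc_mem_jetDom h hq
  have hS : ∀ z : JetModel E N, jetTrunc E m.le_succ (jetShift E (m + 1) (jetTrunc E h z)) =
      jetTrunc E (Nat.le_of_succ_le h) (jetShift E N z) := by
    intro z
    ext i
    rw [jetTrunc_apply, jetTrunc_apply, jetShift_apply_of_lt _ _ (by simp; lia),
      jetShift_apply_of_lt _ _ (by simp; lia)]
    rfl
  rw [hθ.flatTul_flatForm _ he hq, flatForm, ContinuousLinearMap.comp_apply,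
    hθ.locForm_tulczyjew he hq', hθ.flatTul_flatForm _ he hq', hS, hS]
  rfl

lemma SmoothForm.tulczyjewIter (hθ : SmoothForm θ) (i : ℕ) : SmoothForm (tulczyjewIter θ i) := by
  induction i with
  | zero => exact hθ
  | succ i ih => exact ih.tulczyjew

lemma SmoothForm.flatForm_tulczyjewIter (hθ : SmoothForm θ) {N : ℕ} (he : e ∈ atlas E Q) (i : ℕ)
    (h : m + i ≤ N) : EqOn (flatForm h e (HigherOrder.tulczyjewIter θ i))
      (flatTul^[i] (flatForm ((Nat.le_add_right m i).trans h) e θ)) (jetDom N e.target) := by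
  induction i with
  | zero => exact fun q _ => rfl
  | succ i ih =>
    intro q hq
    rw [Function.iterate_succ_apply', ← flatTul_congr (isOpen_jetDom e.open_target)
      (ih (by lia)) hq]
    exact (hθ.tulczyjewIter i).flatForm_tulczyjew (by lia) he hq

end NaturalCharts

/-! ### The Lagrangian forms of `L` in natural charts. -/

section LagrangianForm

variable {E : Type*} [NormedAddCommGroup E] [NormedSpace ℝ E] {k : ℕ}
  {Q : Type*} [TopologicalSpace Q] [ChartedSpace E Q] [IsManifold 𝓘(ℝ, E) ∞ Q]
  {e : OpenPartialHomeomorph Q E} {L : HTangent E k Q → ℝ}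

/-- The coordinate expression on `T^N Q` of a function on `T^k Q`. -/
def flatFun {N : ℕ} (h : k ≤ N) (e : OpenPartialHomeomorph Q E) (L : HTangent E k Q → ℝ)
    (q : JetModel E N) : ℝ :=
  L (ofCoords e (jetTrunc E h q))

lemma contDiffOn_flatFun {N : ℕ} (h : k ≤ N)
    (hL : ContMDiff 𝓘(ℝ, JetModel E k) 𝓘(ℝ, ℝ) ∞ L) (he : e ∈ atlas E Q) :
    ContDiffOn ℝ ∞ (flatFun h e L) (jetDom N e.target) :=
  (contDiffOn_comp_ofCoords hL he).comp (jetTrunc E h).contDiff.contDiffOn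
    fun _ hq => jetTrunc_mem_jetDom h hq

lemma hasOrder_flatFun {N : ℕ} (h : k ≤ N) : HasOrder k (flatFun h e L) := by
  intro q z hz
  have : jetTrunc E h z = 0 := by
    ext i
    exact hz _ (by simp; lia)
  rw [flatFun, map_add, this, add_zero]
  rfl

lemma smoothForm_vertDiff (hL : ContMDiff 𝓘(ℝ, JetModel E k) 𝓘(ℝ, ℝ) ∞ L) (r : ℕ) :
    SmoothForm (vertDiff r L) := fun _ he =>
  (contDiffOn_flatVertDiff (OpenPartialHomeomorph.open_target _)
    (contDiffOn_comp_ofCoords hL he) r).congr (locForm_vertDiff hL he r)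

lemma jetTrunc_jetVert {N : ℕ} (h : k ≤ N) (r : ℕ) (w : JetModel E N) :
    jetTrunc E h (jetVert E N r w) = jetVert E k r (jetTrunc E h w) := by
  ext j
  rw [jetTrunc_apply]
  by_cases hr : r ≤ j
  · rw [jetVert_apply_of_le _ _ _ hr, jetVert_apply_of_le _ _ _ (by simpa using hr)]
    rfl
  · rw [jetVert_apply_of_lt _ _ _ (by simpa using hr),
      jetVert_apply_of_lt _ _ _ (by simpa using hr)]

lemma flatForm_vertDiff {N : ℕ} (h : k ≤ N) (hL : ContMDiff 𝓘(ℝ, JetModel E k) 𝓘(ℝ, ℝ) ∞ L)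
    (he : e ∈ atlas E Q) (r : ℕ) :
    EqOn (flatForm h e (vertDiff r L)) (flatVertDiff r (flatFun h e L)) (jetDom N e.target) := by
  intro q hq
  ext w
  have hq' := jetTrunc_mem_jetDom h hq
  have hd := ContDiffOn.differentiableAt_of_isOpen (contDiffOn_comp_ofCoords hL he)
    (isOpen_jetDom e.open_target) hq'
  have h1 : fderiv ℝ (flatFun h e L) q = _ :=
    (hd.hasFDerivAt.comp q (jetTrunc E h).hasFDerivAt).fderiv
  rw [flatForm, locForm_vertDiff hL he r hq', flatVertDiff, flatVertDiff, h1]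
  simp only [ContinuousLinearMap.comp_apply, jetTrunc_jetVert]

/-- The bridge from `θ_L`, whose summands live on bundles of different orders, to the sum of
iterates of one operator on `E^{2k}`. -/
lemma locForm_lagrangianOne (hL : ContMDiff 𝓘(ℝ, JetModel E k) 𝓘(ℝ, ℝ) ∞ L) (he : e ∈ atlas E Q)
    (h : k ≤ 2 * k - 1) : EqOn (locForm e (lagrangianOne L)) (flatTheta k (flatFun h e L))
      (jetDom (2 * k - 1) e.target) := by
  intro q hq
  ext w
  have h0 : ∀ (x : HTangent E (2 * k - 1) Q) (v : TangentSpace 𝓘(ℝ, JetModel E (2 * k - 1)) x),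
      lagrangianOne L x v = ∑ i : Fin k, ((-1) ^ (i : ℕ) / ((i : ℕ) + 1).factorial : ℝ) •
        pullOne (HTangent.proj (order_add_le i)) (tulczyjewIter (vertDiff (i + 1) L) i) x v := by
    intro x v
    rw [lagrangianOne, Finset.sum_apply, sum_apply]
    rfl
  have h1 : locForm e (lagrangianOne L) q w = ∑ i : Fin k,
      ((-1) ^ (i : ℕ) / ((i : ℕ) + 1).factorial : ℝ) •
        locForm e (pullOne (HTangent.proj (order_add_le i))
          (tulczyjewIter (vertDiff (i + 1) L) i)) q w := h0 _ (chartFrame (2 * k - 1) e q w)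
  rw [h1, flatTheta, sum_apply]
  refine Finset.sum_congr rfl fun i _ => ?_
  rw [smul_apply, locForm_pullOne_proj _ he hq,
    (smoothForm_vertDiff hL _).flatForm_tulczyjewIter he _ _ hq,
    flatTul_iterate_congr (isOpen_jetDom e.open_target) (flatForm_vertDiff h hL he _) _ hq]

lemma smoothForm_lagrangianOne (hL : ContMDiff 𝓘(ℝ, JetModel E k) 𝓘(ℝ, ℝ) ∞ L)
    (h : k ≤ 2 * k - 1) : SmoothForm (lagrangianOne L) := fun e he =>
  (contDiffOn_flatTheta e.open_target (contDiffOn_flatFun h hL he)).congr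
    (locForm_lagrangianOne hL he h)

lemma lagrangianTwo_chartFrame (hL : ContMDiff 𝓘(ℝ, JetModel E k) 𝓘(ℝ, ℝ) ∞ L)
    (h : k ≤ 2 * k - 1) (he : e ∈ atlas E Q) {q : JetModel E (2 * k - 1)}
    (hq : q ∈ jetDom (2 * k - 1) e.target) (u v : JetModel E (2 * k - 1)) :
    lagrangianTwo L (ofCoords e q) (chartFrame _ e q u) (chartFrame _ e q v) =
      flatOmega (flatTheta k (flatFun h e L)) q u v := by
  have h1 := extDerivOne_chartFrame (smoothForm_lagrangianOne hL h) he hq u v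
  have h2 : locForm e (lagrangianOne L) =ᶠ[𝓝 q] flatTheta k (flatFun h e L) :=
    (locForm_lagrangianOne hL he h).eventuallyEq_of_mem
      ((isOpen_jetDom e.open_target).mem_nhds hq)
  rw [h2.fderiv_eq] at h1
  rw [flatOmega_apply, ← neg_sub, ← h1]
  rfl

lemma flatOmega_nondegenerate (hL : ContMDiff 𝓘(ℝ, JetModel E k) 𝓘(ℝ, ℝ) ∞ L)
    (hreg : IsRegularLagrangian L) (h : k ≤ 2 * k - 1) (he : e ∈ atlas E Q)
    {q : JetModel E (2 * k - 1)} (hq : q ∈ jetDom (2 * k - 1) e.target)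
    (u : JetModel E (2 * k - 1))
    (hu : ∀ v, flatOmega (flatTheta k (flatFun h e L)) q u v = 0) : u = 0 := by
  have h1 : chartFrame (2 * k - 1) e q u = 0 := by
    refine hreg (ofCoords e q) _ fun v => ?_
    obtain ⟨v, rfl⟩ := chartFrame_surjective he hq v
    exact (lagrangianTwo_chartFrame hL h he hq u v).trans (hu v)
  rw [← mfderiv_coords_chartFrame he hq u, h1]
  exact map_zero _

end LagrangianForm

/-! ### Canonical form and Hamiltonian in the charts of `W`. -/

section UnifiedCharts

variable {E : Type*} [NormedAddCommGroup E] [NormedSpace ℝ E] {k m : ℕ}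
  {Q : Type*} [TopologicalSpace Q] [ChartedSpace E Q] [IsManifold 𝓘(ℝ, E) ∞ Q]

/-- The fibre coordinate of a covector in the trivialization over the preferred chart at `x₀`. -/
def covectorCoord (x₀ : HTangent E m Q) (α : Cotangent (JetModel E m) (HTangent E m Q)) :
    JetModel E m →L[ℝ] ℝ :=
  (trivializationAt (JetModel E m →L[ℝ] ℝ)
    (CotangentSpace (JetModel E m) (HTangent E m Q)) x₀ α).2

/-- The fibre coordinates of a covector are its components on the natural frame of the fixed chart;
in other words, they are the momenta `p`. -/
lemma covectorCoord_apply (x₀ x : HTangent E m Q)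
    (α : CotangentSpace (JetModel E m) (HTangent E m Q) x)
    (hx : x.base ∈ (chartAt E x₀.base).source) (w : JetModel E m) :
    covectorCoord x₀ ⟨x, α⟩ w =
      α (chartFrame m (chartAt E x₀.base) (coords (chartAt E x₀.base) x) w) := by
  have h1 := TangentBundle.symmL_trivializationAt (I := 𝓘(ℝ, JetModel E m))
    (M := HTangent E m Q) (x₀ := x₀) (x := x) hx
  rw [modelWithCornersSelf_coe, range_id, mfderivWithin_univ] at h1
  have h2 := DFunLike.congr_fun h1 w
  rw [covectorCoord, hom_trivializationAt_apply]
  simp only [ContinuousLinearMap.inCoordinates, ContinuousLinearMap.comp_apply]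
  refine Eq.trans ?_ (congrArg α h2)
  exact DFunLike.congr_fun
    (Trivial.continuousLinearMapAt_trivialization ℝ (HTangent E m Q) ℝ x) _

variable (E m) in
/-- The model with corners of the cotangent bundle of `T^m Q`. -/
abbrev cotangentModel := 𝓘(ℝ, JetModel E m).prod 𝓘(ℝ, JetModel E m →L[ℝ] ℝ)

lemma base_mem_of_mem_source_cotangent {α₀ α : Cotangent (JetModel E m) (HTangent E m Q)}
    (h : α ∈ (extChartAt (cotangentModel E m) α₀).source) :
    α.1.base ∈ (chartAt E α₀.1.base).source := by
  rw [FiberBundle.extChartAt] at h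
  exact ((Trivialization.mem_source _).1 h.1).1

lemma base_mem_of_mem_source_unified {w₀ w : UnifiedSpace E k Q}
    (h : w ∈ (extChartAt (unifiedModel E k) w₀).source) :
    w.1.base ∈ (chartAt E w₀.1.base).source := by
  rw [FiberBundle.extChartAt] at h
  have h2 : (baseProj E k Q w.1).base ∈ (chartAt E (baseProj E k Q w₀.1).base).source :=
    ((Trivialization.mem_source _).1 h.1).1
  exact base_proj (E := E) (Q := Q) (k := 2 * k - 1) (r := k - 1) (by lia) w.1 ▸
    base_proj (E := E) (Q := Q) (k := 2 * k - 1) (r := k - 1) (by lia) w₀.1 ▸ h2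

/-- In the charts of the cotangent bundle the canonical `1`-form is `p dq`, so its negative
differential is `dq ∧ dp`. -/
lemma canonicalTwo_apply (α₀ : Cotangent (JetModel E m) (HTangent E m Q))
    (u v : JetModel E m × (JetModel E m →L[ℝ] ℝ)) :
    canonicalTwo (JetModel E m) (HTangent E m Q) α₀ u v = v.2 u.1 - u.2 v.1 := by
  set φ := extChartAt (cotangentModel E m) α₀ with hφdef
  set e := chartAt E α₀.1.base with he
  have hmem : e ∈ atlas E Q := chart_mem_atlas E α₀.1.base
  have ht : ∀ y ∈ φ.target, φ.target ∈ 𝓝 y := fun y hy =>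
    (isOpen_extChartAt_target (I := cotangentModel E m) α₀).mem_nhds hy
  have hφ : ∀ y ∈ φ.target, (coords e (φ.symm y).1, covectorCoord α₀.1 (φ.symm y)) = y :=
    fun y hy => φ.right_inv hy
  have hsrc : ∀ y ∈ φ.target, (φ.symm y).1.base ∈ e.source :=
    fun y hy => base_mem_of_mem_source_cotangent (φ.map_target hy)
  have hproj : ∀ y ∈ φ.target, (φ.symm y).1 = ofCoords e y.1 := fun y hy =>
    (ofCoords_coords hmem _ (hsrc y hy)).symm.trans
      (congrArg (ofCoords e) (Prod.ext_iff.1 (hφ y hy)).1)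
  have hdom : ∀ y ∈ φ.target, y.1 ∈ jetDom m e.target := fun y hy =>
    (Prod.ext_iff.1 (hφ y hy)).1 ▸ coords_mem_jetDom hmem (hsrc y hy)
  -- The formula `p dq` is needed on a neighbourhood, since its coefficients are then
  -- differentiated.
  have h1 : (fun y => (canonicalOne (JetModel E m) (HTangent E m Q) (φ.symm y)).comp
        (mfderiv 𝓘(ℝ, JetModel E m × (JetModel E m →L[ℝ] ℝ)) (cotangentModel E m) φ.symm y))
        =ᶠ[𝓝 (φ α₀)]
      fun y => y.2.comp (ContinuousLinearMap.fst ℝ _ _) := by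
    filter_upwards [ht _ (mem_extChartAt_target α₀)] with y hy
    have hd : MDifferentiableAt 𝓘(ℝ, JetModel E m × (JetModel E m →L[ℝ] ℝ)) (cotangentModel E m)
        φ.symm y :=
      ((contMDiffOn_extChartAt_symm (n := 1) α₀).contMDiffAt (ht y hy)).mdifferentiableAt (by simp)
    refine ContinuousLinearMap.ext fun w => ?_
    have h2 := mfderiv_comp y (mdifferentiableAt_proj (𝕜 := ℝ)
      (CotangentSpace (JetModel E m) (HTangent E m Q)) (IB := 𝓘(ℝ, JetModel E m))
      (p := φ.symm y)) hd
    have h3 : π (JetModel E m →L[ℝ] ℝ) (CotangentSpace (JetModel E m) (HTangent E m Q)) ∘ φ.symm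
        =ᶠ[𝓝 y] ofCoords e ∘ Prod.fst := by
      filter_upwards [ht y hy] with y' hy'
      exact hproj y' hy'
    have h4 := mfderiv_comp y (mdifferentiableAt_ofCoords (Q := Q) hmem (hdom y hy))
      (ContinuousLinearMap.fst ℝ (JetModel E m)
        (JetModel E m →L[ℝ] ℝ)).differentiableAt.mdifferentiableAt
    rw [mfderiv_eq_fderiv, fderiv_fst] at h4
    rw [h3.mfderiv_eq] at h2
    have h5 := DFunLike.congr_fun (h2.symm.trans h4) w
    have h6 := covectorCoord_apply α₀.1 (φ.symm y).1 (φ.symm y).2 (hsrc y hy) w.1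
    have h6' : coords e (φ.symm y).1 = y.1 := (Prod.ext_iff.1 (hφ y hy)).1
    have h7 : covectorCoord α₀.1 ⟨(φ.symm y).1, (φ.symm y).2⟩ = y.2 := (Prod.ext_iff.1 (hφ y hy)).2
    rw [h7, ← he, h6'] at h6
    refine Eq.trans ?_ h6.symm
    exact congrArg (φ.symm y).2 h5
  have h8 : HasFDerivAt (fun y : JetModel E m × (JetModel E m →L[ℝ] ℝ) =>
      y.2.comp (ContinuousLinearMap.fst ℝ (JetModel E m) (JetModel E m →L[ℝ] ℝ))) _ (φ α₀) :=
    hasFDerivAt_snd.clm_comp (hasFDerivAt_const _ _)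
  have h9 := h8.fderiv
  rw [← h1.fderiv_eq] at h9
  have h10 : ∀ u v : JetModel E m × (JetModel E m →L[ℝ] ℝ),
      fderiv ℝ (fun y => (canonicalOne (JetModel E m) (HTangent E m Q) (φ.symm y)).comp
        (mfderiv 𝓘(ℝ, JetModel E m × (JetModel E m →L[ℝ] ℝ)) (cotangentModel E m) φ.symm y))
        (φ α₀) u v = u.2 v.1 := fun u v => by
    rw [h9]
    simp
  have h11 : canonicalTwo (JetModel E m) (HTangent E m Q) α₀ u v = -(_ - _) :=
    congrArg Neg.neg (congrArg₂ (· - ·) (h10 u v) (h10 v u))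
  rw [h11]
  ring

lemma baseProj_base (p : HTangent E (2 * k - 1) Q) : (baseProj E k Q p).base = p.base :=
  base_proj (by lia) p

variable (E k) in
/-- The truncation `(q_0, …, q_{2k-1}) ↦ (q_0, …, q_{k-1})`. -/
def baseTrunc : JetModel E (2 * k - 1) →L[ℝ] JetModel E (k - 1) := jetTrunc E (by lia)

lemma coords_baseProj {e : OpenPartialHomeomorph Q E} (he : e ∈ atlas E Q)
    {p : HTangent E (2 * k - 1) Q} (hp : p.base ∈ e.source) :
    coords e (baseProj E k Q p) = baseTrunc E k (coords e p) :=
  funext fun i => coords_proj (by lia) he p hp i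

lemma covectorCoord_prTwo (p₀ : HTangent E (2 * k - 1) Q) (w : UnifiedSpace E k Q)
    (hw : w.1.base ∈ (chartAt E p₀.base).source) (z : JetModel E (k - 1)) :
    covectorCoord (baseProj E k Q p₀) (prTwo w) z =
      (prTwo w).2 (chartFrame (k - 1) (chartAt E p₀.base)
        (baseTrunc E k (coords (chartAt E p₀.base) w.1)) z) := by
  have h := covectorCoord_apply (baseProj E k Q p₀) (baseProj E k Q w.1) w.2
    (by rwa [baseProj_base, baseProj_base]) z
  rw [baseProj_base, coords_baseProj (chart_mem_atlas E _) hw] at h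
  exact h

/-- The preferred charts at `w₀` and at `prTwo w₀` come from the same chart of `Q`, and in them the
map is linear: truncation of `q`, identity on `p`. -/
lemma hasMFDerivAt_prTwo (w₀ : UnifiedSpace E k Q) :
    HasMFDerivAt (unifiedModel E k) (cotangentModel E (k - 1)) prTwo w₀
      ((baseTrunc E k).prodMap (ContinuousLinearMap.id ℝ (JetModel E (k - 1) →L[ℝ] ℝ))) := by
  refine ⟨(Pullback.continuous_lift _ _ _).continuousAt, ?_⟩
  set φ := extChartAt (unifiedModel E k) w₀
  rw [ModelWithCorners.range_eq_univ]
  refine HasFDerivAt.hasFDerivWithinAt ?_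
  refine (ContinuousLinearMap.hasFDerivAt _).congr_of_eventuallyEq ?_
  filter_upwards [(isOpen_extChartAt_target (I := unifiedModel E k) w₀).mem_nhds
    (mem_extChartAt_target w₀)] with y hy
  have h1 := base_mem_of_mem_source_unified (φ.map_target hy)
  have h2 : (coords (chartAt E w₀.1.base) (φ.symm y).1,
    covectorCoord (baseProj E k Q w₀.1) (prTwo (φ.symm y))) = y := φ.right_inv hy
  have h3 : writtenInExtChartAt (unifiedModel E k) (cotangentModel E (k - 1)) w₀ prTwo y =
      (coords (chartAt E (baseProj E k Q w₀.1).base) (baseProj E k Q (φ.symm y).1),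
        covectorCoord (baseProj E k Q w₀.1) (prTwo (φ.symm y))) := rfl
  rw [h3, baseProj_base, coords_baseProj (chart_mem_atlas E _) h1]
  exact congrArg (Prod.map (baseTrunc E k) id) h2

lemma unifiedTwo_apply (w : UnifiedSpace E k Q)
    (u v : JetModel E (2 * k - 1) × (JetModel E (k - 1) →L[ℝ] ℝ)) :
    unifiedTwo E k Q w u v = v.2 (baseTrunc E k u.1) - u.2 (baseTrunc E k v.1) := by
  have h1 : ∀ u : JetModel E (2 * k - 1) × (JetModel E (k - 1) →L[ℝ] ℝ),
      mfderiv (unifiedModel E k) (cotangentModel E (k - 1)) prTwo w u =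
        (baseTrunc E k u.1, u.2) := fun u => by
    rw [(hasMFDerivAt_prTwo w).mfderiv]
    rfl
  have h2 : unifiedTwo E k Q w u v = canonicalTwo (JetModel E (k - 1)) (HTangent E (k - 1) Q)
      (prTwo w) (mfderiv (unifiedModel E k) (cotangentModel E (k - 1)) prTwo w u)
      (mfderiv (unifiedModel E k) (cotangentModel E (k - 1)) prTwo w v) := rfl
  rw [h2, h1, h1, canonicalTwo_apply]

lemma coupling_apply (hk : 1 ≤ k) {e : OpenPartialHomeomorph Q E} (he : e ∈ atlas E Q)
    {w : UnifiedSpace E k Q} (hw : w.1.base ∈ e.source) :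
    coupling hk w = (prTwo w).2 (chartFrame (k - 1) e (baseTrunc E k (coords e w.1))
      (baseTrunc E k (jetShift E (2 * k - 1) (coords e w.1)))) := by
  have h := canonicalInjection_ofCoords (r := k - 1) (m := 2 * k - 1) (by lia) he
    (coords_mem_jetDom he hw)
  rw [ofCoords_coords he w.1 hw] at h
  exact congrArg (prTwo w).2 h

lemma hamiltonian_apply (hk : 1 ≤ k) (h : k ≤ 2 * k - 1) (L : HTangent E k Q → ℝ)
    {e : OpenPartialHomeomorph Q E} (he : e ∈ atlas E Q)
    {w : UnifiedSpace E k Q} (hw : w.1.base ∈ e.source) :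
    hamiltonian hk L w = (prTwo w).2 (chartFrame (k - 1) e (baseTrunc E k (coords e w.1))
      (baseTrunc E k (jetShift E (2 * k - 1) (coords e w.1)))) - flatFun h e L (coords e w.1) := by
  rw [hamiltonian, coupling_apply hk he hw, flatFun,
    ofCoords_jetTrunc h he (coords_mem_jetDom he hw), ofCoords_coords he w.1 hw]

lemma exists_hasFDerivAt_pairing {V W : Type*} [NormedAddCommGroup V] [NormedSpace ℝ V]
    [NormedAddCommGroup W] [NormedSpace ℝ W] (A : V →L[ℝ] W) {g : V → ℝ} {g' : V →L[ℝ] ℝ}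
    {y : V × (W →L[ℝ] ℝ)} (hg : HasFDerivAt g g' y.1) :
    ∃ D : V × (W →L[ℝ] ℝ) →L[ℝ] ℝ,
      HasFDerivAt (fun y : V × (W →L[ℝ] ℝ) => y.2 (A y.1) - g y.1) D y ∧
      ∀ v, D v = v.2 (A y.1) + y.2 (A v.1) - g' v.1 := by
  refine ⟨_, ((hasFDerivAt_snd (𝕜 := ℝ) (p := y)).clm_apply
    (A.hasFDerivAt.comp y hasFDerivAt_fst)).sub (hg.comp y hasFDerivAt_fst), fun v => ?_⟩
  simp [add_comm]

/-- In the chart at `w₀`, whose differential at `w₀` is the identity, `H` is `⟨p, (q_1, …, q_k)⟩ -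
L`; this is the product rule. -/
lemma dFun_hamiltonian (hk : 1 ≤ k) (h : k ≤ 2 * k - 1) {L : HTangent E k Q → ℝ}
    (hL : ContMDiff 𝓘(ℝ, JetModel E k) 𝓘(ℝ, ℝ) ∞ L) (w₀ : UnifiedSpace E k Q)
    (v : JetModel E (2 * k - 1) × (JetModel E (k - 1) →L[ℝ] ℝ)) :
    dFun (I := unifiedModel E k) (hamiltonian hk L) w₀ v =
      v.2 (baseTrunc E k (jetShift E (2 * k - 1) (coords (chartAt E w₀.1.base) w₀.1))) +
      covectorCoord (baseProj E k Q w₀.1) (prTwo w₀)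
        (baseTrunc E k (jetShift E (2 * k - 1) v.1)) -
      fderiv ℝ (flatFun h (chartAt E w₀.1.base) L) (coords (chartAt E w₀.1.base) w₀.1) v.1 := by
  set φ := extChartAt (unifiedModel E k) w₀
  set e := chartAt E w₀.1.base
  have he : e ∈ atlas E Q := chart_mem_atlas E _
  set q₀ := coords e w₀.1
  have hq₀ : q₀ ∈ jetDom (2 * k - 1) e.target := coords_mem_jetDom he (mem_chart_source E _)
  set RS := (baseTrunc E k).comp (jetShift E (2 * k - 1))
  have hd := ContDiffOn.differentiableAt_of_isOpen (contDiffOn_flatFun h hL he)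
    (isOpen_jetDom e.open_target) hq₀
  obtain ⟨D, hD, hDv⟩ := exists_hasFDerivAt_pairing RS
    (y := (q₀, covectorCoord (baseProj E k Q w₀.1) (prTwo w₀))) hd.hasFDerivAt
  have hHf : hamiltonian hk L =ᶠ[𝓝 w₀]
      (fun y : JetModel E (2 * k - 1) × (JetModel E (k - 1) →L[ℝ] ℝ) =>
        y.2 (RS y.1) - flatFun h e L y.1) ∘ φ := by
    filter_upwards [extChartAt_source_mem_nhds (I := unifiedModel E k) w₀] with w hw
    have h1 := base_mem_of_mem_source_unified hw
    rw [hamiltonian_apply hk h L he h1, ← covectorCoord_prTwo w₀.1 w h1]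
    rfl
  have h2 : HasMFDerivAt (unifiedModel E k) 𝓘(ℝ, ℝ) (hamiltonian hk L) w₀ _ :=
    (HasMFDerivAt.comp w₀ (HasFDerivAt.hasMFDerivAt hD)
      (mdifferentiableAt_extChartAt (mem_chart_source _ w₀)).hasMFDerivAt).congr_of_eventuallyEq hHf
  have h3 : dFun (I := unifiedModel E k) (hamiltonian hk L) w₀ = _ := h2.mfderiv
  refine (DFunLike.congr_fun h3 v).trans ?_
  rw [mfderiv_extChartAt_self]
  exact hDv v

end UnifiedCharts

/-! ### The Legendre–Ostrogradsky map and its graph. -/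

section LegendreMap

variable {E : Type*} [NormedAddCommGroup E] [NormedSpace ℝ E] {k : ℕ}
  {Q : Type*} [TopologicalSpace Q] [ChartedSpace E Q] [IsManifold 𝓘(ℝ, E) ∞ Q]
  {e : OpenPartialHomeomorph Q E} {L : HTangent E k Q → ℝ}

lemma exists_ofCoords_eq {m : ℕ} (he : e ∈ atlas E Q) {p : HTangent E m Q}
    (hp : p.base ∈ e.source) : ∃ q ∈ jetDom m e.target, ofCoords e q = p :=
  ⟨coords e p, coords_mem_jetDom he hp, ofCoords_coords he p hp⟩

variable (E k) in
/-- The extension `(q_0, …, q_{k-1}) ↦ (q_0, …, q_{k-1}, 0, …, 0)`. -/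
def baseExtend : JetModel E (k - 1) →L[ℝ] JetModel E (2 * k - 1) :=
  ContinuousLinearMap.pi fun j : Fin (2 * k - 1 + 1) =>
    if h : (j : ℕ) < k - 1 + 1 then
      ContinuousLinearMap.proj (R := ℝ) (φ := fun _ : Fin (k - 1 + 1) => E) ⟨j, h⟩
    else 0

lemma baseExtend_apply_of_lt (z : JetModel E (k - 1)) (j : Fin (2 * k - 1 + 1))
    (h : (j : ℕ) < k - 1 + 1) : baseExtend E k z j = z ⟨j, h⟩ := by
  simp only [baseExtend, ContinuousLinearMap.coe_pi', dif_pos h, ContinuousLinearMap.proj_apply]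

lemma baseTrunc_baseExtend (z : JetModel E (k - 1)) : baseTrunc E k (baseExtend E k z) = z :=
  funext fun j => baseExtend_apply_of_lt z (Fin.castLE (by lia) j) j.2

lemma baseExtend_baseTrunc_apply (w : JetModel E (2 * k - 1)) (j : Fin (2 * k - 1 + 1))
    (h : (j : ℕ) < k) : baseExtend E k (baseTrunc E k w) j = w j := by
  rw [baseExtend_apply_of_lt _ _ (by lia)]
  rfl

/-- The coordinate expression of `θ_L`. -/
def localTheta (h : k ≤ 2 * k - 1) (e : OpenPartialHomeomorph Q E) (L : HTangent E k Q → ℝ) :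
    JetModel E (2 * k - 1) → (JetModel E (2 * k - 1) →L[ℝ] ℝ) :=
  flatTheta k (flatFun h e L)

lemma contDiffOn_localTheta (h : k ≤ 2 * k - 1)
    (hL : ContMDiff 𝓘(ℝ, JetModel E k) 𝓘(ℝ, ℝ) ∞ L)
    (he : e ∈ atlas E Q) :
    ContDiffOn ℝ ∞ (localTheta h e L) (jetDom (2 * k - 1) e.target) :=
  contDiffOn_flatTheta e.open_target (contDiffOn_flatFun h hL he)

lemma localTheta_baseExtend (h : k ≤ 2 * k - 1)
    (hL : ContMDiff 𝓘(ℝ, JetModel E k) 𝓘(ℝ, ℝ) ∞ L)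
    (he : e ∈ atlas E Q) {q : JetModel E (2 * k - 1)}
    (hq : q ∈ jetDom (2 * k - 1) e.target) (w : JetModel E (2 * k - 1)) :
    localTheta h e L q (baseExtend E k (baseTrunc E k w)) = localTheta h e L q w :=
  ((hasOrder_flatFun h).semibasicOn_flatTheta e.open_target (contDiffOn_flatFun h hL he)).congr hq
    fun j hj => baseExtend_baseTrunc_apply w j hj

lemma mfderiv_baseProj_chartFrame (he : e ∈ atlas E Q) {q : JetModel E (2 * k - 1)}
    (hq : q ∈ jetDom (2 * k - 1) e.target) (w : JetModel E (2 * k - 1)) :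
    mfderiv 𝓘(ℝ, JetModel E (2 * k - 1)) 𝓘(ℝ, JetModel E (k - 1)) (baseProj E k Q)
      (ofCoords e q) (chartFrame (2 * k - 1) e q w) =
      chartFrame (k - 1) e (baseTrunc E k q) (baseTrunc E k w) :=
  mfderiv_proj_chartFrame (by lia) he hq w

/-- As `legendre` is a choice by `epsilon`, the content is that some covector exists. It does
because `θ_L` kills the vectors with vanishing first `k` components, that is, the kernel of `Tρ`. -/
lemma legendre_spec (h : k ≤ 2 * k - 1)
    (hL : ContMDiff 𝓘(ℝ, JetModel E k) 𝓘(ℝ, ℝ) ∞ L)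
    (p : HTangent E (2 * k - 1) Q)
    (u : TangentSpace 𝓘(ℝ, JetModel E (2 * k - 1)) p) :
    lagrangianOne L p u = legendre L p (mfderiv 𝓘(ℝ, JetModel E (2 * k - 1))
      𝓘(ℝ, JetModel E (k - 1)) (baseProj E k Q) p u) := by
  refine Classical.epsilon_spec (p := fun α : CotangentSpace (JetModel E (k - 1))
    (HTangent E (k - 1) Q) (baseProj E k Q p) => ∀ u : TangentSpace 𝓘(ℝ, JetModel E (2 * k - 1)) p,
    lagrangianOne L p u = α (mfderiv 𝓘(ℝ, JetModel E (2 * k - 1)) 𝓘(ℝ, JetModel E (k - 1))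
        (baseProj E k Q) p u)) ?_ u
  set e := chartAt E p.base
  have he : e ∈ atlas E Q := chart_mem_atlas E _
  have hp : p.base ∈ e.source := mem_chart_source E _
  have hq := coords_mem_jetDom he hp
  -- In the preferred chart the frames at `p` and at `ρ(p)` are identities, so the covector is `θ_L`
  -- on any extension; the zeros put in by `baseExtend` do not matter.
  refine ⟨(localTheta h e L (coords e p)).comp (baseExtend E k), fun u => ?_⟩
  have h1 := mfderiv_baseProj_chartFrame he hq u
  rw [chartFrame_self, ← coords_baseProj he hp] at h1
  have h2 := chartFrame_self (baseProj E k Q p)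
  rw [baseProj_base] at h2
  rw [h2, ofCoords_coords he p hp] at h1
  refine (DFunLike.congr_fun (locForm_coords_self (θ := lagrangianOne L) p) u).symm.trans ?_
  rw [locForm_lagrangianOne hL he h hq]
  refine (localTheta_baseExtend h hL he hq u).symm.trans ?_
  exact congrArg (fun z => localTheta h e L (coords e p) (baseExtend E k z)) h1.symm

lemma legendre_chartFrame (h : k ≤ 2 * k - 1)
    (hL : ContMDiff 𝓘(ℝ, JetModel E k) 𝓘(ℝ, ℝ) ∞ L)
    (he : e ∈ atlas E Q) {q : JetModel E (2 * k - 1)}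
    (hq : q ∈ jetDom (2 * k - 1) e.target) (w : JetModel E (2 * k - 1)) :
    legendre L (ofCoords e q) (chartFrame (k - 1) e (baseTrunc E k q) (baseTrunc E k w)) =
      localTheta h e L q w := by
  rw [← mfderiv_baseProj_chartFrame he hq]
  refine (legendre_spec h hL _ _).symm.trans ?_
  exact DFunLike.congr_fun (locForm_lagrangianOne hL he h hq) w

lemma covectorCoord_graphMap (h : k ≤ 2 * k - 1)
    (hL : ContMDiff 𝓘(ℝ, JetModel E k) 𝓘(ℝ, ℝ) ∞ L)
    (p₀ : HTangent E (2 * k - 1) Q) {q : JetModel E (2 * k - 1)}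
    (hq : q ∈ jetDom (2 * k - 1) (chartAt E p₀.base).target) :
    covectorCoord (baseProj E k Q p₀) (prTwo (graphMap L (ofCoords (chartAt E p₀.base) q))) =
      (localTheta h (chartAt E p₀.base) L q).comp (baseExtend E k) := by
  have he := chart_mem_atlas E p₀.base
  refine ContinuousLinearMap.ext fun z => ?_
  rw [covectorCoord_prTwo p₀ _ (ofCoords_base_mem he hq), ContinuousLinearMap.comp_apply,
    ← legendre_chartFrame h hL he hq, baseTrunc_baseExtend]
  have : coords (chartAt E p₀.base) (graphMap L (ofCoords (chartAt E p₀.base) q)).1 = q :=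
    coords_ofCoords he hq
  rw [this]
  rfl

lemma contMDiff_graphMap (h : k ≤ 2 * k - 1)
    (hL : ContMDiff 𝓘(ℝ, JetModel E k) 𝓘(ℝ, ℝ) ∞ L) :
    ContMDiff 𝓘(ℝ, JetModel E (2 * k - 1)) (unifiedModel E k) ∞
    (graphMap L) := by
  intro p
  rw [contMDiffAt_totalSpace]
  refine ⟨contMDiffAt_id, ?_⟩
  set e := chartAt E p.base
  have he : e ∈ atlas E Q := chart_mem_atlas E _
  have hp : p.base ∈ e.source := mem_chart_source E _
  have hdom := (isOpen_jetDom (N := 2 * k - 1) e.open_target).mem_nhds (coords_mem_jetDom he hp)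
  have h1 : ContMDiffAt 𝓘(ℝ, JetModel E (2 * k - 1)) 𝓘(ℝ, JetModel E (k - 1) →L[ℝ] ℝ) ∞
      ((fun q => (localTheta h e L q).comp (baseExtend E k)) ∘ coords e) p := by
    refine ContMDiffAt.comp p (I' := 𝓘(ℝ, JetModel E (2 * k - 1))) ?_
      ((contMDiffOn_coords he).contMDiffAt ((isOpen_base_preimage he).mem_nhds hp))
    exact (((contDiffOn_localTheta h hL he).clm_comp contDiffOn_const).contDiffAt
      hdom).contMDiffAt
  refine h1.congr_of_eventuallyEq ?_
  filter_upwards [(isOpen_base_preimage he).mem_nhds hp] with p' hp'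
  obtain ⟨q, hq, rfl⟩ := exists_ofCoords_eq he hp'
  refine (covectorCoord_graphMap h hL p hq).trans ?_
  rw [Function.comp_apply, coords_ofCoords he hq]

/-- In the chart the graph map is `q ↦ (q, θ_q ∘ baseExtend)`, and only `θ` varies in the second
component. -/
lemma mfderiv_graphMap (h : k ≤ 2 * k - 1)
    (hL : ContMDiff 𝓘(ℝ, JetModel E k) 𝓘(ℝ, ℝ) ∞ L)
    (p : HTangent E (2 * k - 1) Q) (u : JetModel E (2 * k - 1)) :
    mfderiv 𝓘(ℝ, JetModel E (2 * k - 1)) (unifiedModel E k) (graphMap L) p u =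
      (u, (fderiv ℝ (localTheta h (chartAt E p.base) L) (coords (chartAt E p.base) p) u).comp
        (baseExtend E k)) := by
  set e := chartAt E p.base with hedef
  have he : e ∈ atlas E Q := chart_mem_atlas E _
  have hp : p.base ∈ e.source := mem_chart_source E _
  have hq := coords_mem_jetDom he hp
  have hdom := (isOpen_jetDom (N := 2 * k - 1) e.open_target).mem_nhds hq
  have hd := (ContDiffOn.differentiableAt_of_isOpen (contDiffOn_localTheta h hL he)
    (isOpen_jetDom e.open_target) hq).hasFDerivAt
  have h1 := (hasFDerivAt_id (𝕜 := ℝ) (coords e p)).prodMk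
    (hd.clm_comp (hasFDerivAt_const (baseExtend E k) _))
  have h2 : writtenInExtChartAt 𝓘(ℝ, JetModel E (2 * k - 1)) (unifiedModel E k) p (graphMap L)
      =ᶠ[𝓝 (coords e p)] fun q => (q, (localTheta h e L q).comp (baseExtend E k)) := by
    filter_upwards [hdom] with q hq
    exact Prod.ext (coords_ofCoords he hq) (covectorCoord_graphMap h hL p hq)
  have h3 : HasMFDerivAt 𝓘(ℝ, JetModel E (2 * k - 1)) (unifiedModel E k) (graphMap L) p _ :=
    ⟨(contMDiff_graphMap h hL p).continuousAt,
      (h1.congr_of_eventuallyEq h2).hasFDerivWithinAt⟩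
  rw [h3.mfderiv]
  refine Prod.ext rfl (ContinuousLinearMap.ext fun z => ?_)
  simp only [ContinuousLinearMap.comp_zero, zero_add]
  rfl

end LegendreMap

/-! ### Equivalence with the Euler–Lagrange equation, and smoothness. -/

section Dynamics

variable {E : Type*} [NormedAddCommGroup E] [NormedSpace ℝ E] {k : ℕ}
  {Q : Type*} [TopologicalSpace Q] [ChartedSpace E Q] [IsManifold 𝓘(ℝ, E) ∞ Q]
  {e : OpenPartialHomeomorph Q E} {L : HTangent E k Q → ℝ}

/-- The Euler–Lagrange equation at `q` in the natural coordinates of `e`. -/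
def LocalEulerLagrange (h : k ≤ 2 * k - 1) (e : OpenPartialHomeomorph Q E)
    (L : HTangent E k Q → ℝ) (q u : JetModel E (2 * k - 1)) : Prop :=
  ∀ v, flatOmega (localTheta h e L) q u v =
    fderiv ℝ (flatEnergy (localTheta h e L) (flatFun h e L)) q v

lemma fderiv_localTheta_baseExtend (h : k ≤ 2 * k - 1)
    (hL : ContMDiff 𝓘(ℝ, JetModel E k) 𝓘(ℝ, ℝ) ∞ L) (he : e ∈ atlas E Q)
    {q : JetModel E (2 * k - 1)} (hq : q ∈ jetDom (2 * k - 1) e.target)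
    (v w : JetModel E (2 * k - 1)) :
    fderiv ℝ (localTheta h e L) q v (baseExtend E k (baseTrunc E k w)) =
      fderiv ℝ (localTheta h e L) q v w := by
  have hU := isOpen_jetDom (N := 2 * k - 1) e.open_target
  have hd := ContDiffOn.differentiableAt_of_isOpen (contDiffOn_localTheta h hL he) hU hq
  have hev : ∀ w, HasFDerivAt (fun q => localTheta h e L q w)
      ((fderiv ℝ (localTheta h e L) q).flip w) q := fun w => by
    have := hd.hasFDerivAt.clm_apply (hasFDerivAt_const w q)
    simpa using this
  have h1 : (fun q => localTheta h e L q w) =ᶠ[𝓝 q]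
      fun q => localTheta h e L q (baseExtend E k (baseTrunc E k w)) := by
    filter_upwards [hU.mem_nhds hq] with q' hq'
    exact (localTheta_baseExtend h hL he hq' w).symm
  exact DFunLike.congr_fun (((hev w).congr_of_eventuallyEq h1.symm).unique (hev _)).symm v

lemma localEulerLagrange_unique (h : k ≤ 2 * k - 1)
    (hL : ContMDiff 𝓘(ℝ, JetModel E k) 𝓘(ℝ, ℝ) ∞ L) (hreg : IsRegularLagrangian L)
    (he : e ∈ atlas E Q) {q : JetModel E (2 * k - 1)} (hq : q ∈ jetDom (2 * k - 1) e.target)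
    {u u' : JetModel E (2 * k - 1)} (hu : LocalEulerLagrange h e L q u)
    (hu' : LocalEulerLagrange h e L q u') : u = u' := by
  rw [← sub_eq_zero]
  refine flatOmega_nondegenerate hL hreg h he hq _ fun v => ?_
  rw [map_sub, sub_apply]
  exact sub_eq_zero.2 ((hu v).trans (hu' v).symm)

lemma exists_localEulerLagrange [FiniteDimensional ℝ E] (hk : 1 ≤ k) (h : k ≤ 2 * k - 1)
    (hL : ContMDiff 𝓘(ℝ, JetModel E k) 𝓘(ℝ, ℝ) ∞ L) (hreg : IsRegularLagrangian L)
    (he : e ∈ atlas E Q) {q : JetModel E (2 * k - 1)} (hq : q ∈ jetDom (2 * k - 1) e.target) :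
    ∃ c, LocalEulerLagrange h e L q (jetShift E (2 * k - 1) q + Pi.single (Fin.last _) c) :=
  (hasOrder_flatFun h).exists_flat_solution e.open_target (contDiffOn_flatFun h hL he) (by lia) hq
    (flatOmega_nondegenerate hL hreg h he hq)

/-- By uniqueness the solution is `S q` corrected in the last slot only. This holonomy is the source
of the semispray property. -/
lemma LocalEulerLagrange.apply_of_lt [FiniteDimensional ℝ E] (hk : 1 ≤ k) {h : k ≤ 2 * k - 1}
    (hL : ContMDiff 𝓘(ℝ, JetModel E k) 𝓘(ℝ, ℝ) ∞ L) (hreg : IsRegularLagrangian L)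
    (he : e ∈ atlas E Q) {q : JetModel E (2 * k - 1)} (hq : q ∈ jetDom (2 * k - 1) e.target)
    {u : JetModel E (2 * k - 1)} (hu : LocalEulerLagrange h e L q u) (i : Fin (2 * k - 1 + 1))
    (hi : (i : ℕ) + 1 < 2 * k - 1 + 1) : u i = q ⟨i + 1, hi⟩ := by
  obtain ⟨c, hc⟩ := exists_localEulerLagrange hk h hL hreg he hq
  rw [localEulerLagrange_unique h hL hreg he hq hu hc, Pi.add_apply, jetShift_apply_of_lt _ _ hi,
    Pi.single_eq_of_ne (by rw [ne_eq, Fin.ext_iff, Fin.val_last]; lia), add_zero]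

/-- The dynamical equation at a point of the graph of the Legendre map, in coordinates, for a vector
tangent to the graph. -/
lemma dynamics_iff_localEulerLagrange [FiniteDimensional ℝ E] (hk : 1 ≤ k) (h : k ≤ 2 * k - 1)
    (hL : ContMDiff 𝓘(ℝ, JetModel E k) 𝓘(ℝ, ℝ) ∞ L) (hreg : IsRegularLagrangian L)
    (he : e ∈ atlas E Q) {q : JetModel E (2 * k - 1)} (hq : q ∈ jetDom (2 * k - 1) e.target)
    (u : JetModel E (2 * k - 1)) :
    (∀ (v : JetModel E (2 * k - 1)) (b : JetModel E (k - 1) →L[ℝ] ℝ),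
      b (baseTrunc E k u) - fderiv ℝ (localTheta h e L) q u (baseExtend E k (baseTrunc E k v)) =
        b (baseTrunc E k (jetShift E (2 * k - 1) q)) +
          localTheta h e L q (baseExtend E k (baseTrunc E k (jetShift E (2 * k - 1) v))) -
          fderiv ℝ (flatFun h e L) q v) ↔ LocalEulerLagrange h e L q u := by
  have hU := isOpen_jetDom (N := 2 * k - 1) e.open_target
  have hd := ContDiffOn.differentiableAt_of_isOpen (contDiffOn_localTheta h hL he) hU hq
  have hd' := ContDiffOn.differentiableAt_of_isOpen (contDiffOn_flatFun h hL he) hU hq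
  -- `Dθ(v)` reads only the first `k` slots of its argument, so the two terms by which the
  -- Euler–Lagrange equation differs from the dynamics cancel.
  have key : baseTrunc E k u = baseTrunc E k (jetShift E (2 * k - 1) q) → ∀ v,
      fderiv ℝ (localTheta h e L) q v u =
        fderiv ℝ (localTheta h e L) q v (jetShift E (2 * k - 1) q) := fun hR v => by
    rw [← fderiv_localTheta_baseExtend h hL he hq v u, hR,
      fderiv_localTheta_baseExtend h hL he hq]
  simp only [LocalEulerLagrange, flatOmega_apply, fderiv_flatEnergy hd hd',
    localTheta_baseExtend h hL he hq, fderiv_localTheta_baseExtend h hL he hq]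
  constructor
  · intro H v
    -- The fibre directions alone give the half `u_i = q_{i+1}`, `i < k`, of the equations, since
    -- the covectors `b` separate points.
    have hR : baseTrunc E k u = baseTrunc E k (jetShift E (2 * k - 1) q) := by
      rw [SeparatingDual.eq_iff_forall_dual_eq (R := ℝ)]
      intro b
      simpa using H 0 b
    have := H v 0
    simp only [zero_apply, zero_sub, zero_add] at this
    rw [key hR v]
    linarith
  · intro H v b
    -- In this direction the same half comes from regularity: the correction to `S q` sits in slot
    -- `2k - 1`, which the truncation drops.
    have hR : baseTrunc E k u = baseTrunc E k (jetShift E (2 * k - 1) q) := by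
      obtain ⟨c, hc⟩ := exists_localEulerLagrange hk h hL hreg he hq
      have hu : LocalEulerLagrange h e L q u := fun v => by
        rw [flatOmega_apply, fderiv_flatEnergy hd hd', H v]
      rw [localEulerLagrange_unique h hL hreg he hq hu hc, map_add, add_eq_left]
      funext i
      exact Pi.single_eq_of_ne (by rw [ne_eq, Fin.ext_iff, Fin.val_last]; simp; lia) _
    have := H v
    rw [key hR v] at this
    rw [hR]
    linarith

/-- The Lagrangian energy. -/
def lagrangianEnergy (hk : 1 ≤ k) (L : HTangent E k Q → ℝ) (p : HTangent E (2 * k - 1) Q) : ℝ :=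
  hamiltonian hk L (graphMap L p)

/-- The global Euler–Lagrange equation `i_u ω_L = dE_L`. -/
def EulerLagrange (hk : 1 ≤ k) (L : HTangent E k Q → ℝ) (p : HTangent E (2 * k - 1) Q)
    (u : JetModel E (2 * k - 1)) : Prop :=
  ∀ v : JetModel E (2 * k - 1), lagrangianTwo L p u v =
    dFun (I := 𝓘(ℝ, JetModel E (2 * k - 1))) (lagrangianEnergy hk L) p v

lemma lagrangianEnergy_ofCoords (hk : 1 ≤ k) (h : k ≤ 2 * k - 1)
    (hL : ContMDiff 𝓘(ℝ, JetModel E k) 𝓘(ℝ, ℝ) ∞ L) (he : e ∈ atlas E Q)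
    {q : JetModel E (2 * k - 1)} (hq : q ∈ jetDom (2 * k - 1) e.target) :
    lagrangianEnergy hk L (ofCoords e q) = flatEnergy (localTheta h e L) (flatFun h e L) q := by
  have hw : (graphMap L (ofCoords e q)).1.base ∈ e.source := ofCoords_base_mem he hq
  have h1 : coords e (graphMap L (ofCoords e q)).1 = q := coords_ofCoords he hq
  rw [lagrangianEnergy, hamiltonian_apply hk h L he hw, h1, flatEnergy,
    ← legendre_chartFrame h hL he hq]
  rfl

/-- Both sides of `i_u ω_L = dE_L` are natural. Moving the equation to one fixed chart is what
allows comparison of nearby points, whose preferred charts may differ. -/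
lemma eulerLagrange_chartFrame_iff (hk : 1 ≤ k) (h : k ≤ 2 * k - 1)
    (hL : ContMDiff 𝓘(ℝ, JetModel E k) 𝓘(ℝ, ℝ) ∞ L) (he : e ∈ atlas E Q)
    {q : JetModel E (2 * k - 1)} (hq : q ∈ jetDom (2 * k - 1) e.target)
    (u : JetModel E (2 * k - 1)) :
    EulerLagrange hk L (ofCoords e q) (chartFrame (2 * k - 1) e q u) ↔
      LocalEulerLagrange h e L q u := by
  have hU := isOpen_jetDom (N := 2 * k - 1) e.open_target
  have hd := ContDiffOn.differentiableAt_of_isOpen (contDiffOn_localTheta h hL he) hU hq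
  have hd' := ContDiffOn.differentiableAt_of_isOpen (contDiffOn_flatFun h hL he) hU hq
  have h1 : lagrangianEnergy hk L ∘ ofCoords e =ᶠ[𝓝 q]
      flatEnergy (localTheta h e L) (flatFun h e L) := by
    filter_upwards [hU.mem_nhds hq] with q' hq'
    exact lagrangianEnergy_ofCoords hk h hL he hq'
  have h2 : DifferentiableAt ℝ (flatEnergy (localTheta h e L) (flatFun h e L)) q :=
    (hd.clm_apply (jetShift E (2 * k - 1)).differentiableAt).sub hd'
  have h3 := mdifferentiableAt_of_comp_ofCoords (Q := Q) he hq (h2.congr_of_eventuallyEq h1)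
  have h4 := fun v => dFun_chartFrame h3 he hq v
  rw [h1.fderiv_eq] at h4
  refine ⟨fun H v => ?_, fun H v => ?_⟩
  · exact ((lagrangianTwo_chartFrame hL h he hq u v).symm.trans (H _)).trans (h4 v)
  · obtain ⟨v, rfl⟩ := chartFrame_surjective he hq v
    exact ((lagrangianTwo_chartFrame hL h he hq u v).trans (H v)).trans (h4 v).symm

lemma eulerLagrange_iff (hk : 1 ≤ k) (h : k ≤ 2 * k - 1)
    (hL : ContMDiff 𝓘(ℝ, JetModel E k) 𝓘(ℝ, ℝ) ∞ L) (p : HTangent E (2 * k - 1) Q)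
    (u : JetModel E (2 * k - 1)) :
    EulerLagrange hk L p u ↔
      LocalEulerLagrange h (chartAt E p.base) L (coords (chartAt E p.base) p) u := by
  have he := chart_mem_atlas E p.base
  have hp := mem_chart_source E p.base
  have h1 := eulerLagrange_chartFrame_iff hk h hL he (coords_mem_jetDom he hp) u
  rwa [chartFrame_self, ofCoords_coords he p hp] at h1

lemma EulerLagrange.unique {hk : 1 ≤ k} (hL : ContMDiff 𝓘(ℝ, JetModel E k) 𝓘(ℝ, ℝ) ∞ L)
    (hreg : IsRegularLagrangian L) {p : HTangent E (2 * k - 1) Q} {u u' : JetModel E (2 * k - 1)}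
    (hu : EulerLagrange hk L p u) (hu' : EulerLagrange hk L p u') : u = u' := by
  have h : k ≤ 2 * k - 1 := by lia
  rw [eulerLagrange_iff hk h hL] at hu hu'
  exact localEulerLagrange_unique h hL hreg (chart_mem_atlas E _)
    (coords_mem_jetDom (chart_mem_atlas E _) (mem_chart_source E _)) hu hu'

lemma exists_eulerLagrange [FiniteDimensional ℝ E] (hk : 1 ≤ k)
    (hL : ContMDiff 𝓘(ℝ, JetModel E k) 𝓘(ℝ, ℝ) ∞ L)
    (hreg : IsRegularLagrangian L) (p : HTangent E (2 * k - 1) Q) :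
    ∃ u, EulerLagrange hk L p u := by
  have h : k ≤ 2 * k - 1 := by lia
  obtain ⟨c, hc⟩ := exists_localEulerLagrange hk h hL hreg (chart_mem_atlas E p.base)
    (coords_mem_jetDom (chart_mem_atlas E _) (mem_chart_source E _))
  exact ⟨_, (eulerLagrange_iff hk h hL p _).2 hc⟩

/-- A vector tangent to the graph of the Legendre map solves the dynamical equation if and only if
its projection solves the Euler–Lagrange equation. -/
lemma solves_iff_eulerLagrange [FiniteDimensional ℝ E] (hk : 1 ≤ k)
    (hL : ContMDiff 𝓘(ℝ, JetModel E k) 𝓘(ℝ, ℝ) ∞ L) (hreg : IsRegularLagrangian L)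
    (p : HTangent E (2 * k - 1) Q) (u : JetModel E (2 * k - 1)) :
    (∀ v : JetModel E (2 * k - 1) × (JetModel E (k - 1) →L[ℝ] ℝ),
      unifiedTwo E k Q (graphMap L p)
        (mfderiv 𝓘(ℝ, JetModel E (2 * k - 1)) (unifiedModel E k) (graphMap L) p u) v =
      dFun (I := unifiedModel E k) (hamiltonian hk L) (graphMap L p) v) ↔
      EulerLagrange hk L p u := by
  have h : k ≤ 2 * k - 1 := by lia
  have he := chart_mem_atlas E p.base
  have hp := mem_chart_source E p.base
  have hq := coords_mem_jetDom he hp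
  rw [eulerLagrange_iff hk h hL, ← dynamics_iff_localEulerLagrange hk h hL hreg he hq]
  have h1 := covectorCoord_graphMap h hL p hq
  rw [ofCoords_coords he p hp] at h1
  have h2 : ∀ v : JetModel E (2 * k - 1) × (JetModel E (k - 1) →L[ℝ] ℝ),
      unifiedTwo E k Q (graphMap L p)
        (mfderiv 𝓘(ℝ, JetModel E (2 * k - 1)) (unifiedModel E k) (graphMap L) p u) v =
      v.2 (baseTrunc E k u) - fderiv ℝ (localTheta h (chartAt E p.base) L)
        (coords (chartAt E p.base) p) u (baseExtend E k (baseTrunc E k v.1)) := fun v => by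
    rw [mfderiv_graphMap h hL]
    exact unifiedTwo_apply _ _ _
  have h3 : ∀ v : JetModel E (2 * k - 1) × (JetModel E (k - 1) →L[ℝ] ℝ),
      dFun (I := unifiedModel E k) (hamiltonian hk L) (graphMap L p) v =
      v.2 (baseTrunc E k (jetShift E (2 * k - 1) (coords (chartAt E p.base) p))) +
        localTheta h (chartAt E p.base) L (coords (chartAt E p.base) p)
          (baseExtend E k (baseTrunc E k (jetShift E (2 * k - 1) v.1))) -
        fderiv ℝ (flatFun h (chartAt E p.base) L) (coords (chartAt E p.base) p) v.1 := fun v => by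
    refine (dFun_hamiltonian hk h hL (graphMap L p) v).trans ?_
    rw [show (graphMap L p).1 = p from rfl, h1]
    rfl
  constructor
  · intro H v b
    have := H (v, b)
    rwa [h2, h3] at this
  · intro H v
    rw [h2, h3]
    exact H v.1 v.2

lemma _root_.ContDiffOn.flip_sub {V : Type*} [NormedAddCommGroup V] [NormedSpace ℝ V]
    [FiniteDimensional ℝ V] {f : V → V →L[ℝ] V →L[ℝ] ℝ} {s : Set V} (hf : ContDiffOn ℝ ∞ f s) :
    ContDiffOn ℝ ∞ (fun q => (f q).flip - f q) s :=
  contDiffOn_clm_apply.2 fun _ => contDiffOn_clm_apply.2 fun _ =>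
    ((hf.clm_apply contDiffOn_const).clm_apply contDiffOn_const).sub
      ((hf.clm_apply contDiffOn_const).clm_apply contDiffOn_const)

/-- The coordinate expression of the solution of the Euler–Lagrange equations is smooth. -/
lemma exists_local_field [FiniteDimensional ℝ E] (hk : 1 ≤ k) (h : k ≤ 2 * k - 1)
    (hL : ContMDiff 𝓘(ℝ, JetModel E k) 𝓘(ℝ, ℝ) ∞ L) (hreg : IsRegularLagrangian L)
    (he : e ∈ atlas E Q) : ∃ f : JetModel E (2 * k - 1) → JetModel E (2 * k - 1),
      ContDiffOn ℝ ∞ f (jetDom (2 * k - 1) e.target) ∧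
      ∀ q ∈ jetDom (2 * k - 1) e.target, LocalEulerLagrange h e L q (f q) := by
  -- The top components are chosen point by point; smoothness is recovered afterwards from
  -- nondegeneracy of the linear system.
  choose! f hf using fun q (hq : q ∈ jetDom (2 * k - 1) e.target) =>
    (exists_localEulerLagrange hk h hL hreg he hq).imp fun _ => id
  have hU := isOpen_jetDom (N := 2 * k - 1) e.open_target
  refine ⟨_, ?_, hf⟩
  have hθ := contDiffOn_localTheta h hL he
  have hθ' : ContDiffOn ℝ ∞ (fderiv ℝ (localTheta h e L)) (jetDom (2 * k - 1) e.target) :=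
    hθ.fderiv_of_isOpen hU (by simp)
  have hE : ContDiffOn ℝ ∞ (flatEnergy (localTheta h e L) (flatFun h e L))
      (jetDom (2 * k - 1) e.target) :=
    (hθ.clm_apply (jetShift E (2 * k - 1)).contDiff.contDiffOn).sub (contDiffOn_flatFun h hL he)
  refine contDiffOn_of_nondegenerate hU (om := flatOmega (localTheta h e L))
    (β := fderiv ℝ (flatEnergy (localTheta h e L) (flatFun h e L))) ?_
    (hE.fderiv_of_isOpen hU (by simp)) (fun q hq => ContinuousLinearMap.ext (hf q hq))
    fun q hq u hu => flatOmega_nondegenerate hL hreg h he hq u fun v => DFunLike.congr_fun hu v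
  exact hθ'.flip_sub

/-- By uniqueness, a global solution given pointwise has as components in a fixed chart the values
of the local field. -/
lemma eulerLagrange_eq_chartFrame {hk : 1 ≤ k} (h : k ≤ 2 * k - 1)
    (hL : ContMDiff 𝓘(ℝ, JetModel E k) 𝓘(ℝ, ℝ) ∞ L) (hreg : IsRegularLagrangian L)
    (he : e ∈ atlas E Q) {p : HTangent E (2 * k - 1) Q} (hp : p.base ∈ e.source)
    {u v : JetModel E (2 * k - 1)} (hu : EulerLagrange hk L p u)
    (hv : LocalEulerLagrange h e L (coords e p) v) :
    mfderiv 𝓘(ℝ, JetModel E (2 * k - 1)) 𝓘(ℝ, JetModel E (2 * k - 1)) (coords e) p u = v := by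
  obtain ⟨q, hq, rfl⟩ := exists_ofCoords_eq he hp
  rw [coords_ofCoords he hq] at hv
  rw [hu.unique hL hreg ((eulerLagrange_chartFrame_iff hk h hL he hq v).2 hv),
    mfderiv_coords_chartFrame he hq]

/-- The solution of the Euler–Lagrange equations is a smooth vector field. -/
lemma contMDiff_eulerLagrange_section [FiniteDimensional ℝ E] {hk : 1 ≤ k}
    (hL : ContMDiff 𝓘(ℝ, JetModel E k) 𝓘(ℝ, ℝ) ∞ L) (hreg : IsRegularLagrangian L)
    {u : ∀ p : HTangent E (2 * k - 1) Q, TangentSpace 𝓘(ℝ, JetModel E (2 * k - 1)) p}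
    (hu : ∀ p, EulerLagrange hk L p (u p)) :
    ContMDiff 𝓘(ℝ, JetModel E (2 * k - 1)) 𝓘(ℝ, JetModel E (2 * k - 1)).tangent ∞
      fun p => (⟨p, u p⟩ : TangentBundle 𝓘(ℝ, JetModel E (2 * k - 1)) (HTangent E (2 * k - 1) Q)) := by
  have h : k ≤ 2 * k - 1 := by lia
  intro p₀
  have he := chart_mem_atlas E p₀.base
  have hp₀ := mem_chart_source E p₀.base
  obtain ⟨f, hf, hf'⟩ := exists_local_field hk h hL hreg he
  refine (contMDiffAt_section p₀).2 ?_
  have h1 : ContMDiffAt 𝓘(ℝ, JetModel E (2 * k - 1)) 𝓘(ℝ, JetModel E (2 * k - 1)) ∞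
      (f ∘ coords (chartAt E p₀.base)) p₀ := by
    refine ContMDiffAt.comp p₀ (I' := 𝓘(ℝ, JetModel E (2 * k - 1))) ?_
      ((contMDiffOn_coords he).contMDiffAt ((isOpen_base_preimage he).mem_nhds hp₀))
    exact (hf.contDiffAt ((isOpen_jetDom (OpenPartialHomeomorph.open_target _)).mem_nhds
      (coords_mem_jetDom he hp₀))).contMDiffAt
  refine h1.congr_of_eventuallyEq ?_
  filter_upwards [(isOpen_base_preimage he).mem_nhds hp₀] with p hp
  have h2 := TangentBundle.continuousLinearMapAt_trivializationAt
    (I := 𝓘(ℝ, JetModel E (2 * k - 1))) (x₀ := p₀) (x := p) hp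
  have h3 := eulerLagrange_eq_chartFrame h hL hreg he hp (hu p)
    (hf' _ (coords_mem_jetDom he hp))
  refine Eq.trans ?_ h3
  refine Eq.trans ?_ (DFunLike.congr_fun h2 (u p))
  rw [Trivialization.continuousLinearMapAt_apply, Trivialization.coe_linearMapAt_of_mem]
  exact hp

end Dynamics

/-! ### Integral curves are canonical liftings. -/

section Semispray

/-- Solutions of a smooth autonomous differential equation are smooth. -/
lemma contDiffOn_of_hasDerivAt {F : Type*} [NormedAddCommGroup F] [NormedSpace ℝ F] {f : F → F}
    {U : Set F} (hf : ContDiffOn ℝ ∞ f U) {y : ℝ → F} {J : Set ℝ} (hJ : IsOpen J)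
    (hyU : MapsTo y J U) (hy : ∀ s ∈ J, HasDerivAt y (f (y s)) s) : ContDiffOn ℝ ∞ y J := by
  refine contDiffOn_infty.2 fun n => ?_
  induction n with
  | zero => exact contDiffOn_zero.2 fun s hs => (hy s hs).continuousAt.continuousWithinAt
  | succ n ih =>
    refine (contDiffOn_succ_iff_deriv_of_isOpen (n := n) hJ).2
      ⟨fun s hs => (hy s hs).differentiableAt.differentiableWithinAt, by simp, ?_⟩
    -- Bootstrap: if `y` is `C^n`, then so is `y' = f ∘ y`, hence `y` is `C^{n+1}`.
    exact ((hf.of_le (by exact_mod_cast le_top)).comp ih hyU).congr fun s hs => (hy s hs).deriv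

lemma iteratedDeriv_eq_of_chain {F : Type*} [NormedAddCommGroup F] [NormedSpace ℝ F] {N : ℕ}
    {y : ℝ → Fin (N + 1) → F} {J : Set ℝ} (hJ : IsOpen J)
    (hy : ∀ s ∈ J, ∀ (i : ℕ) (hi : i + 1 < N + 1),
      HasDerivAt (fun s => y s ⟨i, by lia⟩) (y s ⟨i + 1, hi⟩) s) :
    ∀ (i : ℕ) (hi : i < N + 1), ∀ s ∈ J, iteratedDeriv i (fun s => y s 0) s = y s ⟨i, hi⟩
  | 0, _, s, _ => by simp
  | i + 1, hi, s, hs => by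
    have h : iteratedDeriv i (fun s => y s 0) =ᶠ[𝓝 s] fun s => y s ⟨i, by lia⟩ := by
      filter_upwards [hJ.mem_nhds hs] with s' hs'
      exact iteratedDeriv_eq_of_chain hJ hy i (by lia) s' hs'
    rw [iteratedDeriv_succ, h.deriv_eq, (hy s hs i hi).deriv]

variable {E : Type*} [NormedAddCommGroup E] [NormedSpace ℝ E] {k : ℕ}
  {Q : Type*} [TopologicalSpace Q] [ChartedSpace E Q] [IsManifold 𝓘(ℝ, E) ∞ Q]
  {L : HTangent E k Q → ℝ}

/-- A curve in `T^m Q` whose natural coordinates are the successive derivatives of the first one is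
a lifting. -/
lemma exists_lift_eq {m : ℕ} {e : OpenPartialHomeomorph Q E} (he : e ∈ atlas E Q)
    {c : ℝ → HTangent E m Q} {t : ℝ} (hc : ∀ᶠ s in 𝓝 t, (c s).base ∈ e.source)
    (hy : ContDiffAt ℝ ∞ (fun s => coords e (c s)) t)
    (hd : ∀ i : Fin (m + 1), iteratedDeriv i (fun s => coords e (c s) 0) t = coords e (c t) i) :
    ∃ h : ContMDiffAt 𝓘(ℝ, ℝ) 𝓘(ℝ, E) ∞ (fun s => (c s).base) t,
      lift m (fun s => (c s).base) t h = c t := by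
  have h0 : (fun s => coords e (c s) 0) =ᶠ[𝓝 t] e ∘ fun s => (c s).base := by
    filter_upwards [hc] with s hs
    exact coords_zero he _ hs
  have hsm : ContMDiffAt 𝓘(ℝ, ℝ) 𝓘(ℝ, E) ∞ (fun s => (c s).base) t := by
    have h1 : ContMDiffAt 𝓘(ℝ, ℝ) 𝓘(ℝ, E) ∞ (e.symm ∘ fun s => coords e (c s) 0) t := by
      refine ContMDiffAt.comp (I' := 𝓘(ℝ, E)) t (contMDiffAt_symm_of_mem_maximalAtlas
        (IsManifold.subset_maximalAtlas he) ?_) (contDiffAt_pi.1 hy 0).contMDiffAt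
      rw [coords_zero he _ hc.self_of_nhds]
      exact e.map_source hc.self_of_nhds
    refine h1.congr_of_eventuallyEq ?_
    filter_upwards [h0, hc] with s hs hs'
    rw [Function.comp_apply, hs, Function.comp_apply, e.left_inv hs']
  refine ⟨hsm, ?_⟩
  have hb : (Curve.shift E (fun s => (c s).base) t hsm).1 0 ∈ e.source := by
    simpa [Curve.shift] using hc.self_of_nhds
  rw [← ofCoords_coords he (c t) hc.self_of_nhds, ← ofCoords_coords he (lift m _ t hsm) hb]
  congr 1
  funext i
  refine (coords_mk he _ hb i).trans ((Eq.trans ?_ (h0.iteratedDeriv_eq _).symm).trans (hd i))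
  have := congrFun (iteratedDeriv_comp_add_const i (e ∘ fun s => (c s).base) t) 0
  rw [zero_add] at this
  exact this

/-- The integral curves of the Euler–Lagrange vector field are liftings. -/
lemma exists_lift_eq_of_eulerLagrange [FiniteDimensional ℝ E] {hk : 1 ≤ k}
    (hL : ContMDiff 𝓘(ℝ, JetModel E k) 𝓘(ℝ, ℝ) ∞ L) (hreg : IsRegularLagrangian L)
    {u : ∀ p : HTangent E (2 * k - 1) Q, TangentSpace 𝓘(ℝ, JetModel E (2 * k - 1)) p}
    (hu : ∀ p, EulerLagrange hk L p (u p)) {c : ℝ → HTangent E (2 * k - 1) Q} {J : Set ℝ}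
    (hJ : IsOpen J) (hc : ∀ t ∈ J, HasMFDerivAt 𝓘(ℝ, ℝ) 𝓘(ℝ, JetModel E (2 * k - 1)) c t
      ((1 : ℝ →L[ℝ] ℝ).smulRight (u (c t)))) {t : ℝ} (ht : t ∈ J) :
    ∃ h : ContMDiffAt 𝓘(ℝ, ℝ) 𝓘(ℝ, E) ∞ (fun s => (c s).base) t,
      lift (2 * k - 1) (fun s => (c s).base) t h = c t := by
  have h : k ≤ 2 * k - 1 := by lia
  set e := chartAt E (c t).base
  have he : e ∈ atlas E Q := chart_mem_atlas E _
  obtain ⟨f, hf, hf'⟩ := exists_local_field hk h hL hreg he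
  have hcont : ContinuousOn c J := fun s hs => (hc s hs).continuousAt.continuousWithinAt
  have hJ' := hcont.isOpen_inter_preimage hJ (isOpen_base_preimage he)
  set J' := J ∩ c ⁻¹' {p | p.base ∈ e.source}
  have htJ' : t ∈ J' := ⟨ht, mem_chart_source E _⟩
  -- In one fixed chart the curve, so far only differentiable, solves an autonomous equation with
  -- smooth right-hand side.
  have hy : ∀ s ∈ J', HasDerivAt (fun s => coords e (c s)) (f (coords e (c s))) s := by
    rintro s ⟨hs, hse⟩
    let D : JetModel E (2 * k - 1) →L[ℝ] JetModel E (2 * k - 1) :=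
      mfderiv 𝓘(ℝ, JetModel E (2 * k - 1)) 𝓘(ℝ, JetModel E (2 * k - 1)) (coords e) (c s)
    let A : ℝ →L[ℝ] JetModel E (2 * k - 1) := D.comp ((1 : ℝ →L[ℝ] ℝ).smulRight (u (c s)))
    have h1 : HasFDerivAt (fun s => coords e (c s)) A s :=
      ((mdifferentiableAt_coords he hse).hasMFDerivAt.comp s (hc s hs)).hasFDerivAt
    refine h1.hasDerivAt.congr_deriv ?_
    rw [← eulerLagrange_eq_chartFrame h hL hreg he hse (hu _)
      (hf' _ (coords_mem_jetDom he hse))]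
    change D ((1 : ℝ) • u (c s)) = _
    rw [one_smul]
    rfl
  have hyU : MapsTo (fun s => coords e (c s)) J' (jetDom (2 * k - 1) e.target) :=
    fun s hs => coords_mem_jetDom he hs.2
  refine exists_lift_eq he (mem_of_superset (hJ'.mem_nhds htJ') fun s hs => hs.2)
    ((contDiffOn_of_hasDerivAt hf hJ' hyU hy).contDiffAt (hJ'.mem_nhds htJ')) fun i =>
    iteratedDeriv_eq_of_chain hJ' (fun s hs i hi => ?_) i i.2 t htJ'
  -- Holonomy of the solution is the chain `y_i' = y_{i+1}`.
  exact (hasDerivAt_pi.1 (hy s hs) _).congr_deriv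
    ((hf' _ (hyU hs)).apply_of_lt hk hL hreg he (hyU hs) ⟨i, by lia⟩ hi)

end Semispray

/-! ### The vector field along the graph. -/

section Field

variable {E : Type*} [NormedAddCommGroup E] [NormedSpace ℝ E] {k : ℕ}
  {Q : Type*} [TopologicalSpace Q] [ChartedSpace E Q] [IsManifold 𝓘(ℝ, E) ∞ Q]
  {L : HTangent E k Q → ℝ}

lemma mdifferentiableAt_totalSpace_proj (w : UnifiedSpace E k Q) :
    MDifferentiableAt (unifiedModel E k) 𝓘(ℝ, JetModel E (2 * k - 1))
      (fun w : UnifiedSpace E k Q => w.1) w :=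
  (Bundle.contMDiff_proj (n := ∞) _ w).mdifferentiableAt (by simp)

/-- The graph map is a section of the projection to `T^{2k-1} Q`. Hence the integral curves of a
tangent field project to integral curves of the field `u` below. -/
lemma mfderiv_proj_mfderiv_graphMap (h : k ≤ 2 * k - 1)
    (hL : ContMDiff 𝓘(ℝ, JetModel E k) 𝓘(ℝ, ℝ) ∞ L)
    (p : HTangent E (2 * k - 1) Q) (u : TangentSpace 𝓘(ℝ, JetModel E (2 * k - 1)) p) :
    mfderiv (unifiedModel E k) 𝓘(ℝ, JetModel E (2 * k - 1)) (fun w : UnifiedSpace E k Q => w.1)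
      (graphMap L p) (mfderiv 𝓘(ℝ, JetModel E (2 * k - 1)) (unifiedModel E k) (graphMap L) p u) =
      u := by
  have h1 := mfderiv_comp_apply p (mdifferentiableAt_totalSpace_proj (graphMap L p))
    ((contMDiff_graphMap h hL p).mdifferentiableAt (by simp)) u
  refine h1.symm.trans ?_
  change mfderiv _ _ (id : HTangent E (2 * k - 1) Q → _) p u = u
  rw [mfderiv_id]
  rfl

/-- The vector field along the graph of the Legendre map that lifts a vector field on
`T^{2k-1} Q`. -/
def liftField (h : k ≤ 2 * k - 1) (hL : ContMDiff 𝓘(ℝ, JetModel E k) 𝓘(ℝ, ℝ) ∞ L)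
    (u : ∀ p : HTangent E (2 * k - 1) Q, TangentSpace 𝓘(ℝ, JetModel E (2 * k - 1)) p)
    (hu : ContMDiff 𝓘(ℝ, JetModel E (2 * k - 1)) 𝓘(ℝ, JetModel E (2 * k - 1)).tangent ∞
      fun p => (⟨p, u p⟩ :
        TangentBundle 𝓘(ℝ, JetModel E (2 * k - 1)) (HTangent E (2 * k - 1) Q))) :
    FieldAlong L where
  toFun w := (mfderiv 𝓘(ℝ, JetModel E (2 * k - 1)) (unifiedModel E k) (graphMap L) w.1.1
    (u w.1.1) : JetModel E (2 * k - 1) × (JetModel E (k - 1) →L[ℝ] ℝ))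
  smooth := ((contMDiff_graphMap h hL).contMDiff_tangentMap (by simp)).comp hu

lemma liftField_solves_iff [FiniteDimensional ℝ E] (hk : 1 ≤ k) {h : k ≤ 2 * k - 1}
    {hL : ContMDiff 𝓘(ℝ, JetModel E k) 𝓘(ℝ, ℝ) ∞ L} (hreg : IsRegularLagrangian L) {u hu} :
    (liftField h hL u hu).Solves hk ↔ ∀ p, EulerLagrange hk L p (u p) :=
  ⟨fun H p => (solves_iff_eulerLagrange hk hL hreg p _).1 (H ⟨graphMap L p, mem_range_self p⟩),
    by
      rintro H ⟨_, p, rfl⟩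
      exact (solves_iff_eulerLagrange hk hL hreg p _).2 (H p)⟩

lemma liftField_isTangent {h : k ≤ 2 * k - 1}
    {hL : ContMDiff 𝓘(ℝ, JetModel E k) 𝓘(ℝ, ℝ) ∞ L} {u hu} : (liftField h hL u hu).IsTangent :=
  fun p => ⟨u p, rfl⟩

namespace FieldAlong

lemma ext_graphMap {X Y : FieldAlong L}
    (H : ∀ p, X.toFun ⟨graphMap L p, mem_range_self p⟩ = Y.toFun ⟨graphMap L p, mem_range_self p⟩) :
    X = Y := by
  obtain ⟨X, hX⟩ := X
  obtain ⟨Y, hY⟩ := Y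
  congr 1
  funext ⟨_, p, rfl⟩
  exact H p

/-- A tangent solution of the dynamical equation projects to a solution of the Euler–Lagrange
equation. -/
lemma exists_eulerLagrange_lift [FiniteDimensional ℝ E] {hk : 1 ≤ k} {X : FieldAlong L}
    (hL : ContMDiff 𝓘(ℝ, JetModel E k) 𝓘(ℝ, ℝ) ∞ L) (hreg : IsRegularLagrangian L)
    (hX : X.Solves hk) (hX' : X.IsTangent) :
    ∃ u : ∀ p : HTangent E (2 * k - 1) Q, TangentSpace 𝓘(ℝ, JetModel E (2 * k - 1)) p,
      ∀ p, EulerLagrange hk L p (u p) ∧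
        mfderiv 𝓘(ℝ, JetModel E (2 * k - 1)) (unifiedModel E k) (graphMap L) p (u p) =
          X.toFun ⟨graphMap L p, mem_range_self p⟩ := by
  choose u hu using hX'
  refine ⟨u, fun p => ⟨(solves_iff_eulerLagrange hk hL hreg p _).1 fun v => ?_, hu p⟩⟩
  rw [hu p]
  exact hX ⟨graphMap L p, mem_range_self p⟩ v

/-- Tangency reduces both fields to fields on `T^{2k-1} Q`, where nondegeneracy of `ω_L` gives
uniqueness. The degenerate form `Ω` alone would not. -/
lemma eq_of_solves [FiniteDimensional ℝ E] {hk : 1 ≤ k} {X Y : FieldAlong L}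
    (hL : ContMDiff 𝓘(ℝ, JetModel E k) 𝓘(ℝ, ℝ) ∞ L) (hreg : IsRegularLagrangian L)
    (hX : X.Solves hk) (hX' : X.IsTangent) (hY : Y.Solves hk) (hY' : Y.IsTangent) : X = Y := by
  obtain ⟨u, hu⟩ := exists_eulerLagrange_lift hL hreg hX hX'
  obtain ⟨v, hv⟩ := exists_eulerLagrange_lift hL hreg hY hY'
  refine ext_graphMap fun p => ?_
  rw [← (hu p).2, ← (hv p).2, (hu p).1.unique hL hreg (hv p).1]

lemma exists_solves [FiniteDimensional ℝ E] (hk : 1 ≤ k)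
    (hL : ContMDiff 𝓘(ℝ, JetModel E k) 𝓘(ℝ, ℝ) ∞ L) (hreg : IsRegularLagrangian L) :
    ∃ X : FieldAlong L, X.Solves hk ∧ X.IsTangent := by
  choose u hu using fun p : HTangent E (2 * k - 1) Q => exists_eulerLagrange hk hL hreg p
  exact ⟨liftField (by lia) hL u (contMDiff_eulerLagrange_section hL hreg hu),
    (liftField_solves_iff hk hreg).2 hu, liftField_isTangent⟩

lemma isSemispray [FiniteDimensional ℝ E] {hk : 1 ≤ k} {X : FieldAlong L}
    (hL : ContMDiff 𝓘(ℝ, JetModel E k) 𝓘(ℝ, ℝ) ∞ L) (hreg : IsRegularLagrangian L)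
    (hX : X.Solves hk) (hX' : X.IsTangent) : X.IsSemispray := by
  obtain ⟨u, hu⟩ := exists_eulerLagrange_lift hL hreg hX hX'
  have hproj : ∀ w (hw : w ∈ graphSubmanifold L),
      mfderiv (unifiedModel E k) 𝓘(ℝ, JetModel E (2 * k - 1)) (fun w : UnifiedSpace E k Q => w.1)
        w (X.toFun ⟨w, hw⟩) = u w.1 := by
    rintro _ ⟨p, rfl⟩
    rw [← (hu p).2]
    exact mfderiv_proj_mfderiv_graphMap (by lia) hL p (u p)
  intro σ J hJ hσ t ht
  refine exists_lift_eq_of_eulerLagrange (c := fun s => (σ s).1) hL hreg (fun p => (hu p).1) hJ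
    (fun s hs => ?_) ht
  obtain ⟨hw, hd⟩ := hσ s hs
  have h1 := (mdifferentiableAt_totalSpace_proj (σ s)).hasMFDerivAt.comp s hd
  refine HasMFDerivAt.congr_mfderiv h1 (ContinuousLinearMap.ext fun r => ?_)
  refine ((mfderiv (unifiedModel E k) 𝓘(ℝ, JetModel E (2 * k - 1))
    (fun w : UnifiedSpace E k Q => w.1) (σ s)).map_smul r _).trans ?_
  rw [hproj]
  rfl

end FieldAlong

end Field

end HigherOrder

end

theorem mainTheorem3 {n k : ℕ} (hk : 1 ≤ k)
    {Q : Type*} [TopologicalSpace Q] [ChartedSpace (EuclideanSpace ℝ (Fin n)) Q]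
    [IsManifold 𝓘(ℝ, EuclideanSpace ℝ (Fin n)) ∞ Q]
    (L : HTangent (EuclideanSpace ℝ (Fin n)) k Q → ℝ)
    (hL : ContMDiff 𝓘(ℝ, JetModel (EuclideanSpace ℝ (Fin n)) k) 𝓘(ℝ, ℝ) ∞ L)
    (hreg : IsRegularLagrangian L) :
    (∃! X : FieldAlong L, X.Solves hk ∧ X.IsTangent) ∧
      ∀ X : FieldAlong L, X.Solves hk → X.IsTangent → X.IsSemispray := by
  obtain ⟨X, hX, hX'⟩ := FieldAlong.exists_solves hk hL hreg
  exact ⟨⟨X, ⟨hX, hX'⟩, fun Y hY => FieldAlong.eq_of_solves hL hreg hY.1 hY.2 hX hX'⟩,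
    fun Y hY hY' => FieldAlong.isSemispray hL hreg hY hY'⟩
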